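/- **Setting.** For $f\in\mathcal S'(\mathbb R^3)$ let $\hat f$ be the Fourier transform with $\hat f(\xi)=\int e^{-ix\cdot\xi}f(x)\,dx$ for integrable $f$. Fix a nonnegative Schwartz function $\psi$ on $\mathbb R^3$ supported in $\{3/4\le|\xi|\le 8/3\}$ with $\sum_{j\in\mathbb Z}\psi(2^{-j}\xi)=1$ for all $\xi\ne0$, and put $\Delta_jf=\mathcal F^{-1}(\psi(2^{-j}\cdot)\hat f)$. Let $$\|f\|_{\dot B^{s}_{p,r}}=\big\|\big(2^{js}\|\Delta_jf\|_{L^p}\big)_{j}\big\|_{\ell^r(\mathbb Z)},\qquad \|f\|_{\dot{FB}^{s}_{p,r}}=\big\|\big(2^{js}\|\widehat{\Delta_jf}\|_{L^p}\big)_{j}\big\|_{\ell^r(\mathbb Z)},$$ $$\|f\|_{\tilde L^{\lambda}(0,\infty;\dot{FB}^{s}_{p,r})}=\big\|\big(2^{js}\|\widehat{\Delta_jf}\|_{L^\lambda(0,\infty;L^p)}\big)_{j}\big\|_{\ell^r(\mathbb Z)},$$ and let $\dot{FB}^{s}_{p,r}$ be the space of tempered distributions $f$ with $\hat f\in L^1_{loc}(\mathbb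 R^3)$ and $\|f\|_{\dot{FB}^{s}_{p,r}}<\infty$. For vector fields, the norms of the components are added. Consider on $\mathbb R^3\times(0,\infty)$ the micropolar fluid system (with viscosity constants $\kappa=\mu=1$, $\chi=\nu=\tfrac12$) $$\begin{cases}\partial_tu-\Delta u+u\cdot\nabla u+\nabla\pi-\nabla\times\omega=0,\\ \partial_t\omega-\Delta\omega+u\cdot\nabla\omega+2\omega-\nabla\operatorname{div}\omega-\nabla\times u=0,\\ \operatorname{div}u=0,\qquad (u,\omega)|_{t=0}=(u_0,\omega_0),\end{cases}$$ for real vector fields $u,\omega$. Let $\mathbf P$ be the Leray projection, with symbol $(\delta_{il}-\xi_i\xi_l/|\xi|^2)_{i,l}$, and let $G(t)$ be the solution operator of the linear system obtained by dropping $u\cdot\nabla u$, $\nabla\pi$ and $u\cdot\nabla\omega$: $\widehat{G(t)f}(\xi)=e^{-t\mathcal A(\xi)}\hat f(\xi)$ with $$\mathcal A(\xi)=\begin{pmatrix}|\xi|^2I&\mathcal B(\xi)\\ \mathcal B(\xi)&(|\xi|^2+2)I+(\xi_i\xi_j)_{i,j}\end{pmatrix},\qquad \mathcal B(\xi)v=-i\,\xi\times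 v.$$ A (global) *mild solution* with data $U_0=(u_0,\omega_0)$, $\operatorname{div}u_0=0$, is $U=(u,\omega)$ with $$U(t)=G(t)U_0-\int_0^tG(t-\tau)\big(\mathbf P\nabla\cdot(u\otimes u),\ \nabla\cdot(u\otimes\omega)\big)(\tau)\,d\tau\qquad(t\ge0).$$ For $\alpha\in(0,1)$ let $$\mathcal X^\alpha=C([0,\infty);\dot{FB}^{-1}_{1,2})\cap\tilde L^{\frac2{1+\alpha}}(0,\infty;\dot{FB}^{\alpha}_{1,2})\cap\tilde L^{\frac2{1-\alpha}}(0,\infty;\dot{FB}^{-\alpha}_{1,2}).$$ **Theorem 1.6.** Let $r\in(2,\infty]$. The system is ill-posed in $\dot B^{-1}_{\infty,r}(\mathbb R^3)$, in the sense that the solution map is discontinuous at the origin. More precisely, there exist a constant $c_0>0$, a sequence of real initial data $f^N=(u_0^N,\omega_0^N)\in\dot{FB}^{-1}_{1,2}(\mathbb R^3)$ with $\operatorname{div}u_0^N=0$, and a sequence of times $t^N>0$ with $$\|f^N\|_{\dot B^{-1}_{\infty,r}}\to0\quad\text{and}\quad t^N\to0\qquad(N\to\infty),$$ and for each $N$ there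 is a global real mild solution $(u,\omega)[f^N]$ with data $f^N$ and $\operatorname{div}u[f^N](t)=0$ for all $t\ge0$, which for every $\alpha\in(0,1)$ lies in $\mathcal X^\alpha$ and is the only such solution in $\mathcal X^\alpha$, such that for all $N$ $$\|u[f^N](t^N)\|_{\dot B^{-1}_{\infty,r}}\ge c_0\quad\text{and}\quad\|\omega[f^N](t^N)\|_{\dot B^{-1}_{\infty,r}}\ge c_0 .$$ -/

import Mathlib

open MeasureTheory Filter Topology
open scoped SchwartzMap FourierTransform ENNReal LineDeriv

noncomputable section

namespace Micropolar

/-- Physical space `ℝ³` with its Euclidean norm (also used for the frequency variable). -/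
abbrev E3 : Type := EuclideanSpace ℝ (Fin 3)

/-- Scalar complex tempered distributions on `ℝ³`. -/
abbrev Dist : Type := 𝓢'(E3, ℂ)

/-- Indices of the six components of `U = (u, ω)`: `Sum.inl i` is `u_i`, `Sum.inr i` is `ω_i`. -/
abbrev Idx : Type := Fin 3 ⊕ Fin 3

/-- Pairs `(u, ω)` of three-dimensional vector fields with tempered-distribution components. -/
abbrev VField : Type := Idx → Dist

/-! ### The Fourier transform with kernel `e^{-i x·ξ}` -/

/-- The dilation `x ↦ x / (2π)` of `ℝ³`. -/
def dilation : E3 ≃L[ℝ] E3 :=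
  ContinuousLinearEquiv.smulLeft (Units.mk0 ((2 * Real.pi)⁻¹ : ℝ) (by positivity))

/-- The Fourier transform `φ ↦ ∫ e^{-i x·ξ} φ(x) dx` on Schwartz functions, obtained by a dilation
from Mathlib's, whose kernel is `e^{-2π i x·ξ}`. -/
def fourierS : 𝓢(E3, ℂ) →L[ℂ] 𝓢(E3, ℂ) :=
  (SchwartzMap.compCLMOfContinuousLinearEquiv ℂ dilation).comp
    (FourierTransform.fourierCLM ℂ 𝓢(E3, ℂ))

/-- The inverse Fourier transform `φ ↦ (2π)⁻³ ∫ e^{i x·ξ} φ(ξ) dξ` on Schwartz functions. -/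
def fourierInvS : 𝓢(E3, ℂ) →L[ℂ] 𝓢(E3, ℂ) :=
  (((2 * Real.pi) ^ 3)⁻¹ : ℂ) •
    (SchwartzMap.compCLMOfContinuousLinearEquiv ℂ dilation).comp
      (FourierTransform.fourierInvCLM ℂ 𝓢(E3, ℂ))

theorem fourierS_apply (φ : 𝓢(E3, ℂ)) (ξ : E3) :
    fourierS φ ξ = ∫ x : E3, Complex.exp (-(Complex.I * ((inner ℝ x ξ : ℝ) : ℂ))) * φ x := by
  have h : fourierS φ ξ = 𝓕 (φ : E3 → ℂ) (dilation ξ) := rfl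
  rw [h, Real.fourier_eq']
  have hd : dilation ξ = (2 * Real.pi)⁻¹ • ξ := rfl
  refine integral_congr_ae (Eventually.of_forall fun x => ?_)
  simp only [smul_eq_mul, hd, inner_smul_right]
  congr 2
  have hpi : (Real.pi : ℂ) ≠ 0 := by exact_mod_cast Real.pi_ne_zero
  push_cast
  field_simp

theorem fourierInvS_apply (φ : 𝓢(E3, ℂ)) (x : E3) :
    fourierInvS φ x = ((2 * Real.pi) ^ 3 : ℂ)⁻¹ *
      ∫ ξ : E3, Complex.exp (Complex.I * ((inner ℝ ξ x : ℝ) : ℂ)) * φ ξ := by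
  have h : fourierInvS φ x =
      (((2 * Real.pi) ^ 3)⁻¹ : ℂ) * 𝓕⁻ (φ : E3 → ℂ) (dilation x) := by
    rw [← SchwartzMap.fourierInv_coe]
    simp [fourierInvS]
  rw [h, Real.fourierInv_eq']
  have hd : dilation x = (2 * Real.pi)⁻¹ • x := rfl
  congr 1
  refine integral_congr_ae (Eventually.of_forall fun ξ => ?_)
  simp only [smul_eq_mul, hd, inner_smul_right]
  congr 2
  have hpi : (Real.pi : ℂ) ≠ 0 := by exact_mod_cast Real.pi_ne_zero
  push_cast
  field_simp

/-- The Fourier transform of a tempered distribution, `⟨f̂, φ⟩ = ⟨f, φ̂⟩`. -/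
def fourierD (f : Dist) : Dist := PointwiseConvergenceCLM.precomp ℂ fourierS f

/-- The inverse Fourier transform of a tempered distribution. -/
def fourierInvD (f : Dist) : Dist := PointwiseConvergenceCLM.precomp ℂ fourierInvS f

/-- `f̂ ∈ L¹_loc`, with `f̂` given by the function `g`. -/
def HasFourierDensity (f : Dist) (g : E3 → ℂ) : Prop :=
  LocallyIntegrable g volume ∧
    ∀ φ : 𝓢(E3, ℂ), HasCompactSupport φ → fourierD f φ = ∫ ξ : E3, φ ξ * g ξ

/-- `f` is a real distribution: it takes real values on real test functions. -/
def IsRealDist (f : Dist) : Prop :=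
  ∀ φ : 𝓢(E3, ℂ), (∀ x, (φ x).im = 0) → (f φ).im = 0

/-- `div u = 0` in the sense of distributions. -/
def IsDivFree (u : Fin 3 → Dist) : Prop :=
  ∑ k : Fin 3, ∂_{(EuclideanSpace.single k (1 : ℝ) : E3)} (u k) = 0

/-! ### Littlewood–Paley blocks, Besov and Fourier–Besov norms -/

/-- `ψ` generates a homogeneous dyadic partition of unity: it is a nonnegative Schwartz function
supported in `{3/4 ≤ |ξ| ≤ 8/3}` with `∑_{j ∈ ℤ} ψ(2^{-j} ξ) = 1` for `ξ ≠ 0`. -/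
structure IsDyadicPartition (ψ : 𝓢(E3, ℝ)) : Prop where
  nonneg : ∀ ξ, 0 ≤ ψ ξ
  support : ∀ ξ, ψ ξ ≠ 0 → 3 / 4 ≤ ‖ξ‖ ∧ ‖ξ‖ ≤ 8 / 3
  sum_eq_one : ∀ ξ, ξ ≠ 0 → HasSum (fun j : ℤ => ψ ((2 : ℝ) ^ (-j) • ξ)) 1

/-- The symbol `ξ ↦ ψ(2^{-j} ξ)`. -/
def dyadicSymbol (ψ : 𝓢(E3, ℝ)) (j : ℤ) : E3 → ℂ := fun ξ => ((ψ ((2 : ℝ) ^ (-j) • ξ) : ℝ) : ℂ)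

/-- Multiplication of tempered distributions by `ψ(2^{-j} ξ)` is the genuine one. -/
theorem dyadicSymbol_hasTemperateGrowth (ψ : 𝓢(E3, ℝ)) (j : ℤ) :
    (dyadicSymbol ψ j).HasTemperateGrowth := by
  have h1 : Function.HasTemperateGrowth fun ξ : E3 => (2 : ℝ) ^ (-j) • ξ :=
    ((2 : ℝ) ^ (-j) • ContinuousLinearMap.id ℝ E3).hasTemperateGrowth
  exact Complex.ofRealCLM.hasTemperateGrowth.comp (ψ.hasTemperateGrowth.comp h1)

/-- The dyadic block `Δ_j f = F⁻¹(ψ(2^{-j} ξ) f̂(ξ))`. -/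
def dyadicBlock (ψ : 𝓢(E3, ℝ)) (j : ℤ) (f : Dist) : Dist :=
  fourierInvD (TemperedDistribution.smulLeftCLM ℂ (dyadicSymbol ψ j) (fourierD f))

/-- The `L^p` norm of a tempered distribution: `‖h‖_{L^p}` if the distribution is given by a
function `h ∈ L^p` (which is then unique up to null sets), and `∞` otherwise. -/
def distLpNorm (p : ℝ≥0∞) (f : Dist) : ℝ≥0∞ :=
  ⨅ (h : E3 → ℂ) (_ : MemLp h p volume) (_ : ∀ φ : 𝓢(E3, ℂ), f φ = ∫ x : E3, φ x * h x),
    eLpNorm h p volume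

/-- The `ℓ^r(ℤ)` norm of a nonnegative sequence. -/
def seqNorm (r : ℝ≥0∞) (a : ℤ → ℝ≥0∞) : ℝ≥0∞ :=
  if r = ∞ then ⨆ j, a j else (∑' j, a j ^ r.toReal) ^ (1 / r.toReal)

/-- The homogeneous Besov norm `‖f‖_{Ḃ^s_{p,r}}`. -/
def besovNorm (ψ : 𝓢(E3, ℝ)) (s : ℝ) (p r : ℝ≥0∞) (f : Dist) : ℝ≥0∞ :=
  seqNorm r fun j => (2 : ℝ≥0∞) ^ ((j : ℝ) * s) * distLpNorm p (dyadicBlock ψ j f)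

/-- The homogeneous Fourier–Besov norm `‖f‖_{FḂ^s_{p,r}}`. -/
def fbNorm (ψ : 𝓢(E3, ℝ)) (s : ℝ) (p r : ℝ≥0∞) (f : Dist) : ℝ≥0∞ :=
  seqNorm r fun j => (2 : ℝ≥0∞) ^ ((j : ℝ) * s) * distLpNorm p (fourierD (dyadicBlock ψ j f))

/-- `f ∈ FḂ^s_{p,r}`: `f̂ ∈ L¹_loc` and the norm is finite. A class of tempered distributions modulo
polynomials has at most one member with `f̂ ∈ L¹_loc`, which represents it here. -/
def MemFB (ψ : 𝓢(E3, ℝ)) (s : ℝ) (p r : ℝ≥0∞) (f : Dist) : Prop :=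
  (∃ g, HasFourierDensity f g) ∧ fbNorm ψ s p r f < ∞

/-- The Chemin–Lerner norm of `L̃^l(0, ∞; FḂ^s_{p,r})`: the `ℓ^r` norm over `j` of
`2^{js} ‖F(Δ_j f)‖_{L^l(0, ∞; L^p)}`. -/
def clNorm (ψ : 𝓢(E3, ℝ)) (l : ℝ≥0∞) (s : ℝ) (p r : ℝ≥0∞) (f : ℝ → Dist) : ℝ≥0∞ :=
  seqNorm r fun j => (2 : ℝ≥0∞) ^ ((j : ℝ) * s) *
    eLpNorm (fun t => distLpNorm p (fourierD (dyadicBlock ψ j (f t)))) l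
      (volume.restrict (Set.Ioi (0 : ℝ)))

/-- The Besov norm of a vector field (sum over the components). -/
def besovNormVec {ι : Type} [Fintype ι] (ψ : 𝓢(E3, ℝ)) (s : ℝ) (p r : ℝ≥0∞) (f : ι → Dist) :
    ℝ≥0∞ :=
  ∑ a, besovNorm ψ s p r (f a)

/-! ### The micropolar system (with `κ = μ = 1`, `χ = ν = 1/2`) -/

/-- The symbol `𝓑(ξ)` of `-∇×`. -/
def curlSymbol (ξ : E3) : Matrix (Fin 3) (Fin 3) ℂ :=
  Complex.I • !![0, (ξ 2 : ℂ), -(ξ 1 : ℂ); -(ξ 2 : ℂ), 0, (ξ 0 : ℂ); (ξ 1 : ℂ), -(ξ 0 : ℂ), 0]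

/-- The symbol `𝓒(ξ) = (ξ_i ξ_j)` of `-∇ div`. -/
def gradDivSymbol (ξ : E3) : Matrix (Fin 3) (Fin 3) ℂ :=
  Matrix.of fun i j => (ξ i : ℂ) * (ξ j : ℂ)

/-- The symbol `𝓐(ξ)` of the linear part; the linear solution operator is
`(G(t) f)^(ξ) = e^{-t 𝓐(ξ)} f̂(ξ)`. -/
def linSymbol (ξ : E3) : Matrix Idx Idx ℂ :=
  Matrix.fromBlocks (((‖ξ‖ ^ 2 : ℝ) : ℂ) • 1) (curlSymbol ξ) (curlSymbol ξ)
    (((‖ξ‖ ^ 2 + 2 : ℝ) : ℂ) • 1 + gradDivSymbol ξ)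

/-- The Fourier symbol `e^{-t 𝓐(ξ)}` of `G(t)`. -/
def semigroupSymbol (t : ℝ) (ξ : E3) : Matrix Idx Idx ℂ :=
  NormedSpace.exp ((-(t : ℂ)) • linSymbol ξ)

/-- The Fourier transform `(2π)⁻³ (f * g)` of the product of the two functions whose Fourier
transforms are `f` and `g`. -/
def fourierProd (f g : E3 → ℂ) (ξ : E3) : ℂ :=
  ((2 * Real.pi) ^ 3 : ℂ)⁻¹ * ∫ η : E3, f (ξ - η) * g η

/-- The Fourier transform of the vector `(∇·(u ⊗ w))_l = ∑_k ∂_k (u_k w_l)`, in terms of the Fourier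
transforms of `u` and `w`. -/
def divTensor (u w : Fin 3 → E3 → ℂ) (ξ : E3) (l : Fin 3) : ℂ :=
  ∑ k : Fin 3, Complex.I * (ξ k : ℂ) * fourierProd (u k) (w l) ξ

/-- The symbol `δ_{il} - ξ_i ξ_l / |ξ|²` of the Leray projection. -/
def leraySymbol (ξ : E3) : Matrix (Fin 3) (Fin 3) ℂ :=
  Matrix.of fun i l => (if i = l then 1 else 0) - (ξ i : ℂ) * (ξ l : ℂ) / ((‖ξ‖ ^ 2 : ℝ) : ℂ)

/-- The Fourier transform of `(P ∇·(u ⊗ u), ∇·(u ⊗ ω))`, where `v` is the Fourier transform of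
`U = (u, ω)`. -/
def nonlinearity (v : E3 → Idx → ℂ) (ξ : E3) : Idx → ℂ :=
  Sum.elim
    ((leraySymbol ξ).mulVec
      (divTensor (fun k η => v η (Sum.inl k)) (fun k η => v η (Sum.inl k)) ξ))
    (divTensor (fun k η => v η (Sum.inl k)) (fun k η => v η (Sum.inr k)) ξ)

/-- `U` is a (global) mild solution with initial data `U₀`, i.e. for all `t ≥ 0`
`U(t) = G(t) U₀ - ∫₀ᵗ G(t-τ) (P ∇·(u ⊗ u), ∇·(u ⊗ ω))(τ) dτ`.
The equation is written for the Fourier transforms `v(t, ·)` of `U(t)`; for almost every time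
`v(t, ·)` is integrable, so that the products are products of bounded functions, and the time
integral converges absolutely. -/
def IsMildSolution (U₀ : VField) (U : ℝ → VField) : Prop :=
  ∃ (v₀ : E3 → Idx → ℂ) (v : ℝ → E3 → Idx → ℂ),
    (∀ a, HasFourierDensity (U₀ a) (fun ξ => v₀ ξ a)) ∧
    (∀ t, 0 ≤ t → ∀ a, HasFourierDensity (U t a) (fun ξ => v t ξ a)) ∧
    AEStronglyMeasurable (fun z : ℝ × E3 => v z.1 z.2)
      ((volume.restrict (Set.Ioi (0 : ℝ))).prod volume) ∧
    (∀ᵐ t ∂(volume.restrict (Set.Ioi (0 : ℝ))), Integrable (v t) volume) ∧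
    ∀ t, 0 ≤ t → ∀ᵐ ξ ∂(volume : Measure E3),
      IntegrableOn (fun τ => (semigroupSymbol (t - τ) ξ).mulVec (nonlinearity (v τ) ξ))
        (Set.Ioc 0 t) volume ∧
      v t ξ = (semigroupSymbol t ξ).mulVec (v₀ ξ) -
        ∫ τ in Set.Ioc 0 t, (semigroupSymbol (t - τ) ξ).mulVec (nonlinearity (v τ) ξ)

/-- `U ∈ C([0, ∞); FḂ^{-1}_{1,2})`. -/
def IsContinuousFB (ψ : 𝓢(E3, ℝ)) (U : ℝ → VField) : Prop :=
  ∀ a, ∀ t, 0 ≤ t → MemFB ψ (-1) 1 2 (U t a) ∧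
    Tendsto (fun s => fbNorm ψ (-1) 1 2 (U s a - U t a)) (𝓝[Set.Ici 0] t) (𝓝 0)

/-- `U = (u, ω)` is a real global mild solution of the micropolar system with data `U₀`, in the class
`C([0, ∞); FḂ^{-1}_{1,2}) ∩ L̃^{2/(1+α)}(0, ∞; FḂ^α_{1,2}) ∩ L̃^{2/(1-α)}(0, ∞; FḂ^{-α}_{1,2})`. -/
structure IsSolution (ψ : 𝓢(E3, ℝ)) (α : ℝ) (U₀ : VField) (U : ℝ → VField) : Prop where
  initial : U 0 = U₀
  real : ∀ t, 0 ≤ t → ∀ a, IsRealDist (U t a)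
  divFree : ∀ t, 0 ≤ t → IsDivFree (fun k => U t (Sum.inl k))
  continuous : IsContinuousFB ψ U
  high : ∀ a, clNorm ψ (ENNReal.ofReal (2 / (1 + α))) α 1 2 (fun t => U t a) < ∞
  low : ∀ a, clNorm ψ (ENNReal.ofReal (2 / (1 - α))) (-α) 1 2 (fun t => U t a) < ∞
  mild : IsMildSolution U₀ U

end Micropolar

end

open Micropolar

open scoped Matrix

noncomputable section

namespace Micropolar

/-! Everything happens on the Fourier side, in the critical space `Z = L²(0,∞; L¹(dξ))`, whose norm
is `znorm` or `vnorm`.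

Well-posedness. The Duhamel term is dominated by `∫₀ᵗ |ξ| e^{-(t-τ)|ξ|²/2} (|v| * |v|)(τ, ξ) dτ`.
The kernel `|ξ| e^{-(t-τ)|ξ|²/2}` has `L²` norm at most one in `t`, uniformly in `ξ` and `τ`, so
Minkowski's inequality, Young's inequality for `L¹ * L¹` and Cauchy–Schwarz in time bound the
bilinear map on `Z` (`znorm_duhMaj_le`). Picard iteration then solves the equation for small data
(`exists_mild`), and a continuation argument in time gives uniqueness in all of `Z`
(`IsFreqSolution.unique`). The classes `X^α` are linked to `Z` in both directions. Each of them
embeds into `Z`, because products of distinct dyadic blocks decay geometrically in time average and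
Schur's test sums them (`znorm_lt_top_of_mixed`). Conversely a solution in `Z` has a forcing in
`L¹(dt dξ)`, so its Duhamel term has `ℓ¹`-summable block bounds, and with data in `FḂ^{-1}_{1,2}` it
lies in every `X^α` (`IsFreqSolution.exists_isParabolic`).

Ill-posedness. The data consist of `n = N + 1` bumps of fixed width at the frequencies `±(3/2) 2^k
e₃`, `K ≤ k < K + n`, with amplitude `a = δ / √n` in the scaling of `FḂ^{-1}`. Their `FḂ^{-1}_{1,2}`
norm is of order at most `δ`, whereas their `Ḃ^{-1}_{∞,r}` norm is of order at most `a n^{1/r} = δ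
n^{1/r - 1/2}`, which tends to zero because `r > 2`. In the quadratic term each bump meets its
reflected copy and produces frequencies of order one, with a contribution of order `a² 4^k ∫₀ᵗ
e^{-8·4^k τ} dτ`. This is of order `a²` as soon as `4^k t ≥ 1`. On a suitable region of low
frequencies all contributions have the same sign and add up to a multiple of `a² n = δ²`
(`testFun_integral_nonlinearity_ge`).

The rest is perturbation. The linear flow differs from the heat flow by a relative error `2^{-K}` at
frequencies above `2^K`. It is within `O(t)` of the identity at low frequencies. Replacing the
solution by the heat flow of the data costs `O(δ³ + 2^{-K} δ²)` in the quadratic term. At time `t =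
2^{-K}` and for small `δ` and large `K` the resonant term wins (`exists_inflation`). Both fields
inflate because both start from the same solenoidal field, and the quantity tested, a component of
the curl, does not see the Leray projection. -/

/-! ### Fourier inversion and density of compactly supported functions -/

theorem fourierS_eq (φ : 𝓢(E3, ℂ)) (ξ : E3) : fourierS φ ξ = 𝓕 φ (dilation ξ) := rfl

theorem fourierInvS_eq (φ : 𝓢(E3, ℂ)) (x : E3) :
    fourierInvS φ x = (((2 * Real.pi) ^ 3)⁻¹ : ℂ) * 𝓕⁻ φ (dilation x) := by
  simp [fourierInvS]

theorem dilation_apply (x : E3) : dilation x = (2 * Real.pi)⁻¹ • x := rfl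

theorem fourierInvS_fourierS (φ : 𝓢(E3, ℂ)) : fourierInvS (fourierS φ) = φ := by
  ext x
  have hφ : 𝓕⁻ (𝓕 φ) x = φ x := by rw [FourierTransform.fourierInv_fourier_eq]
  rw [← hφ, SchwartzMap.fourierInv_coe (𝓕 φ), Real.fourierInv_eq', fourierInvS_apply]
  have h := Measure.integral_comp_smul (volume : Measure E3)
    (fun v : E3 => Complex.exp (↑(2 * Real.pi * inner ℝ v x) * Complex.I) • 𝓕 φ v)
    ((2 * Real.pi)⁻¹)
  have hpi : (Real.pi : ℂ) ≠ 0 := by exact_mod_cast Real.pi_ne_zero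
  have h2 : ∀ ξ : E3, Complex.exp (Complex.I * ((inner ℝ ξ x : ℝ) : ℂ)) * fourierS φ ξ =
      Complex.exp (↑(2 * Real.pi * inner ℝ ((2 * Real.pi)⁻¹ • ξ) x) * Complex.I) •
        𝓕 φ ((2 * Real.pi)⁻¹ • ξ) := by
    intro ξ
    rw [fourierS_eq, dilation_apply, smul_eq_mul, real_inner_smul_left]
    congr 2
    push_cast
    field_simp
  simp_rw [h2]
  rw [h]
  have h3 : |(((2 * Real.pi)⁻¹ ^ Module.finrank ℝ E3)⁻¹ : ℝ)| = (2 * Real.pi) ^ 3 := by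
    rw [abs_of_pos (by positivity), ← inv_pow, inv_inv]; simp
  rw [h3, Complex.real_smul, ← mul_assoc]
  push_cast
  rw [inv_mul_cancel₀ (by simp [hpi]), one_mul]

theorem fourierS_fourierInvS (φ : 𝓢(E3, ℂ)) : fourierS (fourierInvS φ) = φ := by
  ext x
  have hφ : 𝓕 (𝓕⁻ φ) x = φ x := by rw [FourierTransform.fourier_fourierInv_eq]
  rw [← hφ, SchwartzMap.fourier_coe (𝓕⁻ φ), Real.fourier_eq', fourierS_apply]
  have h := Measure.integral_comp_smul (volume : Measure E3)
    (fun v : E3 => Complex.exp (↑(-2 * Real.pi * inner ℝ v x) * Complex.I) • 𝓕⁻ φ v)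
    ((2 * Real.pi)⁻¹)
  have hpi : (Real.pi : ℂ) ≠ 0 := by exact_mod_cast Real.pi_ne_zero
  have h2 : ∀ ξ : E3, Complex.exp (-(Complex.I * ((inner ℝ ξ x : ℝ) : ℂ))) * fourierInvS φ ξ =
      (((2 * Real.pi) ^ 3)⁻¹ : ℂ) *
      (Complex.exp (↑(-2 * Real.pi * inner ℝ ((2 * Real.pi)⁻¹ • ξ) x) * Complex.I) •
        𝓕⁻ φ ((2 * Real.pi)⁻¹ • ξ)) := by
    intro ξ
    rw [fourierInvS_eq, dilation_apply, smul_eq_mul, real_inner_smul_left, mul_left_comm]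
    congr 3
    push_cast
    field_simp
  simp_rw [h2]
  rw [integral_const_mul, h]
  have h3 : |(((2 * Real.pi)⁻¹ ^ Module.finrank ℝ E3)⁻¹ : ℝ)| = (2 * Real.pi) ^ 3 := by
    rw [abs_of_pos (by positivity), ← inv_pow, inv_inv]; simp
  rw [h3, Complex.real_smul, ← mul_assoc]
  push_cast
  rw [inv_mul_cancel₀ (by simp [hpi]), one_mul]

theorem fourierD_apply (f : Dist) (φ : 𝓢(E3, ℂ)) : fourierD f φ = f (fourierS φ) := rfl

theorem fourierInvD_apply (f : Dist) (φ : 𝓢(E3, ℂ)) : fourierInvD f φ = f (fourierInvS φ) := rfl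

theorem fourierD_fourierInvD (f : Dist) : fourierD (fourierInvD f) = f := by
  ext φ
  rw [fourierD_apply, fourierInvD_apply, fourierInvS_fourierS]

theorem fourierInvD_fourierD (f : Dist) : fourierInvD (fourierD f) = f := by
  ext φ
  rw [fourierInvD_apply, fourierD_apply, fourierS_fourierInvS]

/-- Compactly supported smooth functions are dense in the Schwartz space. -/
theorem exists_seq_hasCompactSupport_tendsto (φ : 𝓢(E3, ℂ)) :
    ∃ u : ℕ → 𝓢(E3, ℂ), (∀ n, HasCompactSupport (u n)) ∧ Tendsto u atTop (𝓝 φ) := by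
  let b : ContDiffBump (0 : E3) := ⟨1, 2, one_pos, one_lt_two⟩
  let χ : E3 → ℂ := fun x => ((b x : ℝ) : ℂ)
  have hχs : ContDiff ℝ (⊤ : ℕ∞) χ := Complex.ofRealCLM.contDiff.comp b.contDiff
  have hχc : HasCompactSupport χ := b.hasCompactSupport.comp_left Complex.ofReal_zero
  have hc : ∀ n : ℕ, ((n : ℝ) + 1)⁻¹ ≠ 0 := fun n => by positivity
  let χn : ℕ → E3 → ℂ := fun n x => χ (((n : ℝ) + 1)⁻¹ • x)
  have hχns : ∀ n, ContDiff ℝ (⊤ : ℕ∞) (χn n) := fun n => hχs.comp (contDiff_const_smul _)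
  have hχnc : ∀ n, HasCompactSupport (χn n) := fun n =>
    hχc.comp_homeomorph (Homeomorph.smulOfNeZero _ (hc n))
  have hχnt : ∀ n, (χn n).HasTemperateGrowth := fun n =>
    (hχnc n).hasTemperateGrowth (hχns n)
  -- The derivatives of `χ(x/(n+1)) - 1` are bounded uniformly in `n`, since each one brings out a
  -- factor `1/(n+1) ≤ 1`.
  have hbd : ∀ i : ℕ, ∃ C : ℝ, 0 ≤ C ∧ ∀ n x, ‖iteratedFDeriv ℝ i (fun y => χn n y - 1) x‖ ≤ C := by
    intro i
    have hs : ContDiff ℝ (⊤ : ℕ∞) (fun y => χ y - 1) := hχs.sub contDiff_const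
    have hb : ∃ C : ℝ, ∀ x, ‖iteratedFDeriv ℝ i (fun y => χ y - 1) x‖ ≤ C := by
      have h1 : ∃ C : ℝ, ∀ x, ‖iteratedFDeriv ℝ i χ x‖ ≤ C :=
        (hχs.continuous_iteratedFDeriv (mod_cast le_top)).bounded_above_of_compact_support
          (hχc.iteratedFDeriv i)
      obtain ⟨C, hC⟩ := h1
      refine ⟨C + ‖iteratedFDeriv ℝ i (fun _ : E3 => (1 : ℂ)) 0‖, fun x => ?_⟩
      have : iteratedFDeriv ℝ i (fun y => χ y - 1) x = iteratedFDeriv ℝ i χ x -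
          iteratedFDeriv ℝ i (fun _ : E3 => (1 : ℂ)) x :=
        iteratedFDeriv_sub_apply (hχs.contDiffAt.of_le (mod_cast le_top)) contDiffAt_const
      rw [this]
      refine (norm_sub_le _ _).trans (add_le_add (hC x) (le_of_eq ?_))
      rcases Nat.eq_zero_or_pos i with rfl | hi
      · simp
      · rw [iteratedFDeriv_const_of_ne hi.ne']; simp
    obtain ⟨C, hC⟩ := hb
    refine ⟨C, (norm_nonneg _).trans (hC 0), fun n x => ?_⟩
    have : iteratedFDeriv ℝ i (fun y => χn n y - 1) x =
        (((n : ℝ) + 1)⁻¹) ^ i • iteratedFDeriv ℝ i (fun y => χ y - 1) (((n : ℝ) + 1)⁻¹ • x) := by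
      have := iteratedFDeriv_comp_const_smul (i := i) (𝕜 := ℝ) (f := fun y => χ y - 1)
        (((n : ℝ) + 1)⁻¹) (hs.of_le (mod_cast le_top))
      exact congrFun this x
    rw [this, norm_smul]
    have h1 : ‖(((n : ℝ) + 1)⁻¹) ^ i‖ ≤ 1 := by
      rw [norm_pow]
      refine pow_le_one₀ (norm_nonneg _) ?_
      rw [Real.norm_of_nonneg (by positivity)]
      exact inv_le_one_of_one_le₀ (by linarith [(Nat.cast_nonneg n : (0 : ℝ) ≤ n)])
    calc _ ≤ 1 * C := mul_le_mul h1 (hC _) (norm_nonneg _) zero_le_one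
      _ = C := one_mul C
  refine ⟨fun n => SchwartzMap.smulLeftCLM ℂ (χn n) φ, fun n => ?_, ?_⟩
  · rw [SchwartzMap.smulLeftCLM_apply (hχnt n)]
    exact (hχnc n).smul_right
  rw [(schwartz_withSeminorms ℂ E3 ℂ).tendsto_nhds_atTop]
  rintro ⟨k, m⟩ ε hε
  choose C hC0 hC using hbd
  let M : ℝ := ∑ i ∈ Finset.range (m + 1), (m.choose i : ℝ) * C i *
    SchwartzMap.seminorm ℂ (k + 1) (m - i) φ
  have hM : 0 ≤ M := Finset.sum_nonneg fun i _ =>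
    mul_nonneg (mul_nonneg (Nat.cast_nonneg _) (hC0 i)) (apply_nonneg _ _)
  obtain ⟨n₀, hn₀⟩ := exists_nat_gt (M / ε)
  refine ⟨n₀, fun n hn => ?_⟩
  have hn1 : (0 : ℝ) < (n : ℝ) + 1 := by positivity
  have hfun : ((SchwartzMap.smulLeftCLM ℂ (χn n) φ - φ : 𝓢(E3, ℂ)) : E3 → ℂ) =
      fun x => (χn n x - 1) * φ x := by
    ext x
    simp [SchwartzMap.smulLeftCLM_apply_apply (hχnt n), sub_mul]
  -- For `|x| < n + 1` the cutoff equals one near `x` and nothing remains. Elsewhere `1 ≤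
  -- |x|/(n+1)`, so one extra power of `|x|`, taken from the decay of `φ`, pays for the factor
  -- `1/(n+1)`.
  have key : SchwartzMap.seminorm ℂ k m (SchwartzMap.smulLeftCLM ℂ (χn n) φ - φ) ≤
      M / ((n : ℝ) + 1) := by
    refine SchwartzMap.seminorm_le_bound ℂ k m _ (by positivity) fun x => ?_
    rw [hfun]
    rcases lt_or_ge ‖x‖ ((n : ℝ) + 1) with hx | hx
    · have hev : (fun x => (χn n x - 1) * φ x) =ᶠ[𝓝 x] fun _ => 0 := by
        filter_upwards [(isOpen_lt continuous_norm continuous_const).mem_nhds hx] with y hy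
        have : b (((n : ℝ) + 1)⁻¹ • y) = 1 := by
          apply b.one_of_mem_closedBall
          rw [mem_closedBall_zero_iff, norm_smul, Real.norm_of_nonneg (by positivity)]
          change _ ≤ (1 : ℝ)
          rw [inv_mul_le_iff₀ hn1, mul_one]
          exact le_of_lt hy
        simp [χn, χ, this]
      rw [(Filter.EventuallyEq.iteratedFDeriv ℝ hev m).eq_of_nhds]
      have : iteratedFDeriv ℝ m (fun _ : E3 => (0 : ℂ)) x = 0 := by
        simp
      rw [this, norm_zero, mul_zero]
      positivity
    · have h1 := norm_iteratedFDeriv_mul_le (𝕜 := ℝ) (N := ((⊤ : ℕ∞) : WithTop ℕ∞)) (f := fun x => χn n x - 1)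
        (g := (φ : E3 → ℂ)) (((hχns n).sub contDiff_const))
        (φ.smooth ⊤) x (n := m) (mod_cast le_top)
      have hx0 : 0 < ‖x‖ := hn1.trans_le hx
      have h2 : ‖x‖ ^ k ≤ ‖x‖ ^ (k + 1) / ((n : ℝ) + 1) := by
        rw [le_div_iff₀ hn1, pow_succ]
        gcongr
      calc _ ≤ (‖x‖ ^ (k + 1) / ((n : ℝ) + 1)) * ∑ i ∈ Finset.range (m + 1), (m.choose i : ℝ) *
            ‖iteratedFDeriv ℝ i (fun x => χn n x - 1) x‖ * ‖iteratedFDeriv ℝ (m - i) φ x‖ := by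
            gcongr
        _ = (∑ i ∈ Finset.range (m + 1), (m.choose i : ℝ) *
            ‖iteratedFDeriv ℝ i (fun x => χn n x - 1) x‖ *
            (‖x‖ ^ (k + 1) * ‖iteratedFDeriv ℝ (m - i) φ x‖)) / ((n : ℝ) + 1) := by
            rw [div_mul_eq_mul_div, Finset.mul_sum]
            congr 1
            exact Finset.sum_congr rfl fun i _ => by ring
        _ ≤ _ := by
            refine div_le_div_of_nonneg_right (Finset.sum_le_sum fun i _ => ?_) hn1.le
            exact mul_le_mul (mul_le_mul_of_nonneg_left (hC i n x) (Nat.cast_nonneg _))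
              (SchwartzMap.le_seminorm ℂ _ _ φ x) (by positivity)
              (mul_nonneg (Nat.cast_nonneg _) (hC0 i))
  refine key.trans_lt ?_
  rw [div_lt_iff₀ hn1]
  rw [div_lt_iff₀ hε] at hn₀
  have : (n₀ : ℝ) ≤ n := by exact_mod_cast hn
  nlinarith

/-! ### Distributions given by a Fourier density -/

section

/-- The smooth weight `1 + |ξ|²`. -/
def japanese (ξ : E3) : ℂ := ((1 + ‖ξ‖ ^ 2 : ℝ) : ℂ)

theorem japanese_hasTemperateGrowth : japanese.HasTemperateGrowth := by
  have h : (fun ξ : E3 => (1 + ‖ξ‖ ^ 2 : ℝ)).HasTemperateGrowth :=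
    (Function.HasTemperateGrowth.const 1).add (Function.hasTemperateGrowth_norm_sq (H := E3))
  exact Complex.ofRealCLM.hasTemperateGrowth.comp h

theorem japanese_ne_zero (ξ : E3) : japanese ξ ≠ 0 :=
  Complex.ofReal_ne_zero.2 (by positivity)

theorem continuous_japanese : Continuous japanese := by unfold japanese; fun_prop

/-- Functions `g` with `∫ |g(ξ)| / (1 + |ξ|²) dξ < ∞`. -/
def IsTemperedDensity (g : E3 → ℂ) : Prop :=
  Integrable (fun ξ => (japanese ξ)⁻¹ * g ξ) volume

open Classical in
/-- The tempered distribution whose Fourier transform is the function `g`. -/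
def ofDensity (g : E3 → ℂ) : Dist :=
  if h : IsTemperedDensity g then
    fourierInvD (TemperedDistribution.smulLeftCLM ℂ japanese
      (Lp.toTemperedDistribution ((memLp_one_iff_integrable.2 h).toLp _)))
  else 0

theorem IsTemperedDensity.integrable_mul {g : E3 → ℂ} (hg : IsTemperedDensity g)
    (φ : 𝓢(E3, ℂ)) : Integrable (fun ξ => φ ξ * g ξ) volume := by
  have h1 : (fun ξ => φ ξ * g ξ) = fun ξ =>
      (SchwartzMap.smulLeftCLM ℂ japanese φ) ξ * ((japanese ξ)⁻¹ * g ξ) := by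
    ext ξ
    rw [SchwartzMap.smulLeftCLM_apply_apply japanese_hasTemperateGrowth, smul_eq_mul]
    field_simp [japanese_ne_zero ξ]
  rw [h1]
  exact Integrable.bdd_mul hg (SchwartzMap.continuous _).aestronglyMeasurable
    (Eventually.of_forall fun ξ => SchwartzMap.norm_le_seminorm ℂ _ ξ)

theorem fourierD_ofDensity_apply {g : E3 → ℂ} (hg : IsTemperedDensity g) (φ : 𝓢(E3, ℂ)) :
    fourierD (ofDensity g) φ = ∫ ξ, φ ξ * g ξ := by
  rw [ofDensity, dif_pos hg, fourierD_fourierInvD,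
    TemperedDistribution.smulLeftCLM_apply_apply, Lp.toTemperedDistribution_apply]
  refine integral_congr_ae ?_
  filter_upwards [(memLp_one_iff_integrable.2 hg).coeFn_toLp] with ξ hξ
  rw [hξ, SchwartzMap.smulLeftCLM_apply_apply japanese_hasTemperateGrowth]
  simp only [smul_eq_mul]
  field_simp [japanese_ne_zero ξ]

theorem IsTemperedDensity.locallyIntegrable {g : E3 → ℂ} (hg : IsTemperedDensity g) :
    LocallyIntegrable g volume := by
  have h1 : g = fun ξ => japanese ξ * ((japanese ξ)⁻¹ * g ξ) := by
    ext ξ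
    field_simp [japanese_ne_zero ξ]
  rw [h1, ← locallyIntegrableOn_univ]
  exact ((Integrable.locallyIntegrable hg).locallyIntegrableOn _).continuousOn_mul
    continuous_japanese.continuousOn isOpen_univ.isLocallyClosed

theorem IsTemperedDensity.hasFourierDensity {g : E3 → ℂ} (hg : IsTemperedDensity g) :
    HasFourierDensity (ofDensity g) g :=
  ⟨hg.locallyIntegrable, fun φ _ => fourierD_ofDensity_apply hg φ⟩

theorem HasFourierDensity.integrable_mul {f : Dist} {g : E3 → ℂ} (h : HasFourierDensity f g)
    {φ : E3 → ℂ} (hφ : Continuous φ) (hc : HasCompactSupport φ) :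
    Integrable (fun ξ => φ ξ * g ξ) volume :=
  h.1.integrable_smul_left_of_hasCompactSupport hφ hc

theorem HasFourierDensity.sub {f f' : Dist} {g g' : E3 → ℂ} (h : HasFourierDensity f g)
    (h' : HasFourierDensity f' g') : HasFourierDensity (f - f') (fun ξ => g ξ - g' ξ) := by
  refine ⟨h.1.sub h'.1, fun φ hφ => ?_⟩
  have : fourierD (f - f') φ = fourierD f φ - fourierD f' φ := rfl
  rw [this, h.2 φ hφ, h'.2 φ hφ, ← integral_sub (h.integrable_mul φ.continuous hφ)
    (h'.integrable_mul φ.continuous hφ)]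
  simp only [mul_sub]

theorem ae_eq_of_integral_schwartz_mul_eq {g g' : E3 → ℂ} (hg : LocallyIntegrable g volume)
    (hg' : LocallyIntegrable g' volume)
    (h : ∀ φ : 𝓢(E3, ℂ), HasCompactSupport φ → ∫ x, φ x * g x = ∫ x, φ x * g' x) :
    g =ᵐ[volume] g' := by
  refine ae_eq_of_integral_contDiff_smul_eq hg hg' fun u hu hc => ?_
  have hu' : ContDiff ℝ (⊤ : ℕ∞) (fun x => ((u x : ℝ) : ℂ)) := Complex.ofRealCLM.contDiff.comp hu
  have hc' : HasCompactSupport (fun x => ((u x : ℝ) : ℂ)) := hc.comp_left Complex.ofReal_zero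
  obtain ⟨φ, hφ⟩ : ∃ φ : 𝓢(E3, ℂ), (φ : E3 → ℂ) = fun x => ((u x : ℝ) : ℂ) :=
    ⟨hc'.toSchwartzMap hu', rfl⟩
  have := h φ (by rw [hφ]; exact hc')
  rw [hφ] at this
  simpa only [Complex.real_smul] using this

theorem HasFourierDensity.ae_eq {f : Dist} {g g' : E3 → ℂ} (h : HasFourierDensity f g)
    (h' : HasFourierDensity f g') : g =ᵐ[volume] g' :=
  ae_eq_of_integral_schwartz_mul_eq h.1 h'.1 fun φ hφ => by rw [← h.2 φ hφ, h'.2 φ hφ]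

/-- A density is tested only against compactly supported functions, because a locally integrable
function need not pair with all Schwartz functions. Density of these test functions is what makes it
determine the distribution. -/
theorem HasFourierDensity.dist_eq {f f' : Dist} {g : E3 → ℂ} (h : HasFourierDensity f g)
    (h' : HasFourierDensity f' g) : f = f' := by
  have key : fourierD f = fourierD f' := by
    ext φ
    obtain ⟨u, hu, hlim⟩ := exists_seq_hasCompactSupport_tendsto φ
    have h1 : Tendsto (fun n => fourierD f (u n)) atTop (𝓝 (fourierD f φ)) :=
      ((fourierD f).continuous.tendsto φ).comp hlim
    have h2 : Tendsto (fun n => fourierD f' (u n)) atTop (𝓝 (fourierD f' φ)) :=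
      ((fourierD f').continuous.tendsto φ).comp hlim
    have h3 : (fun n => fourierD f (u n)) = fun n => fourierD f' (u n) := by
      ext n
      rw [h.2 _ (hu n), h'.2 _ (hu n)]
    rw [h3] at h1
    exact tendsto_nhds_unique h1 h2
  rw [← fourierInvD_fourierD f, key, fourierInvD_fourierD]

theorem HasFourierDensity.congr {f : Dist} {g g' : E3 → ℂ} (h : HasFourierDensity f g)
    (hg : g =ᵐ[volume] g') : HasFourierDensity f g' := by
  refine ⟨h.1.congr hg, fun φ hφ => ?_⟩
  rw [h.2 φ hφ]
  exact integral_congr_ae (hg.mono fun x hx => by simp only [hx])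

/-! ### Dyadic blocks of distributions with a Fourier density -/

theorem continuous_dyadicSymbol (ψ : 𝓢(E3, ℝ)) (j : ℤ) : Continuous (dyadicSymbol ψ j) := by
  unfold dyadicSymbol
  fun_prop

theorem IsDyadicPartition.norm_of_dyadicSymbol_ne_zero {ψ : 𝓢(E3, ℝ)} (hψ : IsDyadicPartition ψ)
    {j : ℤ} {ξ : E3} (h : dyadicSymbol ψ j ξ ≠ 0) :
    3 / 4 * (2 : ℝ) ^ j ≤ ‖ξ‖ ∧ ‖ξ‖ ≤ 8 / 3 * (2 : ℝ) ^ j := by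
  have h1 : ψ ((2 : ℝ) ^ (-j) • ξ) ≠ 0 := fun h0 => h (by rw [dyadicSymbol, h0, Complex.ofReal_zero])
  have h2 := hψ.support _ h1
  have h3 : (0 : ℝ) < (2 : ℝ) ^ j := by positivity
  rw [norm_smul, Real.norm_of_nonneg (by positivity), zpow_neg, inv_mul_eq_div] at h2
  exact ⟨(le_div_iff₀ h3).1 h2.1, (div_le_iff₀ h3).1 h2.2⟩

theorem IsDyadicPartition.hasCompactSupport {ψ : 𝓢(E3, ℝ)} (hψ : IsDyadicPartition ψ) (j : ℤ) :
    HasCompactSupport (dyadicSymbol ψ j) := by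
  refine HasCompactSupport.intro (isCompact_closedBall (0 : E3) (8 / 3 * (2 : ℝ) ^ j))
    fun ξ hξ => ?_
  by_contra h
  exact hξ (mem_closedBall_zero_iff.2 (hψ.norm_of_dyadicSymbol_ne_zero h).2)

theorem IsDyadicPartition.le_one {ψ : 𝓢(E3, ℝ)} (hψ : IsDyadicPartition ψ) (ξ : E3) :
    ψ ξ ≤ 1 := by
  by_cases h : ξ = 0
  · by_contra h1
    have := (hψ.support ξ (by linarith : ψ ξ > 0).ne').1
    rw [h, norm_zero] at this
    norm_num at this
  · have := le_hasSum (hψ.sum_eq_one ξ h) 0 fun j _ => hψ.nonneg _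
    simpa using this

theorem IsDyadicPartition.enorm_dyadicSymbol_le_one {ψ : 𝓢(E3, ℝ)} (hψ : IsDyadicPartition ψ)
    (j : ℤ) (ξ : E3) : ‖dyadicSymbol ψ j ξ‖ₑ ≤ 1 := by
  rw [← enorm_one (G := ℂ), enorm_le_iff_norm_le, dyadicSymbol, Complex.norm_real,
    Real.norm_of_nonneg (hψ.nonneg _)]
  simpa using hψ.le_one _

variable {ψ : 𝓢(E3, ℝ)} {f : Dist} {g : E3 → ℂ}

theorem fourierD_dyadicBlock_apply (hψ : IsDyadicPartition ψ) (h : HasFourierDensity f g) (j : ℤ)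
    (φ : 𝓢(E3, ℂ)) :
    fourierD (dyadicBlock ψ j f) φ = ∫ ξ, φ ξ * (dyadicSymbol ψ j ξ * g ξ) := by
  have ht := dyadicSymbol_hasTemperateGrowth ψ j
  rw [dyadicBlock, fourierD_fourierInvD, TemperedDistribution.smulLeftCLM_apply_apply, h.2]
  · refine integral_congr_ae (Eventually.of_forall fun ξ => ?_)
    simp only [SchwartzMap.smulLeftCLM_apply_apply ht, smul_eq_mul]
    ring
  · rw [SchwartzMap.smulLeftCLM_apply ht]
    exact (hψ.hasCompactSupport j).smul_right

theorem integrable_dyadicSymbol_mul (hψ : IsDyadicPartition ψ) (h : HasFourierDensity f g)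
    (j : ℤ) : Integrable (fun ξ => dyadicSymbol ψ j ξ * g ξ) volume :=
  h.integrable_mul (continuous_dyadicSymbol ψ j) (hψ.hasCompactSupport j)

/-- The infimum in `distLpNorm` runs over representatives that agree almost everywhere, so it is
attained by the obvious one. -/
theorem distLpNorm_one_fourierD_dyadicBlock (hψ : IsDyadicPartition ψ)
    (h : HasFourierDensity f g) (j : ℤ) :
    distLpNorm 1 (fourierD (dyadicBlock ψ j f)) = ∫⁻ ξ, ‖dyadicSymbol ψ j ξ‖ₑ * ‖g ξ‖ₑ := by
  have hi := integrable_dyadicSymbol_mul hψ h j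
  have hn : eLpNorm (fun ξ => dyadicSymbol ψ j ξ * g ξ) 1 volume =
      ∫⁻ ξ, ‖dyadicSymbol ψ j ξ‖ₑ * ‖g ξ‖ₑ := by
    rw [eLpNorm_one_eq_lintegral_enorm]
    simp only [enorm_mul]
  rw [← hn]
  refine le_antisymm ?_ ?_
  · exact iInf_le_of_le _ (iInf_le_of_le (memLp_one_iff_integrable.2 hi)
      (iInf_le_of_le (fourierD_dyadicBlock_apply hψ h j) le_rfl))
  · refine le_iInf fun k => le_iInf fun hk => le_iInf fun hk' => le_of_eq (eLpNorm_congr_ae ?_)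
    exact ae_eq_of_integral_schwartz_mul_eq hi.locallyIntegrable
      (memLp_one_iff_integrable.1 hk).locallyIntegrable fun φ _ => by
        rw [← fourierD_dyadicBlock_apply hψ h j, hk']

theorem dyadicBlock_fourierS (hψ : IsDyadicPartition ψ) (h : HasFourierDensity f g) (j : ℤ)
    (φ : 𝓢(E3, ℂ)) :
    dyadicBlock ψ j f (fourierS φ) = ∫ ξ, φ ξ * (dyadicSymbol ψ j ξ * g ξ) :=
  fourierD_dyadicBlock_apply hψ h j φ

/-- Duality of `L^∞` and `L¹`: this is how Besov norms are bounded from below. The summand `1` keeps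
the constant nonzero, so that one may divide by it inside the infimum defining `distLpNorm`. -/
theorem enorm_integral_mul_dyadicSymbol_le (hψ : IsDyadicPartition ψ) (h : HasFourierDensity f g)
    (j : ℤ) (φ : 𝓢(E3, ℂ)) :
    ‖∫ ξ, φ ξ * (dyadicSymbol ψ j ξ * g ξ)‖ₑ ≤
      (1 + eLpNorm (fourierS φ) 1 volume) * distLpNorm ∞ (dyadicBlock ψ j f) := by
  rw [← dyadicBlock_fourierS hψ h]
  have h0 : eLpNorm (fourierS φ) 1 volume ≠ ∞ := by
    have hi : Integrable (fourierS φ) volume := (fourierS φ).integrable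
    exact (memLp_one_iff_integrable.2 hi).2.ne
  rw [mul_comm, ← ENNReal.div_le_iff (by simp) (by simp [h0])]
  refine le_iInf fun k => le_iInf fun hk => le_iInf fun hk' => ?_
  rw [ENNReal.div_le_iff (by simp) (by simp [h0]), hk', mul_comm]
  refine (enorm_integral_le_lintegral_enorm _).trans
    (le_trans ?_ (mul_le_mul_left (le_add_left le_rfl) _))
  simp only [enorm_mul]
  rw [eLpNorm_one_eq_lintegral_enorm, ← lintegral_mul_const' _ _ hk.2.ne]
  refine lintegral_mono_ae ?_
  filter_upwards [enorm_ae_le_eLpNormEssSup k volume] with x hx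
  rw [eLpNorm_exponent_top]
  gcongr

/-- The block is represented by the explicit inverse Fourier integral `k`, which is bounded by the
`L¹` norm of its transform because `(2π)⁻³ ≤ 1`. Fubini's theorem identifies `k` with the
distribution. -/
theorem distLpNorm_top_dyadicBlock_le (hψ : IsDyadicPartition ψ) (h : HasFourierDensity f g)
    (j : ℤ) :
    distLpNorm ∞ (dyadicBlock ψ j f) ≤ ∫⁻ ξ, ‖dyadicSymbol ψ j ξ‖ₑ * ‖g ξ‖ₑ := by
  have hi := integrable_dyadicSymbol_mul hψ h j
  let G : E3 → ℂ := fun ξ => dyadicSymbol ψ j ξ * g ξ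
  let k : E3 → ℂ := fun x => ((2 * Real.pi) ^ 3 : ℂ)⁻¹ *
      ∫ ξ : E3, Complex.exp (Complex.I * ((inner ℝ ξ x : ℝ) : ℂ)) * G ξ
  have hexp : ∀ a : ℝ, ‖Complex.exp (Complex.I * (a : ℂ))‖ₑ = 1 := fun a => by
    rw [← ofReal_norm, mul_comm, Complex.norm_exp_ofReal_mul_I, ENNReal.ofReal_one]
  have hpi : ‖((2 * Real.pi) ^ 3 : ℂ)⁻¹‖ₑ ≤ 1 := by
    rw [← enorm_one (G := ℂ), enorm_le_iff_norm_le]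
    have h2 : (1 : ℝ) ≤ (2 * Real.pi) ^ 3 := one_le_pow₀ (by linarith [Real.pi_gt_three])
    have h3 : ‖((2 * Real.pi) ^ 3 : ℂ)⁻¹‖ = ((2 * Real.pi) ^ 3)⁻¹ := by
      simp [abs_of_pos Real.pi_pos]
    rw [h3, norm_one]
    exact inv_le_one_of_one_le₀ h2
  have hkb : ∀ x, ‖k x‖ₑ ≤ ∫⁻ ξ, ‖dyadicSymbol ψ j ξ‖ₑ * ‖g ξ‖ₑ := fun x => by
    simp only [k, enorm_mul]
    refine (mul_le_mul' hpi (enorm_integral_le_lintegral_enorm _)).trans (le_of_eq ?_)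
    simp only [G, enorm_mul, hexp, one_mul]
  have hkm : AEStronglyMeasurable k volume := by
    refine Continuous.aestronglyMeasurable (continuous_const.mul ?_)
    refine continuous_of_dominated (bound := fun ξ => ‖G ξ‖) (fun x => ?_) (fun x => ?_)
      hi.norm (Eventually.of_forall fun ξ => by fun_prop)
    · exact (Continuous.aestronglyMeasurable (by fun_prop)).mul hi.1
    · refine Eventually.of_forall fun ξ => ?_
      rw [norm_mul, mul_comm Complex.I, Complex.norm_exp_ofReal_mul_I, one_mul]
  have hkL : eLpNorm k ∞ volume ≤ ∫⁻ ξ, ‖dyadicSymbol ψ j ξ‖ₑ * ‖g ξ‖ₑ := by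
    rw [eLpNorm_exponent_top]
    exact essSup_le_of_ae_le _ (Eventually.of_forall hkb)
  have hfin : ∫⁻ ξ, ‖dyadicSymbol ψ j ξ‖ₑ * ‖g ξ‖ₑ < ∞ := by
    have := hi.2
    simpa only [HasFiniteIntegral, enorm_mul] using this
  refine iInf_le_of_le k (iInf_le_of_le ⟨hkm, hkL.trans_lt hfin⟩ (iInf_le_of_le ?_ hkL))
  intro φ
  have h1 : dyadicBlock ψ j f φ = ∫ ξ, fourierInvS φ ξ * G ξ := by
    conv_lhs => rw [← fourierS_fourierInvS φ]
    exact dyadicBlock_fourierS hψ h j _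
  rw [h1]
  have h2 : ∀ ξ, fourierInvS φ ξ * G ξ = ∫ x, ((2 * Real.pi) ^ 3 : ℂ)⁻¹ *
      (Complex.exp (Complex.I * ((inner ℝ x ξ : ℝ) : ℂ)) * φ x * G ξ) := fun ξ => by
    rw [fourierInvS_apply, integral_const_mul, integral_mul_const, mul_assoc]
  have h3 : ∀ x, φ x * k x = ∫ ξ, ((2 * Real.pi) ^ 3 : ℂ)⁻¹ *
      (Complex.exp (Complex.I * ((inner ℝ x ξ : ℝ) : ℂ)) * φ x * G ξ) := fun x => by
    rw [integral_const_mul, mul_left_comm, ← integral_const_mul]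
    congr 1
    refine integral_congr_ae (Eventually.of_forall fun ξ => ?_)
    simp only [real_inner_comm x ξ]
    ring
  simp_rw [h2, h3]
  rw [integral_integral_swap]
  have hb : Integrable (fun p : E3 × E3 => G p.1 * φ p.2) (volume.prod volume) :=
    hi.mul_prod φ.integrable
  refine (hb.norm.const_mul ‖((2 * Real.pi) ^ 3 : ℂ)⁻¹‖).mono ?_ (Eventually.of_forall ?_)
  · refine aestronglyMeasurable_const.mul ?_
    have : (Function.uncurry fun (ξ x : E3) =>
        Complex.exp (Complex.I * ((inner ℝ x ξ : ℝ) : ℂ)) * φ x * G ξ) =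
        fun p : E3 × E3 => Complex.exp (Complex.I * ((inner ℝ p.2 p.1 : ℝ) : ℂ)) *
          (G p.1 * φ p.2) := by
      ext p
      simp only [Function.uncurry]
      ring
    change AEStronglyMeasurable (Function.uncurry fun (ξ x : E3) =>
        Complex.exp (Complex.I * ((inner ℝ x ξ : ℝ) : ℂ)) * φ x * G ξ) _
    rw [this]
    exact (Continuous.aestronglyMeasurable (by fun_prop)).mul hb.1
  · rintro ⟨ξ, x⟩
    simp only [Function.uncurry, norm_mul, norm_norm, mul_comm Complex.I,
      Complex.norm_exp_ofReal_mul_I, one_mul]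
    exact le_of_eq (by ring)

/-! ### Real and divergence free fields -/

theorem fourierInvS_neg (φ : 𝓢(E3, ℂ)) (hφ : ∀ x, (φ x).im = 0) (ξ : E3) :
    fourierInvS φ (-ξ) = starRingEnd ℂ (fourierInvS φ ξ) := by
  rw [fourierInvS_apply, fourierInvS_apply, map_mul, ← integral_conj]
  congr 1
  · rw [map_inv₀, map_pow, map_mul, map_ofNat, Complex.conj_ofReal]
  · refine integral_congr_ae (Eventually.of_forall fun x => ?_)
    have h1 : starRingEnd ℂ (φ x) = φ x := Complex.conj_eq_iff_im.2 (hφ x)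
    simp only [map_mul, h1, ← Complex.exp_conj, Complex.conj_I, Complex.conj_ofReal,
      inner_neg_right]
    push_cast
    ring_nf

/-- For a real test function the inverse transform has the same Hermitian symmetry as `g`, so the
substitution `ξ ↦ -ξ` conjugates the pairing. -/
theorem isRealDist_ofDensity {g : E3 → ℂ} (hg : IsTemperedDensity g)
    (h : ∀ ξ, g (-ξ) = starRingEnd ℂ (g ξ)) : IsRealDist (ofDensity g) := by
  intro φ hφ
  have h1 : ofDensity g φ = ∫ ξ, fourierInvS φ ξ * g ξ := by
    rw [← fourierD_ofDensity_apply hg, fourierD_apply, fourierS_fourierInvS]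
  rw [← Complex.conj_eq_iff_im, h1, ← integral_conj,
    ← integral_neg_eq_self (fun ξ => fourierInvS φ ξ * g ξ)]
  refine integral_congr_ae (Eventually.of_forall fun x => ?_)
  simp only [map_mul, fourierInvS_neg φ hφ, h]

theorem fourierInvS_lineDeriv (φ : 𝓢(E3, ℂ)) (m ξ : E3) :
    fourierInvS (∂_{m} φ) ξ = -(Complex.I * ((inner ℝ ξ m : ℝ) : ℂ)) * fourierInvS φ ξ := by
  have hpi : (Real.pi : ℂ) ≠ 0 := by exact_mod_cast Real.pi_ne_zero
  rw [fourierInvS_eq, fourierInvS_eq, SchwartzMap.fourierInv_lineDerivOp_eq, dilation_apply]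
  simp only [_root_.smul_apply]
  rw [SchwartzMap.smulLeftCLM_apply_apply (by fun_prop)]
  simp only [real_inner_smul_left, smul_eq_mul, Complex.real_smul]
  push_cast
  field_simp

theorem isDivFree_ofDensity {g : Fin 3 → E3 → ℂ} (hg : ∀ k, IsTemperedDensity (g k))
    (h : ∀ ξ : E3, ∑ k, (ξ k : ℂ) * g k ξ = 0) : IsDivFree fun k => ofDensity (g k) := by
  unfold IsDivFree
  ext φ
  have h1 : ∀ k : Fin 3, (∂_{(EuclideanSpace.single k (1 : ℝ) : E3)} (ofDensity (g k)) : Dist) φ =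
      ∫ ξ : E3, Complex.I * fourierInvS φ ξ * ((ξ k : ℂ) * g k ξ) := by
    intro k
    rw [TemperedDistribution.lineDerivOp_apply_apply]
    conv_lhs => rw [← fourierS_fourierInvS (∂_{(EuclideanSpace.single k (1 : ℝ) : E3)} φ)]
    rw [map_neg, ← fourierD_apply, fourierD_ofDensity_apply (hg k), ← integral_neg]
    refine integral_congr_ae (Eventually.of_forall fun ξ => ?_)
    simp only [fourierInvS_lineDeriv, EuclideanSpace.inner_single_right]
    simp
    ring
  have h2 : ∀ k : Fin 3, Integrable
      (fun ξ : E3 => Complex.I * fourierInvS φ ξ * ((ξ k : ℂ) * g k ξ)) volume := by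
    intro k
    have := (hg k).integrable_mul
      (-fourierInvS (∂_{(EuclideanSpace.single k (1 : ℝ) : E3)} φ))
    refine this.congr (Eventually.of_forall fun ξ => ?_)
    simp only [_root_.neg_apply, fourierInvS_lineDeriv, EuclideanSpace.inner_single_right]
    simp
    ring
  have h3 : (∑ k : Fin 3, (∂_{(EuclideanSpace.single k (1 : ℝ) : E3)} (ofDensity (g k)) : Dist)) φ =
      ∑ k : Fin 3, (∂_{(EuclideanSpace.single k (1 : ℝ) : E3)} (ofDensity (g k)) : Dist) φ := by
    simp only [Fin.sum_univ_three]
    rfl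
  rw [h3]
  simp_rw [h1]
  rw [← integral_finsetSum _ fun k _ => h2 k]
  simp_rw [← Finset.mul_sum, h]
  simp

end

section

/-! ### The space `L²(0, ∞; L¹)` -/

/-- Lebesgue measure on the half-line of positive times. -/
abbrev timeMeasure : Measure ℝ := volume.restrict (Set.Ioi (0 : ℝ))

/-- The `L²(0, ∞)` norm of a nonnegative function. -/
def timeL2 (h : ℝ → ℝ≥0∞) : ℝ≥0∞ := (∫⁻ t, h t ^ (2 : ℝ) ∂timeMeasure) ^ (1 / (2 : ℝ))

/-- The `L²(0, ∞; L¹)` norm of a nonnegative function of time and frequency. -/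
def znorm (A : ℝ → E3 → ℝ≥0∞) : ℝ≥0∞ := timeL2 fun t => ∫⁻ ξ, A t ξ

theorem timeL2_mono {h k : ℝ → ℝ≥0∞} (hhk : ∀ᵐ t ∂timeMeasure, h t ≤ k t) :
    timeL2 h ≤ timeL2 k := by
  refine ENNReal.rpow_le_rpow (lintegral_mono_ae ?_) (by norm_num)
  filter_upwards [hhk] with t ht using ENNReal.rpow_le_rpow ht (by norm_num)

theorem timeL2_add_le {h k : ℝ → ℝ≥0∞} (hh : Measurable h) (hk : Measurable k) :
    timeL2 (fun t => h t + k t) ≤ timeL2 h + timeL2 k :=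
  ENNReal.lintegral_Lp_add_le hh.aemeasurable hk.aemeasurable one_le_two

theorem timeL2_const_mul {c : ℝ≥0∞} (hc : c ≠ ∞) (h : ℝ → ℝ≥0∞) :
    timeL2 (fun t => c * h t) = c * timeL2 h := by
  unfold timeL2
  simp_rw [ENNReal.mul_rpow_of_nonneg _ _ (zero_le_two (α := ℝ))]
  rw [lintegral_const_mul' _ _ (ENNReal.rpow_ne_top_of_nonneg zero_le_two hc),
    ENNReal.mul_rpow_of_nonneg _ _ (by norm_num : (0 : ℝ) ≤ 1 / 2), ← ENNReal.rpow_mul]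
  norm_num

theorem timeL2_tsum_le {h : ℕ → ℝ → ℝ≥0∞} (hh : ∀ n, Measurable (h n)) :
    timeL2 (fun t => ∑' n, h n t) ≤ ∑' n, timeL2 (h n) := by
  have h1 : ∀ N, timeL2 (fun t => ∑ n ∈ Finset.range N, h n t) ≤
      ∑ n ∈ Finset.range N, timeL2 (h n) := by
    intro N
    induction N with
    | zero => simp [timeL2]
    | succ N ih =>
      simp_rw [Finset.sum_range_succ]
      exact (timeL2_add_le (Finset.measurable_sum _ fun n _ => hh n) (hh N)).trans
        (add_le_add_left ih _)
  have hmono : Monotone fun N t => (∑ n ∈ Finset.range N, h n t) ^ (2 : ℝ) := fun N M hNM t =>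
    ENNReal.rpow_le_rpow (Finset.sum_le_sum_of_subset (Finset.range_mono hNM)) zero_le_two
  have h2 : timeL2 (fun t => ∑' n, h n t) =
      ⨆ N, timeL2 (fun t => ∑ n ∈ Finset.range N, h n t) := by
    unfold timeL2
    have e : ∀ t, (∑' n, h n t) ^ (2 : ℝ) = ⨆ N, (∑ n ∈ Finset.range N, h n t) ^ (2 : ℝ) := by
      intro t
      rw [ENNReal.tsum_eq_iSup_nat]
      exact (ENNReal.orderIsoRpow 2 two_pos).map_iSup _
    simp_rw [e]
    rw [lintegral_iSup (fun N => (Finset.measurable_sum _ fun n _ => hh n).pow_const _) hmono]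
    exact (ENNReal.orderIsoRpow (1 / 2) (by norm_num)).map_iSup _
  rw [h2]
  exact iSup_le fun N => (h1 N).trans (ENNReal.sum_le_tsum _)

theorem lintegral_mul_le_timeL2 {h k : ℝ → ℝ≥0∞} (hh : Measurable h) (hk : Measurable k) :
    ∫⁻ t, h t * k t ∂timeMeasure ≤ timeL2 h * timeL2 k :=
  ENNReal.lintegral_mul_le_Lp_mul_Lq _ Real.HolderConjugate.two_two
    hh.aemeasurable hk.aemeasurable

theorem timeL2_le_of_sq_le {h : ℝ → ℝ≥0∞} {c : ℝ≥0∞}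
    (hc : ∫⁻ t, h t * h t ∂timeMeasure ≤ c * c) : timeL2 h ≤ c := by
  have e : ∀ x : ℝ≥0∞, x * x = x ^ (2 : ℝ) := fun x => by
    rw [ENNReal.rpow_two, sq]
  simp_rw [e] at hc
  refine (ENNReal.rpow_le_rpow hc (by norm_num : (0 : ℝ) ≤ 1 / 2)).trans (le_of_eq ?_)
  rw [← ENNReal.rpow_mul]
  norm_num

variable {A B D : ℝ → E3 → ℝ≥0∞}

theorem measurable_lintegral_freq' (hA : Measurable (Function.uncurry A)) :
    Measurable fun t => ∫⁻ ξ, A t ξ :=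
  hA.lintegral_prod_right'

theorem znorm_mono (h : ∀ᵐ t ∂timeMeasure, ∀ᵐ ξ, A t ξ ≤ B t ξ) : znorm A ≤ znorm B :=
  timeL2_mono (h.mono fun _ ht => lintegral_mono_ae ht)

theorem znorm_add_le (hA : Measurable (Function.uncurry A)) (hB : Measurable (Function.uncurry B)) :
    znorm (fun t ξ => A t ξ + B t ξ) ≤ znorm A + znorm B := by
  unfold znorm
  refine le_trans (le_of_eq ?_)
    (timeL2_add_le (measurable_lintegral_freq' hA) (measurable_lintegral_freq' hB))
  congr 1
  ext t
  exact lintegral_add_left (hA.comp measurable_prodMk_left) _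

theorem znorm_const_mul {c : ℝ≥0∞} (hc : c ≠ ∞) :
    znorm (fun t ξ => c * A t ξ) = c * znorm A := by
  unfold znorm
  rw [← timeL2_const_mul hc]
  congr 1
  ext t
  exact lintegral_const_mul' _ _ hc

theorem znorm_tsum_le {A : ℕ → ℝ → E3 → ℝ≥0∞} (hA : ∀ n, Measurable (Function.uncurry (A n))) :
    znorm (fun t ξ => ∑' n, A n t ξ) ≤ ∑' n, znorm (A n) := by
  unfold znorm
  refine le_trans (le_of_eq ?_) (timeL2_tsum_le fun n => measurable_lintegral_freq' (hA n))
  congr 1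
  ext t
  exact lintegral_tsum fun n => ((hA n).comp measurable_prodMk_left).aemeasurable

theorem lintegral_sq_lt_top_of_znorm (h : znorm A < ∞) :
    ∫⁻ t, (∫⁻ ξ, A t ξ) ^ (2 : ℝ) ∂timeMeasure < ∞ := by
  by_contra hcon
  rw [not_lt, top_le_iff] at hcon
  rw [znorm, timeL2, hcon, ENNReal.top_rpow_of_pos (by norm_num)] at h
  exact lt_irrefl _ h

theorem ae_lintegral_lt_top_of_znorm (hA : Measurable (Function.uncurry A)) (h : znorm A < ∞) :
    ∀ᵐ t ∂timeMeasure, ∫⁻ ξ, A t ξ < ∞ := by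
  have h2 := ae_lt_top ((measurable_lintegral_freq' hA).pow_const (2 : ℝ))
    (lintegral_sq_lt_top_of_znorm h).ne
  filter_upwards [h2] with t ht
  by_contra hcon
  rw [not_lt, top_le_iff] at hcon
  rw [hcon, ENNReal.top_rpow_of_pos (by norm_num)] at ht
  exact lt_irrefl _ ht

theorem ae_ae_lt_top_of_znorm (hA : Measurable (Function.uncurry A)) (h : znorm A < ∞) :
    ∀ᵐ t ∂timeMeasure, ∀ᵐ ξ, A t ξ < ∞ := by
  filter_upwards [ae_lintegral_lt_top_of_znorm hA h] with t ht
  exact ae_lt_top (hA.comp measurable_prodMk_left) ht.ne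

theorem ae_ae_eq_zero_of_znorm (hA : Measurable (Function.uncurry A)) (h : znorm A = 0) :
    ∀ᵐ t ∂timeMeasure, ∀ᵐ ξ, A t ξ = 0 := by
  rw [znorm, timeL2, ENNReal.rpow_eq_zero_iff_of_pos (by norm_num),
    lintegral_eq_zero_iff ((measurable_lintegral_freq' hA).pow_const _)] at h
  filter_upwards [h] with t ht
  rw [Pi.zero_apply, ENNReal.rpow_eq_zero_iff_of_pos (by norm_num),
    lintegral_eq_zero_iff (f := A t) (hA.comp measurable_prodMk_left)] at ht
  exact ht

/-! ### Convolution in the frequency variable -/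

/-- The convolution of two nonnegative functions on `ℝ³`. -/
def conv (a b : E3 → ℝ≥0∞) (ξ : E3) : ℝ≥0∞ := ∫⁻ η, a (ξ - η) * b η

theorem conv_mono {a a' b b' : E3 → ℝ≥0∞} (ha : ∀ ξ, a ξ ≤ a' ξ) (hb : ∀ ξ, b ξ ≤ b' ξ) (ξ : E3) :
    conv a b ξ ≤ conv a' b' ξ :=
  lintegral_mono fun _ => mul_le_mul' (ha _) (hb _)

theorem conv_comm (a b : E3 → ℝ≥0∞) (ξ : E3) : conv a b ξ = conv b a ξ := by
  unfold conv
  rw [← lintegral_sub_left_eq_self _ ξ]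
  simp_rw [sub_sub_cancel, mul_comm]

theorem measurable_conv_integrand (hA : Measurable (Function.uncurry A))
    (hB : Measurable (Function.uncurry B)) :
    Measurable fun z : (ℝ × E3) × E3 => A z.1.1 (z.1.2 - z.2) * B z.1.1 z.2 :=
  (hA.comp (measurable_fst.fst.prodMk (measurable_fst.snd.sub measurable_snd))).mul
    (hB.comp (measurable_fst.fst.prodMk measurable_snd))

theorem measurable_conv (hA : Measurable (Function.uncurry A))
    (hB : Measurable (Function.uncurry B)) :
    Measurable (Function.uncurry fun t => conv (A t) (B t)) :=
  (measurable_conv_integrand hA hB).lintegral_prod_right'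

theorem lintegral_conv {a b : E3 → ℝ≥0∞} (ha : Measurable a) (hb : Measurable b) :
    ∫⁻ ξ, conv a b ξ = (∫⁻ ξ, a ξ) * ∫⁻ ξ, b ξ := by
  unfold conv
  rw [lintegral_lintegral_swap (((ha.comp (measurable_fst.sub measurable_snd)).mul
    (hb.comp measurable_snd)).aemeasurable)]
  have : ∀ η, ∫⁻ ξ, a (ξ - η) * b η = (∫⁻ ξ, a ξ) * b η := fun η => by
    have hm : Measurable fun ξ => a (ξ - η) := ha.comp (measurable_id.sub_const η)
    rw [lintegral_mul_const _ hm, lintegral_sub_right_eq_self]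
  simp_rw [this]
  exact lintegral_const_mul _ hb

theorem lintegral_lintegral_conv_le (hA : Measurable (Function.uncurry A))
    (hB : Measurable (Function.uncurry B)) :
    ∫⁻ t, (∫⁻ ξ, conv (A t) (B t) ξ) ∂timeMeasure ≤ znorm A * znorm B := by
  have : ∀ t, ∫⁻ ξ, conv (A t) (B t) ξ = (∫⁻ ξ, A t ξ) * ∫⁻ ξ, B t ξ := fun t =>
    lintegral_conv (hA.comp measurable_prodMk_left) (hB.comp measurable_prodMk_left)
  simp_rw [this]
  exact lintegral_mul_le_timeL2 (measurable_lintegral_freq' hA) (measurable_lintegral_freq' hB)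

/-! ### The majorant of the Duhamel term -/

/-- The kernel `|ξ| e^{-(t-τ)|ξ|²/2}`, cut off to `0 < τ ≤ t`. -/
def heatKernel (t τ : ℝ) (ξ : E3) : ℝ≥0∞ :=
  if τ ≤ t then ENNReal.ofReal (‖ξ‖ * Real.exp (-(t - τ) * ‖ξ‖ ^ 2 / 2)) else 0

/-- The majorant `∫₀ᵗ |ξ| e^{-(t-τ)|ξ|²/2} (A * B)(τ, ξ) dτ` of the Duhamel term. -/
def duhMaj (A B : ℝ → E3 → ℝ≥0∞) (t : ℝ) (ξ : E3) : ℝ≥0∞ :=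
  ∫⁻ τ, heatKernel t τ ξ * conv (A τ) (B τ) ξ ∂timeMeasure

theorem measurable_heatKernel : Measurable fun z : (ℝ × E3) × ℝ => heatKernel z.1.1 z.2 z.1.2 := by
  unfold heatKernel
  refine Measurable.ite (measurableSet_le measurable_snd measurable_fst.fst) ?_ measurable_const
  fun_prop

theorem measurable_duhMaj (hA : Measurable (Function.uncurry A))
    (hB : Measurable (Function.uncurry B)) : Measurable (Function.uncurry (duhMaj A B)) := by
  have : Measurable fun z : (ℝ × E3) × ℝ =>
      heatKernel z.1.1 z.2 z.1.2 * conv (A z.2) (B z.2) z.1.2 :=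
    measurable_heatKernel.mul ((measurable_conv hA hB).comp
      (measurable_snd.prodMk measurable_fst.snd))
  exact this.lintegral_prod_right'

theorem heatKernel_le (t τ : ℝ) (ξ : E3) : heatKernel t τ ξ ≤ ENNReal.ofReal ‖ξ‖ := by
  unfold heatKernel
  split_ifs with h
  · refine ENNReal.ofReal_le_ofReal (mul_le_of_le_one_right (norm_nonneg _) ?_)
    rw [Real.exp_le_one_iff]
    have : 0 ≤ (t - τ) * ‖ξ‖ ^ 2 := mul_nonneg (sub_nonneg.2 h) (sq_nonneg _)
    linarith
  · exact zero_le

theorem lintegral_Ioi_exp {c : ℝ} (hc : 0 < c) (a : ℝ) :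
    ∫⁻ t in Set.Ioi a, ENNReal.ofReal (Real.exp (-c * (t - a))) = ENNReal.ofReal c⁻¹ := by
  have hi : IntegrableOn (fun t => Real.exp (-c * t)) (Set.Ioi a) :=
    exp_neg_integrableOn_Ioi a hc
  have e : (fun t => Real.exp (-c * (t - a))) = fun t => Real.exp (c * a) * Real.exp (-c * t) := by
    ext t
    rw [← Real.exp_add]
    ring_nf
  rw [← ofReal_integral_eq_lintegral_ofReal]
  · rw [e, integral_const_mul, integral_exp_mul_Ioi (by linarith)]
    congr 1
    rw [neg_mul, Real.exp_neg]
    field_simp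
  · rw [e]; exact hi.const_mul _
  · exact Eventually.of_forall fun t => (Real.exp_pos _).le

/-- The integral `∫_τ^∞ |ξ|² e^{-(t-τ)|ξ|²} dt` equals one for every `ξ ≠ 0`. This scale invariance
is why `L²` in time is the right exponent. -/
theorem lintegral_heatKernel_sq_le (τ : ℝ) (ξ : E3) :
    ∫⁻ t, heatKernel t τ ξ * heatKernel t τ ξ ≤ 1 := by
  have h1 : ∀ t, heatKernel t τ ξ * heatKernel t τ ξ = (Set.Ici τ).indicator
      (fun t => ENNReal.ofReal (‖ξ‖ ^ 2 * Real.exp (-‖ξ‖ ^ 2 * (t - τ)))) t := by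
    intro t
    unfold heatKernel Set.indicator
    simp only [Set.mem_Ici]
    split_ifs
    · rw [← ENNReal.ofReal_mul (by positivity), mul_mul_mul_comm, ← Real.exp_add]
      congr 2
      · ring
      · ring_nf
    · simp
  simp_rw [h1]
  rw [lintegral_indicator measurableSet_Ici, ← restrict_Ioi_eq_restrict_Ici]
  rcases eq_or_ne ξ 0 with rfl | h0
  · simp
  have hp : 0 < ‖ξ‖ ^ 2 := by positivity
  simp_rw [ENNReal.ofReal_mul hp.le]
  rw [lintegral_const_mul' _ _ ENNReal.ofReal_ne_top, lintegral_Ioi_exp hp,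
    ← ENNReal.ofReal_mul hp.le, mul_inv_cancel₀ hp.ne']
  simp

theorem two_mul_mul_le (a b : ℝ≥0∞) : 2 * (a * b) ≤ a * a + b * b := by
  rcases eq_or_ne a ∞ with rfl | ha
  · simp
  rcases eq_or_ne b ∞ with rfl | hb
  · simp
  lift a to NNReal using ha
  lift b to NNReal using hb
  norm_cast
  have := two_mul_le_add_sq a b
  calc _ = 2 * a * b := by ring
    _ ≤ _ := this
    _ = _ := by ring

/-- Minkowski's integral inequality in `L²(0, ∞)`, for kernels of norm at most one. -/
theorem timeL2_lintegral_le {Y : Type*} [MeasurableSpace Y] {μ : Measure Y} [SFinite μ]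
    {k : ℝ → Y → ℝ≥0∞} {p : Y → ℝ≥0∞} (hk : Measurable (Function.uncurry k)) (hp : Measurable p)
    (h1 : ∀ y, ∫⁻ t, k t y * k t y ∂timeMeasure ≤ 1) :
    timeL2 (fun t => ∫⁻ y, k t y * p y ∂μ) ≤ ∫⁻ y, p y ∂μ := by
  have hky : ∀ y, Measurable fun t => k t y := fun y => hk.comp measurable_prodMk_right
  have hkt : ∀ t, Measurable fun y => k t y := fun t => hk.comp measurable_prodMk_left
  have hkk : ∀ y y', Measurable fun t => k t y * k t y' := fun y y' => (hky y).mul (hky y')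
  have hkp : ∀ t, Measurable fun y => k t y * p y := fun t => (hkt t).mul hp
  refine timeL2_le_of_sq_le ?_
  -- Two kernels of norm at most one have inner product at most one, by `2ab ≤ a² + b²`. Writing the
  -- square of the inner integral as a double integral over `(y, y')` then yields Minkowski's
  -- inequality.
  have h2 : ∀ y y', ∫⁻ t, k t y * k t y' ∂timeMeasure ≤ 1 := by
    intro y y'
    have : 2 * ∫⁻ t, k t y * k t y' ∂timeMeasure ≤ 2 * 1 := by
      rw [← lintegral_const_mul' _ _ (by simp)]
      refine (lintegral_mono fun t => two_mul_mul_le _ _).trans ?_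
      rw [lintegral_add_left (hkk y y), two_mul]
      exact add_le_add (h1 y) (h1 y')
    exact (ENNReal.mul_le_mul_iff_right (by simp) (by simp)).1 this
  have hm : Measurable fun z : (ℝ × Y) × Y => k z.1.1 z.1.2 * p z.1.2 * (k z.1.1 z.2 * p z.2) :=
    ((hk.comp measurable_fst).mul (hp.comp measurable_fst.snd)).mul
      ((hk.comp (measurable_fst.fst.prodMk measurable_snd)).mul (hp.comp measurable_snd))
  calc ∫⁻ t, (∫⁻ y, k t y * p y ∂μ) * (∫⁻ y, k t y * p y ∂μ) ∂timeMeasure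
      = ∫⁻ t, ∫⁻ y, ∫⁻ y', k t y * p y * (k t y' * p y') ∂μ ∂μ ∂timeMeasure := by
        refine lintegral_congr fun t => ?_
        rw [← lintegral_mul_const _ (hkp t)]
        refine lintegral_congr fun y => ?_
        rw [← lintegral_const_mul _ (hkp t)]
    _ = ∫⁻ y, ∫⁻ t, ∫⁻ y', k t y * p y * (k t y' * p y') ∂μ ∂timeMeasure ∂μ :=
        lintegral_lintegral_swap (hm.lintegral_prod_right').aemeasurable
    _ = ∫⁻ y, ∫⁻ y', ∫⁻ t, k t y * p y * (k t y' * p y') ∂timeMeasure ∂μ ∂μ := by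
        refine lintegral_congr fun y => lintegral_lintegral_swap ?_
        have := hm.comp (((measurable_fst (α := ℝ) (β := Y)).prodMk
          (measurable_const (a := y))).prodMk measurable_snd)
        exact this.aemeasurable
    _ ≤ ∫⁻ y, ∫⁻ y', p y * p y' ∂μ ∂μ := by
        refine lintegral_mono fun y => lintegral_mono fun y' => ?_
        have : ∀ t, k t y * p y * (k t y' * p y') = k t y * k t y' * (p y * p y') := fun t => by
          ring
        simp_rw [this]
        rw [lintegral_mul_const _ (hkk y y')]
        exact mul_le_of_le_one_left zero_le (h2 y y')
    _ = _ := by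
        rw [← lintegral_mul_const _ hp]
        refine lintegral_congr fun y => ?_
        rw [← lintegral_const_mul _ hp]

/-- The bilinear estimate on which existence and uniqueness rest. Minkowski's inequality over the
pairs `(τ, ξ)` removes the kernel, and the mass of `A * B` in `(τ, ξ)` is the time integral of a
product of two `L¹` norms. -/
theorem znorm_duhMaj_le (hA : Measurable (Function.uncurry A))
    (hB : Measurable (Function.uncurry B)) : znorm (duhMaj A B) ≤ znorm A * znorm B := by
  refine le_trans ?_ (lintegral_lintegral_conv_le hA hB)
  have hk : Measurable (Function.uncurry fun (t : ℝ) (y : ℝ × E3) => heatKernel t y.1 y.2) :=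
    measurable_heatKernel.comp ((measurable_fst.prodMk measurable_snd.snd).prodMk
      measurable_snd.fst)
  have hc := measurable_conv hA hB
  have := timeL2_lintegral_le (μ := timeMeasure.prod (volume : Measure E3)) hk hc fun y =>
    (lintegral_mono' Measure.restrict_le_self le_rfl).trans (lintegral_heatKernel_sq_le y.1 y.2)
  rw [lintegral_prod _ hc.aemeasurable] at this
  refine le_trans (le_of_eq ?_) this
  unfold znorm duhMaj
  congr 1
  ext t
  have hm : Measurable fun y : ℝ × E3 =>
      heatKernel t y.1 y.2 * Function.uncurry (fun t => conv (A t) (B t)) y :=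
    (hk.comp measurable_prodMk_left).mul hc
  rw [lintegral_prod_symm _ hm.aemeasurable]
  rfl

end

/-! ### The semigroup symbol -/

section MatrixExponential

attribute [local instance] Matrix.linftyOpNormedRing Matrix.linftyOpNormedAlgebra

theorem continuous_matrix_exp :
    Continuous (NormedSpace.exp : Matrix Idx Idx ℂ → Matrix Idx Idx ℂ) :=
  NormedSpace.exp_continuous

theorem hasDerivAt_matrix_exp (M : Matrix Idx Idx ℂ) (t : ℝ) :
    HasDerivAt (fun s : ℝ => NormedSpace.exp ((s : ℝ) • M)) (M * NormedSpace.exp (t • M)) t :=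
  hasDerivAt_exp_smul_const' M t

theorem hasDerivAt_matrix_exp_mulVec (M : Matrix Idx Idx ℂ) (x : Idx → ℂ) (t : ℝ) :
    HasDerivAt (fun s : ℝ => NormedSpace.exp ((s : ℝ) • M) *ᵥ x)
      (M *ᵥ (NormedSpace.exp (t • M) *ᵥ x)) t := by
  have h := hasDerivAt_matrix_exp M t
  let L : Matrix Idx Idx ℂ →L[ℝ] (Idx → ℂ) :=
    LinearMap.toContinuousLinearMap
      { toFun := fun N => N *ᵥ x
        map_add' := fun N N' => Matrix.add_mulVec N N' x
        map_smul' := fun c N => Matrix.smul_mulVec c N x }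
  have := L.hasFDerivAt.comp_hasDerivAt t h
  rw [Matrix.mulVec_mulVec]
  exact this

theorem matrix_exp_mul_comm (M : Matrix Idx Idx ℂ) (t : ℝ) :
    M * NormedSpace.exp (t • M) = NormedSpace.exp (t • M) * M :=
  ((Commute.refl M).smul_right t).exp_right

theorem matrix_exp_map_conj (M : Matrix Idx Idx ℂ) :
    NormedSpace.exp (M.map (starRingEnd ℂ)) = (NormedSpace.exp M).map (starRingEnd ℂ) := by
  have := NormedSpace.map_exp (f := (starRingEnd ℂ).mapMatrix (m := Idx))
    (Continuous.matrix_map continuous_id Complex.continuous_conj) M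
  exact this.symm

end MatrixExponential

theorem semigroupSymbol_eq (t : ℝ) (ξ : E3) :
    semigroupSymbol t ξ = NormedSpace.exp (t • (-linSymbol ξ)) := by
  unfold semigroupSymbol
  congr 1
  ext i j
  simp

theorem semigroupSymbol_zero (ξ : E3) : semigroupSymbol 0 ξ = 1 := by
  rw [semigroupSymbol_eq, zero_smul, NormedSpace.exp_zero]

theorem hasDerivAt_semigroupSymbol (ξ : E3) (x : Idx → ℂ) (t : ℝ) :
    HasDerivAt (fun s => semigroupSymbol s ξ *ᵥ x)
      (-(linSymbol ξ *ᵥ (semigroupSymbol t ξ *ᵥ x))) t := by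
  simp only [semigroupSymbol_eq]
  have := hasDerivAt_matrix_exp_mulVec (-linSymbol ξ) x t
  rwa [Matrix.neg_mulVec] at this

theorem linSymbol_mulVec_semigroupSymbol (t : ℝ) (ξ : E3) (x : Idx → ℂ) :
    linSymbol ξ *ᵥ (semigroupSymbol t ξ *ᵥ x) = semigroupSymbol t ξ *ᵥ (linSymbol ξ *ᵥ x) := by
  have := matrix_exp_mul_comm (-linSymbol ξ) t
  rw [semigroupSymbol_eq, Matrix.mulVec_mulVec, Matrix.mulVec_mulVec]
  rw [neg_mul, mul_neg, neg_inj] at this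
  rw [this]

theorem continuous_linSymbol : Continuous linSymbol := by
  unfold linSymbol
  refine Continuous.matrix_fromBlocks ?_ ?_ ?_ ?_
  · fun_prop
  · unfold curlSymbol
    refine continuous_matrix fun i j => ?_
    fin_cases i <;> fin_cases j <;> simp <;> fun_prop
  · unfold curlSymbol
    refine continuous_matrix fun i j => ?_
    fin_cases i <;> fin_cases j <;> simp <;> fun_prop
  · refine Continuous.add (by fun_prop) (continuous_matrix fun i j => ?_)
    simp only [gradDivSymbol, Matrix.of_apply]
    fun_prop

theorem continuous_semigroupSymbol : Continuous fun z : ℝ × E3 => semigroupSymbol z.1 z.2 := by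
  unfold semigroupSymbol
  refine continuous_matrix_exp.comp ?_
  have := continuous_linSymbol.comp (continuous_snd (X := ℝ) (Y := E3))
  have h1 : Continuous fun z : ℝ × E3 => -(z.1 : ℂ) := by fun_prop
  exact h1.smul this

theorem linSymbol_neg (ξ : E3) : linSymbol (-ξ) = (linSymbol ξ).map (starRingEnd ℂ) := by
  ext i j
  rcases i with i | i <;> rcases j with j | j <;> fin_cases i <;> fin_cases j <;>
    simp [linSymbol, curlSymbol, gradDivSymbol, map_ofNat]

theorem semigroupSymbol_neg (t : ℝ) (ξ : E3) :
    semigroupSymbol t (-ξ) = (semigroupSymbol t ξ).map (starRingEnd ℂ) := by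
  rw [semigroupSymbol_eq, semigroupSymbol_eq, linSymbol_neg, ← matrix_exp_map_conj]
  congr 1
  ext i j
  simp

/-- The squared Euclidean norm on `ℂ⁶`. -/
def normSqSum (x : Idx → ℂ) : ℝ := ∑ a, ‖x a‖ ^ 2

theorem normSqSum_nonneg (x : Idx → ℂ) : 0 ≤ normSqSum x := Finset.sum_nonneg fun _ _ => sq_nonneg _

theorem norm_sq_le_normSqSum (x : Idx → ℂ) : ‖x‖ ^ 2 ≤ normSqSum x := by
  have h : ‖x‖ ≤ √(normSqSum x) := by
    refine (pi_norm_le_iff_of_nonneg (Real.sqrt_nonneg _)).2 fun a => Real.le_sqrt_of_sq_le ?_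
    exact Finset.single_le_sum (f := fun a => ‖x a‖ ^ 2) (fun _ _ => sq_nonneg _)
      (Finset.mem_univ a)
  calc ‖x‖ ^ 2 ≤ √(normSqSum x) ^ 2 := by gcongr
    _ = _ := Real.sq_sqrt (normSqSum_nonneg x)

theorem normSqSum_le (x : Idx → ℂ) : normSqSum x ≤ 6 * ‖x‖ ^ 2 := by
  have : normSqSum x ≤ ∑ _a : Idx, ‖x‖ ^ 2 :=
    Finset.sum_le_sum fun a _ => by gcongr; exact norm_le_pi_norm x a
  simpa using this

/-- Coercivity of the symbol of the linear part. -/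
theorem linSymbol_coercive (ξ : E3) (x : Idx → ℂ) :
    ‖ξ‖ ^ 2 * normSqSum x ≤ 2 * ∑ a, inner ℝ (x a) ((linSymbol ξ *ᵥ x) a) := by
  have hξ : ‖ξ‖ ^ 2 = ξ 0 ^ 2 + ξ 1 ^ 2 + ξ 2 ^ 2 := by
    rw [EuclideanSpace.norm_sq_eq, Fin.sum_univ_three]
    simp
  have e : ∀ z w : ℂ, inner ℝ z w = z.re * w.re + z.im * w.im := fun z w => by
    rw [Complex.inner]; simp; ring
  have e2 : ∀ z : ℂ, ‖z‖ ^ 2 = z.re ^ 2 + z.im ^ 2 := fun z => by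
    rw [← Complex.normSq_eq_norm_sq, Complex.normSq_apply]; ring
  simp only [normSqSum, Fintype.sum_sum_type, Fin.sum_univ_three, e, e2, linSymbol, curlSymbol,
    gradDivSymbol, Matrix.mulVec, dotProduct, Matrix.fromBlocks_apply₁₁,
    Matrix.fromBlocks_apply₁₂, Matrix.fromBlocks_apply₂₁, Matrix.fromBlocks_apply₂₂, hξ,
    Matrix.smul_apply, Matrix.add_apply, Matrix.one_apply, Matrix.of_apply]
  have hre : ∀ p : ℝ, ((p : ℂ) ^ 2).re = p ^ 2 := fun p => by norm_cast
  have him : ∀ p : ℝ, ((p : ℂ) ^ 2).im = 0 := fun p => by norm_cast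
  simp [hre, him]
  generalize (x (Sum.inl 0)).re = a0, (x (Sum.inl 1)).re = a1, (x (Sum.inl 2)).re = a2,
    (x (Sum.inl 0)).im = b0, (x (Sum.inl 1)).im = b1, (x (Sum.inl 2)).im = b2,
    (x (Sum.inr 0)).re = c0, (x (Sum.inr 1)).re = c1, (x (Sum.inr 2)).re = c2,
    (x (Sum.inr 0)).im = d0, (x (Sum.inr 1)).im = d1, (x (Sum.inr 2)).im = d2,
    ξ 0 = p, ξ 1 = q, ξ 2 = r
  rw [← sub_nonneg]
  -- Completing the square. Write `|ξ|²|u|² = |ξ × u|² + |ξ · u|²`. The curl coupling is the cross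
  -- term between `ξ × u` and `2ω`, and the damping `2ω` supplies exactly the missing `4|ω|²`.
  have hs : 0 ≤ (-(r * b1) + q * b2 + 2 * c0) ^ 2 + (r * a1 - q * a2 + 2 * d0) ^ 2 +
      (r * b0 - p * b2 + 2 * c1) ^ 2 + (-(r * a0) + p * a2 + 2 * d1) ^ 2 +
      (-(q * b0) + p * b1 + 2 * c2) ^ 2 + (q * a0 - p * a1 + 2 * d2) ^ 2 +
      (p * a0 + q * a1 + r * a2) ^ 2 + (p * b0 + q * b1 + r * b2) ^ 2 +
      (p ^ 2 + q ^ 2 + r ^ 2) * (c0 ^ 2 + c1 ^ 2 + c2 ^ 2 + d0 ^ 2 + d1 ^ 2 + d2 ^ 2) +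
      2 * (p * c0 + q * c1 + r * c2) ^ 2 + 2 * (p * d0 + q * d1 + r * d2) ^ 2 := by positivity
  refine hs.trans (le_of_eq ?_)
  ring

/-- Energy estimate: by coercivity `e^{s|ξ|²}` times the squared length of the orbit is
nonincreasing in `s`. -/
theorem normSqSum_semigroupSymbol_le {t : ℝ} (ht : 0 ≤ t) (ξ : E3) (x : Idx → ℂ) :
    normSqSum (semigroupSymbol t ξ *ᵥ x) ≤ Real.exp (-t * ‖ξ‖ ^ 2) * normSqSum x := by
  let y : ℝ → Idx → ℂ := fun s => semigroupSymbol s ξ *ᵥ x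
  let F : ℝ → ℝ := fun s => Real.exp (s * ‖ξ‖ ^ 2) * normSqSum (y s)
  have hN : ∀ s, HasDerivAt (fun s => normSqSum (y s))
      (∑ a, 2 * inner ℝ (y s a) (-(linSymbol ξ *ᵥ y s) a)) s := by
    intro s
    have h := hasDerivAt_semigroupSymbol ξ x s
    rw [hasDerivAt_pi] at h
    exact HasDerivAt.fun_sum fun a _ => (h a).norm_sq
  have hE : ∀ s, HasDerivAt (fun s => Real.exp (s * ‖ξ‖ ^ 2))
      (Real.exp (s * ‖ξ‖ ^ 2) * ‖ξ‖ ^ 2) s := fun s => by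
    have := ((hasDerivAt_id s).mul_const (‖ξ‖ ^ 2)).exp
    simpa using this
  have hF : ∀ s, HasDerivAt F _ s := fun s => (hE s).mul (hN s)
  have hanti : Antitone F := by
    refine antitone_of_deriv_nonpos (fun s => (hF s).differentiableAt) fun s => ?_
    rw [(hF s).deriv]
    have h1 := linSymbol_coercive ξ (y s)
    simp only [inner_neg_right, ← Finset.mul_sum, Finset.sum_neg_distrib]
    have h2 : 0 < Real.exp (s * ‖ξ‖ ^ 2) := Real.exp_pos _
    nlinarith
  have h0 := hanti ht
  simp only [F, y, semigroupSymbol_zero, Matrix.one_mulVec, zero_mul, Real.exp_zero, one_mul] at h0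
  rw [neg_mul, Real.exp_neg, inv_mul_eq_div, le_div_iff₀ (Real.exp_pos _), mul_comm]
  exact h0

/-- The constant `3 ≥ √6` pays for passing from the Euclidean norm of `ℂ⁶` to the supremum norm. -/
theorem norm_semigroupSymbol_mulVec_le {t : ℝ} (ht : 0 ≤ t) (ξ : E3) (x : Idx → ℂ) :
    ‖semigroupSymbol t ξ *ᵥ x‖ ≤ 3 * Real.exp (-t * ‖ξ‖ ^ 2 / 2) * ‖x‖ := by
  refine (pow_le_pow_iff_left₀ (norm_nonneg _) (by positivity) two_ne_zero).1 ?_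
  calc ‖semigroupSymbol t ξ *ᵥ x‖ ^ 2 ≤ _ := norm_sq_le_normSqSum _
    _ ≤ _ := normSqSum_semigroupSymbol_le ht ξ x
    _ ≤ Real.exp (-t * ‖ξ‖ ^ 2) * (6 * ‖x‖ ^ 2) := by gcongr; exact normSqSum_le x
    _ ≤ Real.exp (-t * ‖ξ‖ ^ 2) * (9 * ‖x‖ ^ 2) := by gcongr; norm_num
    _ = _ := by
      have : Real.exp (-t * ‖ξ‖ ^ 2) = Real.exp (-t * ‖ξ‖ ^ 2 / 2) ^ 2 := by
        rw [← Real.exp_nat_mul]; congr 1; push_cast; ring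
      rw [this]; ring

theorem enorm_semigroupSymbol_mulVec_le {t : ℝ} (ht : 0 ≤ t) (ξ : E3) (x : Idx → ℂ) :
    ‖semigroupSymbol t ξ *ᵥ x‖ₑ ≤
      3 * ENNReal.ofReal (Real.exp (-t * ‖ξ‖ ^ 2 / 2)) * ‖x‖ₑ := by
  have h := ENNReal.ofReal_le_ofReal (norm_semigroupSymbol_mulVec_le ht ξ x)
  rw [ofReal_norm, ENNReal.ofReal_mul (by positivity), ENNReal.ofReal_mul (by norm_num),
    ofReal_norm] at h
  simpa using h

/-- The function `e^{cs} G(s) x` has derivative `-e^{cs} G(s)(𝓐 - c)x`, and the mean value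
inequality applies. The lemma serves twice: with `c = |ξ|²` it compares the flow with the heat flow
at high frequencies, and with `c = 0` it compares it with the identity at low ones. -/
theorem norm_semigroupSymbol_sub_le {t : ℝ} (ht : 0 ≤ t) (ξ : E3) (x : Idx → ℂ) {c : ℝ}
    (hc : 0 ≤ c) (hc' : c ≤ ‖ξ‖ ^ 2) :
    ‖semigroupSymbol t ξ *ᵥ x - Real.exp (-(c * t)) • x‖ ≤
      3 * t * Real.exp (-(c * t) / 2) * ‖linSymbol ξ *ᵥ x - c • x‖ := by
  let f : ℝ → Idx → ℂ := fun s => Real.exp (c * s) • (semigroupSymbol s ξ *ᵥ x)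
  let d : Idx → ℂ := linSymbol ξ *ᵥ x - c • x
  have hE : ∀ s, HasDerivAt (fun s => Real.exp (c * s)) (Real.exp (c * s) * c) s := fun s => by
    have := ((hasDerivAt_id s).const_mul c).exp
    simpa using this
  have hf : ∀ s, HasDerivAt f (-(Real.exp (c * s) • (semigroupSymbol s ξ *ᵥ d))) s := by
    intro s
    have h := (hE s).smul (hasDerivAt_semigroupSymbol ξ x s)
    refine h.congr_deriv ?_
    rw [linSymbol_mulVec_semigroupSymbol]
    simp only [d, Matrix.mulVec_sub, Matrix.mulVec_smul, smul_sub, smul_neg, smul_smul]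
    abel
  have hb : ∀ s ∈ Set.Ico 0 t, ‖-(Real.exp (c * s) • (semigroupSymbol s ξ *ᵥ d))‖ ≤
      3 * Real.exp (c * t / 2) * ‖d‖ := by
    intro s hs
    rw [norm_neg, norm_smul, Real.norm_of_nonneg (Real.exp_pos _).le]
    calc _ ≤ Real.exp (c * s) * (3 * Real.exp (-s * ‖ξ‖ ^ 2 / 2) * ‖d‖) := by
          gcongr; exact norm_semigroupSymbol_mulVec_le hs.1 ξ d
      _ = 3 * Real.exp (c * s + -s * ‖ξ‖ ^ 2 / 2) * ‖d‖ := by rw [Real.exp_add]; ring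
      _ ≤ _ := by
          gcongr
          nlinarith [mul_le_mul_of_nonneg_left hc' hs.1, mul_le_mul_of_nonneg_left hs.2.le hc]
  have key := norm_image_sub_le_of_norm_deriv_le_segment' (a := 0) (b := t)
    (fun s _ => (hf s).hasDerivWithinAt) hb t ⟨ht, le_rfl⟩
  simp only [f, semigroupSymbol_zero, Matrix.one_mulVec, mul_zero, Real.exp_zero, one_smul,
    sub_zero] at key
  have e : semigroupSymbol t ξ *ᵥ x - Real.exp (-(c * t)) • x = Real.exp (-(c * t)) •
      (Real.exp (c * t) • (semigroupSymbol t ξ *ᵥ x) - x) := by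
    rw [smul_sub, smul_smul, ← Real.exp_add]
    simp
  rw [e, norm_smul, Real.norm_of_nonneg (Real.exp_pos _).le]
  calc _ ≤ Real.exp (-(c * t)) * (3 * Real.exp (c * t / 2) * ‖d‖ * t) := by gcongr
    _ = 3 * t * (Real.exp (-(c * t)) * Real.exp (c * t / 2)) * ‖d‖ := by ring
    _ = _ := by rw [← Real.exp_add]; ring_nf; rfl

theorem sum_mul_linSymbol (ξ : E3) (x : Idx → ℂ) :
    ∑ k : Fin 3, (ξ k : ℂ) * (linSymbol ξ *ᵥ x) (Sum.inl k) =
      ((‖ξ‖ ^ 2 : ℝ) : ℂ) * ∑ k : Fin 3, (ξ k : ℂ) * x (Sum.inl k) := by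
  simp [linSymbol, curlSymbol, Matrix.mulVec, dotProduct, Fin.sum_univ_three,
    Fintype.sum_sum_type, Matrix.one_apply]
  ring

/-- Since a curl has no divergence, `ξ · u` solves the scalar equation `h' = -|ξ|² h` on its own. -/
theorem sum_mul_semigroupSymbol_eq_zero (t : ℝ) (ξ : E3) {x : Idx → ℂ}
    (hx : ∑ k : Fin 3, (ξ k : ℂ) * x (Sum.inl k) = 0) :
    ∑ k : Fin 3, (ξ k : ℂ) * (semigroupSymbol t ξ *ᵥ x) (Sum.inl k) = 0 := by
  let h : ℝ → ℂ := fun s => ∑ k : Fin 3, (ξ k : ℂ) * (semigroupSymbol s ξ *ᵥ x) (Sum.inl k)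
  have hh : ∀ s, HasDerivAt h (-(((‖ξ‖ ^ 2 : ℝ) : ℂ) * h s)) s := by
    intro s
    have h1 := hasDerivAt_semigroupSymbol ξ x s
    rw [hasDerivAt_pi] at h1
    have h2 : HasDerivAt h (∑ k : Fin 3, (ξ k : ℂ) *
        (-(linSymbol ξ *ᵥ (semigroupSymbol s ξ *ᵥ x))) (Sum.inl k)) s :=
      HasDerivAt.fun_sum fun k _ => (h1 (Sum.inl k)).const_mul _
    refine h2.congr_deriv ?_
    simp only [Pi.neg_apply, mul_neg, Finset.sum_neg_distrib, sum_mul_linSymbol, h]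
  have hE : ∀ s, HasDerivAt (fun s : ℝ => Real.exp (‖ξ‖ ^ 2 * s))
      (Real.exp (‖ξ‖ ^ 2 * s) * ‖ξ‖ ^ 2) s := fun s => by
    have := ((hasDerivAt_id s).const_mul (‖ξ‖ ^ 2)).exp
    simpa using this
  have hg : ∀ s, HasDerivAt (fun s => Real.exp (‖ξ‖ ^ 2 * s) • h s) 0 s := by
    intro s
    refine ((hE s).smul (hh s)).congr_deriv ?_
    simp only [Complex.real_smul]
    push_cast
    ring
  have hc := is_const_of_deriv_eq_zero (fun s => (hg s).differentiableAt)
    (fun s => (hg s).deriv) t 0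
  simp only [h, semigroupSymbol_zero, Matrix.one_mulVec, hx, smul_zero] at hc
  exact (smul_eq_zero.1 hc).resolve_left (Real.exp_pos _).ne'

section

/-! ### Bounds for the nonlinearity -/

theorem enorm_fourierProd_le_aux (z : ℂ) : ‖((2 * Real.pi) ^ 3 : ℂ)⁻¹ * z‖ₑ ≤ ‖z‖ₑ := by
  rw [enorm_mul]
  refine mul_le_of_le_one_left zero_le ?_
  rw [← enorm_one (G := ℂ), enorm_le_iff_norm_le]
  have h2 : (1 : ℝ) ≤ (2 * Real.pi) ^ 3 := one_le_pow₀ (by linarith [Real.pi_gt_three])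
  have h3 : ‖((2 * Real.pi) ^ 3 : ℂ)⁻¹‖ = ((2 * Real.pi) ^ 3)⁻¹ := by
    simp [abs_of_pos Real.pi_pos]
  rw [h3, norm_one]
  exact inv_le_one_of_one_le₀ h2

theorem enorm_pi_le {x : Idx → ℂ} {c : ℝ≥0∞} (h : ∀ a, ‖x a‖ₑ ≤ c) : ‖x‖ₑ ≤ c := by
  rcases eq_or_ne c ∞ with rfl | hc
  · exact le_top
  rw [← ofReal_norm, ENNReal.ofReal_le_iff_le_toReal hc,
    pi_norm_le_iff_of_nonneg ENNReal.toReal_nonneg]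
  intro a
  rw [← ENNReal.ofReal_le_iff_le_toReal hc, ofReal_norm]
  exact h a

theorem enorm_apply_le (x : Idx → ℂ) (a : Idx) : ‖x a‖ₑ ≤ ‖x‖ₑ := by
  rw [enorm_le_iff_norm_le]
  exact norm_le_pi_norm x a

theorem integrable_conv_integrand {f g : E3 → ℂ} {S : E3 → ℝ≥0∞} (hf : Measurable f)
    (hg : Measurable g) (hfS : ∀ η, ‖f η‖ₑ ≤ S η) (hgS : ∀ η, ‖g η‖ₑ ≤ S η) {ξ : E3}
    (hS : conv S S ξ < ∞) : Integrable (fun η => f (ξ - η) * g η) volume := by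
  refine ⟨((hf.comp (measurable_const.sub measurable_id)).mul hg).aestronglyMeasurable, ?_⟩
  refine lt_of_le_of_lt (lintegral_mono fun η => ?_) hS
  rw [enorm_mul]
  exact mul_le_mul' (hfS _) (hgS _)

/-- The usual splitting of a difference of products. The common majorant `S` makes both convolutions
absolutely convergent at `ξ`, without which the difference of integrals could not be merged. -/
theorem enorm_fourierProd_sub_le {f g f' g' : E3 → ℂ} {S D : E3 → ℝ≥0∞} (hf : Measurable f)
    (hg : Measurable g) (hf' : Measurable f') (hg' : Measurable g') (hfS : ∀ η, ‖f η‖ₑ ≤ S η)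
    (hgS : ∀ η, ‖g η‖ₑ ≤ S η) (hfS' : ∀ η, ‖f' η‖ₑ ≤ S η) (hgS' : ∀ η, ‖g' η‖ₑ ≤ S η)
    (hfD : ∀ η, ‖f η - f' η‖ₑ ≤ D η) (hgD : ∀ η, ‖g η - g' η‖ₑ ≤ D η)
    (hSm : Measurable S) (hDm : Measurable D) {ξ : E3} (hS : conv S S ξ < ∞) :
    ‖fourierProd f g ξ - fourierProd f' g' ξ‖ₑ ≤ 2 * conv D S ξ := by
  unfold fourierProd
  rw [← mul_sub, ← integral_sub (integrable_conv_integrand hf hg hfS hgS hS)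
    (integrable_conv_integrand hf' hg' hfS' hgS' hS)]
  refine (enorm_fourierProd_le_aux _).trans ((enorm_integral_le_lintegral_enorm _).trans ?_)
  have h1 : ∀ η, ‖f (ξ - η) * g η - f' (ξ - η) * g' η‖ₑ ≤
      D (ξ - η) * S η + S (ξ - η) * D η := fun η => by
    have : f (ξ - η) * g η - f' (ξ - η) * g' η =
        (f (ξ - η) - f' (ξ - η)) * g η + f' (ξ - η) * (g η - g' η) := by ring
    rw [this]
    refine (enorm_add_le _ _).trans ?_
    rw [enorm_mul, enorm_mul]
    exact add_le_add (mul_le_mul' (hfD _) (hgS _)) (mul_le_mul' (hfS' _) (hgD _))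
  have hm : Measurable fun η => D (ξ - η) * S η :=
    (hDm.comp (measurable_const.sub measurable_id)).mul hSm
  refine (lintegral_mono h1).trans ?_
  rw [lintegral_add_left hm, two_mul]
  exact add_le_add le_rfl (le_of_eq (conv_comm S D ξ))

theorem enorm_coord_le (ξ : E3) (k : Fin 3) : ‖(ξ k : ℂ)‖ₑ ≤ ‖ξ‖ₑ := by
  rw [enorm_le_iff_norm_le, Complex.norm_real]
  exact PiLp.norm_apply_le ξ k

theorem enorm_leraySymbol_le (ξ : E3) (i l : Fin 3) : ‖leraySymbol ξ i l‖ₑ ≤ 2 := by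
  have h2 : (2 : ℝ≥0∞) = ‖(2 : ℝ)‖ₑ := by simp [Real.enorm_eq_ofReal]
  rw [h2, enorm_le_iff_norm_le, leraySymbol, Matrix.of_apply]
  refine (norm_sub_le _ _).trans ?_
  have h1 : ‖(if i = l then (1 : ℂ) else 0)‖ ≤ 1 := by split_ifs <;> simp
  have h3 : ‖(ξ i : ℂ) * (ξ l : ℂ) / ((‖ξ‖ ^ 2 : ℝ) : ℂ)‖ ≤ 1 := by
    rw [norm_div, norm_mul, Complex.norm_real, Complex.norm_real, Complex.norm_real,
      Real.norm_of_nonneg (sq_nonneg ‖ξ‖)]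
    refine div_le_one_of_le₀ ?_ (sq_nonneg _)
    rw [sq]
    exact mul_le_mul (PiLp.norm_apply_le ξ i) (PiLp.norm_apply_le ξ l) (norm_nonneg _)
      (norm_nonneg _)
  rw [Real.norm_of_nonneg zero_le_two]
  linarith

section NonlinearityBounds

variable {w w' : E3 → Idx → ℂ} {S D : E3 → ℝ≥0∞}

theorem enorm_divTensor_sub_le (hw : Measurable w) (hw' : Measurable w')
    (hS : ∀ η, ‖w η‖ₑ ≤ S η) (hS' : ∀ η, ‖w' η‖ₑ ≤ S η) (hD : ∀ η, ‖w η - w' η‖ₑ ≤ D η)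
    (hSm : Measurable S) (hDm : Measurable D) {ξ : E3} (hξ : conv S S ξ < ∞)
    (e : Fin 3 → Idx) (l : Fin 3) :
    ‖divTensor (fun k η => w η (Sum.inl k)) (fun k η => w η (e k)) ξ l -
      divTensor (fun k η => w' η (Sum.inl k)) (fun k η => w' η (e k)) ξ l‖ₑ ≤
      6 * ‖ξ‖ₑ * conv D S ξ := by
  unfold divTensor
  rw [← Finset.sum_sub_distrib]
  refine (enorm_sum_le _ _).trans ?_
  have h1 : ∀ k : Fin 3, ‖Complex.I * (ξ k : ℂ) *
      fourierProd (fun η => w η (Sum.inl k)) (fun η => w η (e l)) ξ -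
      Complex.I * (ξ k : ℂ) *
      fourierProd (fun η => w' η (Sum.inl k)) (fun η => w' η (e l)) ξ‖ₑ ≤
      ‖ξ‖ₑ * (2 * conv D S ξ) := by
    intro k
    rw [← mul_sub, enorm_mul, enorm_mul]
    have hI : ‖Complex.I‖ₑ = 1 := by rw [← ofReal_norm, Complex.norm_I, ENNReal.ofReal_one]
    rw [hI, one_mul]
    refine mul_le_mul' (enorm_coord_le ξ k) ?_
    have hma : ∀ {v : E3 → Idx → ℂ}, Measurable v → ∀ a, Measurable fun η => v η a :=
      fun hv a => (measurable_pi_apply a).comp hv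
    exact enorm_fourierProd_sub_le (hma hw _) (hma hw _) (hma hw' _) (hma hw' _)
      (fun η => (enorm_apply_le _ _).trans (hS η)) (fun η => (enorm_apply_le _ _).trans (hS η))
      (fun η => (enorm_apply_le _ _).trans (hS' η)) (fun η => (enorm_apply_le _ _).trans (hS' η))
      (fun η => (enorm_apply_le (w η - w' η) _).trans (hD η))
      (fun η => (enorm_apply_le (w η - w' η) _).trans (hD η)) hSm hDm hξ
  refine (Finset.sum_le_sum fun k _ => h1 k).trans (le_of_eq ?_)
  rw [Finset.sum_const, Finset.card_univ, Fintype.card_fin, nsmul_eq_mul]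
  push_cast
  ring

/-- The constant is `36 = 3 · 2 · 6`: three entries in a row of the Leray symbol, each of size at
most `2`, applied to the bound `6 |ξ| (D * S)` for the divergence of the tensor. -/
theorem enorm_nonlinearity_sub_le (hw : Measurable w) (hw' : Measurable w')
    (hS : ∀ η, ‖w η‖ₑ ≤ S η) (hS' : ∀ η, ‖w' η‖ₑ ≤ S η) (hD : ∀ η, ‖w η - w' η‖ₑ ≤ D η)
    (hSm : Measurable S) (hDm : Measurable D) {ξ : E3} (hξ : conv S S ξ < ∞) :
    ‖nonlinearity w ξ - nonlinearity w' ξ‖ₑ ≤ 36 * ‖ξ‖ₑ * conv D S ξ := by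
  have hT := enorm_divTensor_sub_le hw hw' hS hS' hD hSm hDm hξ
  have hcomp : ∀ a, ‖(nonlinearity w ξ - nonlinearity w' ξ) a‖ₑ ≤ 36 * ‖ξ‖ₑ * conv D S ξ := by
    rintro (i | i)
    · simp only [nonlinearity, Pi.sub_apply, Sum.elim_inl]
      rw [← Pi.sub_apply, ← Matrix.mulVec_sub, Matrix.mulVec, dotProduct]
      refine (enorm_sum_le _ _).trans ?_
      have h1 : ∀ l : Fin 3, ‖leraySymbol ξ i l *
          ((divTensor (fun k η => w η (Sum.inl k)) (fun k η => w η (Sum.inl k)) ξ) -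
          (divTensor (fun k η => w' η (Sum.inl k)) (fun k η => w' η (Sum.inl k)) ξ)) l‖ₑ ≤
          2 * (6 * ‖ξ‖ₑ * conv D S ξ) := fun l => by
        rw [enorm_mul]
        exact mul_le_mul' (enorm_leraySymbol_le ξ i l) (hT Sum.inl l)
      refine (Finset.sum_le_sum fun l _ => h1 l).trans (le_of_eq ?_)
      rw [Finset.sum_const, Finset.card_univ, Fintype.card_fin, nsmul_eq_mul]
      push_cast
      ring
    · simp only [nonlinearity, Pi.sub_apply, Sum.elim_inr]
      refine (hT Sum.inr i).trans ?_
      gcongr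
      norm_num
  exact enorm_pi_le hcomp

end NonlinearityBounds

theorem nonlinearity_zero (ξ : E3) : nonlinearity (fun _ => 0) ξ = 0 := by
  have h : ∀ f : Fin 3 → E3 → ℂ, divTensor (fun _ _ => 0) f ξ = 0 := fun f => by
    ext l
    simp [divTensor, fourierProd]
  ext a
  rcases a with a | a <;> simp [nonlinearity, h]

/-- Convolutions ignore null sets, so equality holds at every `ξ`. This later allows an equation
that holds almost everywhere to be corrected to one that holds everywhere. -/
theorem nonlinearity_congr {w w' : E3 → Idx → ℂ} (h : w =ᵐ[volume] w') (ξ : E3) :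
    nonlinearity w ξ = nonlinearity w' ξ := by
  have h2 : ∀ᵐ η, w (ξ - η) = w' (ξ - η) :=
    (quasiMeasurePreserving_sub_left volume ξ).ae h
  have hf : ∀ a b, fourierProd (fun η => w η a) (fun η => w η b) ξ =
      fourierProd (fun η => w' η a) (fun η => w' η b) ξ := fun a b => by
    unfold fourierProd
    congr 1
    refine integral_congr_ae ?_
    filter_upwards [h, h2] with η h1 h2
    rw [h1, h2]
  have hd : ∀ e : Fin 3 → Idx,
      divTensor (fun k η => w η (Sum.inl k)) (fun k η => w η (e k)) ξ =
      divTensor (fun k η => w' η (Sum.inl k)) (fun k η => w' η (e k)) ξ := fun e => by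
    funext l
    exact Finset.sum_congr rfl fun k _ => by rw [hf]
  unfold nonlinearity
  rw [hd Sum.inl, hd Sum.inr]

theorem measurable_matrix_mulVec {α m n : Type*} [MeasurableSpace α] [Fintype n]
    {M : α → Matrix m n ℂ} {x : α → n → ℂ} (hM : ∀ i j, Measurable fun a => M a i j)
    (hx : Measurable x) : Measurable fun a => M a *ᵥ x a := by
  refine measurable_pi_iff.2 fun i => ?_
  simp only [Matrix.mulVec, dotProduct]
  exact Finset.measurable_sum _ fun j _ => (hM i j).mul ((measurable_pi_apply j).comp hx)

/-! ### The Duhamel term -/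

section Duhamel

variable {v v' : ℝ → E3 → Idx → ℂ} {S D : ℝ → E3 → ℝ≥0∞}

theorem measurable_nonlinearity (hv : Measurable (Function.uncurry v)) :
    Measurable fun z : ℝ × E3 => nonlinearity (v z.1) z.2 := by
  have hcoord : ∀ k : Fin 3, Measurable fun z : ℝ × E3 => (z.2 k : ℂ) := fun k => by
    have : Continuous fun z : ℝ × E3 => (z.2 k : ℂ) := by fun_prop
    exact this.measurable
  have hfp : ∀ a b, Measurable fun z : ℝ × E3 =>
      fourierProd (fun η => v z.1 η a) (fun η => v z.1 η b) z.2 := by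
    intro a b
    have h1 : Measurable fun z : (ℝ × E3) × E3 => v z.1.1 (z.1.2 - z.2) a * v z.1.1 z.2 b := by
      refine Measurable.mul ?_ ?_
      · exact (measurable_pi_apply a).comp
          (hv.comp (measurable_fst.fst.prodMk (measurable_fst.snd.sub measurable_snd)))
      · exact (measurable_pi_apply b).comp (hv.comp (measurable_fst.fst.prodMk measurable_snd))
    exact (h1.stronglyMeasurable.integral_prod_right' (ν := (volume : Measure E3))).measurable.const_mul _
  have hdiv : ∀ e : Fin 3 → Idx, Measurable fun z : ℝ × E3 => divTensor
      (fun k η => v z.1 η (Sum.inl k)) (fun k η => v z.1 η (e k)) z.2 := by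
    intro e
    refine measurable_pi_iff.2 fun l => ?_
    unfold divTensor
    exact Finset.measurable_sum _ fun k _ => ((hcoord k).const_mul _).mul (hfp _ _)
  have hleray : ∀ i l, Measurable fun z : ℝ × E3 => leraySymbol z.2 i l := by
    intro i l
    unfold leraySymbol
    simp only [Matrix.of_apply]
    refine measurable_const.sub (((hcoord i).mul (hcoord l)).div ?_)
    have : Continuous fun z : ℝ × E3 => ((‖z.2‖ ^ 2 : ℝ) : ℂ) := by fun_prop
    exact this.measurable
  refine measurable_pi_iff.2 ?_
  rintro (i | i)
  · have := measurable_matrix_mulVec hleray (hdiv Sum.inl)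
    exact (measurable_pi_apply i).comp this
  · exact (measurable_pi_apply i).comp (hdiv Sum.inr)

theorem measurable_semigroupSymbol (i j : Idx) :
    Measurable fun z : ℝ × E3 => semigroupSymbol z.1 z.2 i j :=
  (continuous_semigroupSymbol.matrix_elem i j).measurable

/-- The Fourier transform of the Duhamel term
`∫₀ᵗ G(t-τ) (P ∇·(u ⊗ u), ∇·(u ⊗ ω))(τ) dτ`. -/
def duh (v : ℝ → E3 → Idx → ℂ) (t : ℝ) (ξ : E3) : Idx → ℂ :=
  ∫ τ in Set.Ioc 0 t, semigroupSymbol (t - τ) ξ *ᵥ nonlinearity (v τ) ξ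

/-- The Fourier transform of the linear evolution `G(t) f`. -/
def linEvol (g : E3 → Idx → ℂ) (t : ℝ) (ξ : E3) : Idx → ℂ := semigroupSymbol t ξ *ᵥ g ξ

theorem measurable_linEvol {g : E3 → Idx → ℂ} (hg : Measurable g) :
    Measurable (Function.uncurry (linEvol g)) :=
  measurable_matrix_mulVec measurable_semigroupSymbol (hg.comp measurable_snd)

attribute [local irreducible] semigroupSymbol nonlinearity

theorem measurable_duh_integrand (hv : Measurable (Function.uncurry v)) :
    Measurable fun z : (ℝ × E3) × ℝ =>
      semigroupSymbol (z.1.1 - z.2) z.1.2 *ᵥ nonlinearity (v z.2) z.1.2 := by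
  have h1 : Measurable fun z : (ℝ × E3) × ℝ => (z.1.1 - z.2, z.1.2) :=
    (measurable_fst.fst.sub measurable_snd).prodMk measurable_fst.snd
  have h2 : Measurable fun z : (ℝ × E3) × ℝ => (z.2, z.1.2) :=
    measurable_snd.prodMk measurable_fst.snd
  have h3 : ∀ i j, Measurable fun z : (ℝ × E3) × ℝ => semigroupSymbol (z.1.1 - z.2) z.1.2 i j :=
    fun i j => (measurable_semigroupSymbol i j).comp h1
  have h4 : Measurable fun z : (ℝ × E3) × ℝ => nonlinearity (v z.2) z.1.2 :=
    (measurable_nonlinearity hv).comp h2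
  exact measurable_matrix_mulVec h3 h4

theorem measurable_duh (hv : Measurable (Function.uncurry v)) :
    Measurable (Function.uncurry (duh v)) := by
  have h1 : Measurable fun z : (ℝ × E3) × ℝ => {z : (ℝ × E3) × ℝ | 0 < z.2 ∧ z.2 ≤ z.1.1}.indicator
      (fun z => semigroupSymbol (z.1.1 - z.2) z.1.2 *ᵥ nonlinearity (v z.2) z.1.2) z := by
    refine (measurable_duh_integrand hv).indicator ?_
    exact (measurableSet_lt measurable_const measurable_snd).inter
      (measurableSet_le measurable_snd measurable_fst.fst)
  have h2 := (h1.stronglyMeasurable.integral_prod_right' (ν := (volume : Measure ℝ))).measurable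
  convert h2 using 1
  ext1 z
  simp only [Function.uncurry, duh]
  rw [← integral_indicator measurableSet_Ioc]
  rfl

theorem measurable_enorm_sub (hv : Measurable (Function.uncurry v))
    (hv' : Measurable (Function.uncurry v')) :
    Measurable (Function.uncurry fun t ξ => ‖v t ξ - v' t ξ‖ₑ) :=
  (hv.sub hv').enorm

theorem duh_zero (t : ℝ) (ξ : E3) : duh (fun _ _ => 0) t ξ = 0 := by
  simp [duh, nonlinearity_zero]

theorem duh_congr (h : ∀ᵐ τ ∂timeMeasure, v τ =ᵐ[volume] v' τ) : duh v = duh v' := by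
  ext1 t
  ext1 ξ
  unfold duh
  refine integral_congr_ae ?_
  filter_upwards [ae_restrict_of_ae_restrict_of_subset Set.Ioc_subset_Ioi_self h] with τ hτ
  rw [nonlinearity_congr hτ]

/-- The majorant `S * S` is integrable in `(τ, ξ)` jointly, so Tonelli's theorem gives a null set of
bad frequencies that does not depend on time. Every later estimate valid for almost every `ξ` and
all `t` at once uses this set. -/
theorem ae_lintegral_conv_lt_top (hS : Measurable (Function.uncurry S)) (h : znorm S < ∞) :
    ∀ᵐ ξ, ∫⁻ τ, conv (S τ) (S τ) ξ ∂timeMeasure < ∞ := by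
  have hm := measurable_conv hS hS
  have h1 := (lintegral_lintegral_conv_le hS hS).trans_lt (ENNReal.mul_lt_top h h)
  rw [lintegral_lintegral_swap hm.aemeasurable] at h1
  refine ae_lt_top ?_ h1.ne
  exact (hm.comp measurable_swap).lintegral_prod_right'

theorem ae_conv_lt_top (hS : Measurable (Function.uncurry S)) {ξ : E3}
    (hξ : ∫⁻ τ, conv (S τ) (S τ) ξ ∂timeMeasure < ∞) :
    ∀ᵐ τ ∂timeMeasure, conv (S τ) (S τ) ξ < ∞ := by
  have hm : Measurable fun τ => conv (S τ) (S τ) ξ :=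
    (measurable_conv hS hS).comp measurable_prodMk_right
  exact ae_lt_top hm hξ.ne

theorem integrableOn_nonlinearity (hv : Measurable (Function.uncurry v))
    (hS : Measurable (Function.uncurry S)) (hvS : ∀ t ξ, ‖v t ξ‖ₑ ≤ S t ξ) {ξ : E3}
    (hξ : ∫⁻ τ, conv (S τ) (S τ) ξ ∂timeMeasure < ∞) :
    IntegrableOn (fun τ => nonlinearity (v τ) ξ) (Set.Ioi 0) := by
  have hm : Measurable fun τ => nonlinearity (v τ) ξ :=
    (measurable_nonlinearity hv).comp measurable_prodMk_right
  have hN : ∀ᵐ τ ∂timeMeasure, ‖nonlinearity (v τ) ξ‖ₑ ≤ 36 * ‖ξ‖ₑ * conv (S τ) (S τ) ξ := by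
    filter_upwards [ae_conv_lt_top hS hξ] with τ hτ
    have hSs : Measurable (S τ) := hS.comp measurable_prodMk_left
    have hvs : Measurable (v τ) := hv.comp measurable_prodMk_left
    have := enorm_nonlinearity_sub_le (w' := fun _ => 0) hvs measurable_const
      (hvS τ) (fun η => by simp) (D := S τ) (fun η => by simpa using hvS τ η) hSs hSs hτ
    rwa [nonlinearity_zero, sub_zero] at this
  refine ⟨hm.aestronglyMeasurable, lt_of_le_of_lt (lintegral_mono_ae hN) ?_⟩
  rw [lintegral_const_mul' _ _ (ENNReal.mul_ne_top (by simp) (by simp))]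
  exact ENNReal.mul_lt_top (ENNReal.mul_lt_top (by simp) (by simp)) hξ

theorem integrableOn_duh_integrand (hv : Measurable (Function.uncurry v))
    (hS : Measurable (Function.uncurry S)) (hvS : ∀ t ξ, ‖v t ξ‖ₑ ≤ S t ξ) {ξ : E3}
    (hξ : ∫⁻ τ, conv (S τ) (S τ) ξ ∂timeMeasure < ∞) (t : ℝ) :
    IntegrableOn (fun τ => semigroupSymbol (t - τ) ξ *ᵥ nonlinearity (v τ) ξ) (Set.Ioc 0 t) := by
  have h1 : IntegrableOn (fun τ => nonlinearity (v τ) ξ) (Set.Ioc 0 t) :=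
    (integrableOn_nonlinearity hv hS hvS hξ).mono_set Set.Ioc_subset_Ioi_self
  have h2 : Measurable fun τ : ℝ => ((t, ξ), τ) := measurable_const.prodMk measurable_id
  have hm : Measurable fun τ => semigroupSymbol (t - τ) ξ *ᵥ nonlinearity (v τ) ξ :=
    (measurable_duh_integrand hv).comp h2
  refine (h1.norm.const_mul 3).mono' hm.aestronglyMeasurable ?_
  filter_upwards [ae_restrict_mem measurableSet_Ioc] with τ hτ
  refine (norm_semigroupSymbol_mulVec_le (sub_nonneg.2 hτ.2) ξ _).trans ?_
  gcongr
  refine mul_le_of_le_one_right (by norm_num) (Real.exp_le_one_iff.2 ?_)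
  have : 0 ≤ (t - τ) * ‖ξ‖ ^ 2 := mul_nonneg (sub_nonneg.2 hτ.2) (sq_nonneg _)
  linarith

/-- The difference of two Duhamel terms, at every frequency where the majorant is finite. -/
theorem duh_sub_le (hv : Measurable (Function.uncurry v)) (hv' : Measurable (Function.uncurry v'))
    (hS : Measurable (Function.uncurry S)) (hvS : ∀ t ξ, ‖v t ξ‖ₑ ≤ S t ξ)
    (hvS' : ∀ t ξ, ‖v' t ξ‖ₑ ≤ S t ξ) {ξ : E3}
    (hξ : ∫⁻ τ, conv (S τ) (S τ) ξ ∂timeMeasure < ∞) (t : ℝ) :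
    ‖duh v t ξ - duh v' t ξ‖ₑ ≤ 108 * duhMaj (fun t ξ => ‖v t ξ - v' t ξ‖ₑ) S t ξ := by
  have hfin := ae_conv_lt_top hS hξ
  unfold duh
  rw [← integral_sub (integrableOn_duh_integrand hv hS hvS hξ t)
    (integrableOn_duh_integrand hv' hS hvS' hξ t)]
  refine (enorm_integral_le_lintegral_enorm _).trans ?_
  unfold duhMaj
  rw [← lintegral_const_mul' _ _ (by simp)]
  refine le_trans (lintegral_mono_ae ?_) (lintegral_mono_set Set.Ioc_subset_Ioi_self)
  filter_upwards [ae_restrict_mem measurableSet_Ioc,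
    ae_restrict_of_ae_restrict_of_subset Set.Ioc_subset_Ioi_self hfin] with τ hτ hτ2
  have hSs : Measurable (S τ) := hS.comp measurable_prodMk_left
  have hvs : Measurable (v τ) := hv.comp measurable_prodMk_left
  have hvs' : Measurable (v' τ) := hv'.comp measurable_prodMk_left
  have hDs : Measurable fun η => ‖v τ η - v' τ η‖ₑ := (hvs.sub hvs').enorm
  rw [← Matrix.mulVec_sub]
  refine (enorm_semigroupSymbol_mulVec_le (sub_nonneg.2 hτ.2) ξ _).trans ?_
  have h3 := enorm_nonlinearity_sub_le hvs hvs' (hvS τ) (hvS' τ)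
    (D := fun η => ‖v τ η - v' τ η‖ₑ) (fun η => le_rfl) hSs hDs hτ2
  refine (mul_le_mul' le_rfl h3).trans (le_of_eq ?_)
  rw [heatKernel, if_pos hτ.2, ENNReal.ofReal_mul (norm_nonneg _), ofReal_norm]
  have : (108 : ℝ≥0∞) = 3 * 36 := by norm_num
  rw [this]
  ring

theorem enorm_duh_le (hv : Measurable (Function.uncurry v)) (hS : Measurable (Function.uncurry S))
    (hvS : ∀ t ξ, ‖v t ξ‖ₑ ≤ S t ξ) {ξ : E3}
    (hξ : ∫⁻ τ, conv (S τ) (S τ) ξ ∂timeMeasure < ∞) (t : ℝ) :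
    ‖duh v t ξ‖ₑ ≤ 108 * duhMaj S S t ξ := by
  have := (duh_sub_le (v' := fun _ _ => 0) hv measurable_const hS hvS (by simp) hξ t)
  rw [duh_zero, sub_zero] at this
  refine this.trans (mul_le_mul' le_rfl ?_)
  refine lintegral_mono fun τ => mul_le_mul' le_rfl (conv_mono (fun η => ?_) (fun η => le_rfl) ξ)
  simpa using hvS τ η

end Duhamel

end

section

/-! ### Existence of solutions with small data -/

/-- The `L²(0, ∞; L¹)` norm of a vector valued function. -/
def vnorm (v : ℝ → E3 → Idx → ℂ) : ℝ≥0∞ := znorm fun t ξ => ‖v t ξ‖ₑ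

section FixedPoint

variable {v v' w : ℝ → E3 → Idx → ℂ}

theorem measurable_enorm_vec (hv : Measurable (Function.uncurry v)) :
    Measurable (Function.uncurry fun t ξ => ‖v t ξ‖ₑ) := hv.enorm

theorem vnorm_congr (h : ∀ᵐ t ∂timeMeasure, v t =ᵐ[volume] v' t) : vnorm v = vnorm v' := by
  refine le_antisymm (znorm_mono ?_) (znorm_mono ?_)
  · filter_upwards [h] with t ht
    filter_upwards [ht] with ξ hξ
    rw [hξ]
  · filter_upwards [h] with t ht
    filter_upwards [ht] with ξ hξ
    rw [hξ]

theorem vnorm_add_le (hv : Measurable (Function.uncurry v))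
    (hv' : Measurable (Function.uncurry v')) :
    vnorm (fun t ξ => v t ξ + v' t ξ) ≤ vnorm v + vnorm v' :=
  (znorm_mono (Eventually.of_forall fun _ => Eventually.of_forall fun _ => enorm_add_le _ _)).trans
    (znorm_add_le (measurable_enorm_vec hv) (measurable_enorm_vec hv'))

theorem vnorm_neg : vnorm (fun t ξ => -v t ξ) = vnorm v := by
  simp only [vnorm, enorm_neg]

theorem vnorm_sub_comm : vnorm (fun t ξ => v t ξ - v' t ξ) = vnorm (fun t ξ => v' t ξ - v t ξ) := by
  simp only [vnorm, enorm_sub_rev]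

theorem vnorm_sub_le (hv : Measurable (Function.uncurry v))
    (hv' : Measurable (Function.uncurry v')) :
    vnorm (fun t ξ => v t ξ - v' t ξ) ≤ vnorm v + vnorm v' := by
  simp_rw [sub_eq_add_neg]
  refine (vnorm_add_le (v' := fun t ξ => -v' t ξ) hv hv'.neg).trans ?_
  rw [vnorm_neg]

theorem vnorm_sub_le_add (hv : Measurable (Function.uncurry v))
    (hv' : Measurable (Function.uncurry v')) (hw : Measurable (Function.uncurry w)) :
    vnorm (fun t ξ => v t ξ - w t ξ) ≤
      vnorm (fun t ξ => v t ξ - v' t ξ) + vnorm (fun t ξ => v' t ξ - w t ξ) := by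
  refine le_trans (le_of_eq ?_) (vnorm_add_le (hv.sub hv') (hv'.sub hw))
  simp

theorem ae_eq_of_vnorm_sub_eq_zero (hv : Measurable (Function.uncurry v))
    (hv' : Measurable (Function.uncurry v')) (h : vnorm (fun t ξ => v t ξ - v' t ξ) = 0) :
    ∀ᵐ t ∂timeMeasure, v t =ᵐ[volume] v' t := by
  filter_upwards [ae_ae_eq_zero_of_znorm (measurable_enorm_sub hv hv') h] with t ht
  filter_upwards [ht] with ξ hξ
  exact sub_eq_zero.1 (enorm_eq_zero.1 hξ)

theorem vnorm_duh_sub_le (hv : Measurable (Function.uncurry v))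
    (hv' : Measurable (Function.uncurry v')) (h : vnorm v < ∞) (h' : vnorm v' < ∞) :
    vnorm (fun t ξ => duh v t ξ - duh v' t ξ) ≤
      108 * (vnorm (fun t ξ => v t ξ - v' t ξ) * (vnorm v + vnorm v')) := by
  let S : ℝ → E3 → ℝ≥0∞ := fun t ξ => ‖v t ξ‖ₑ + ‖v' t ξ‖ₑ
  have hS : Measurable (Function.uncurry S) :=
    (measurable_enorm_vec hv).add (measurable_enorm_vec hv')
  have hSz : znorm S ≤ vnorm v + vnorm v' :=
    znorm_add_le (measurable_enorm_vec hv) (measurable_enorm_vec hv')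
  have hae := ae_lintegral_conv_lt_top hS (hSz.trans_lt (ENNReal.add_lt_top.2 ⟨h, h'⟩))
  calc vnorm (fun t ξ => duh v t ξ - duh v' t ξ)
      ≤ znorm (fun t ξ => 108 * duhMaj (fun t ξ => ‖v t ξ - v' t ξ‖ₑ) S t ξ) := by
        refine znorm_mono (Eventually.of_forall fun t => ?_)
        filter_upwards [hae] with ξ hξ
        exact duh_sub_le hv hv' hS (fun _ _ => le_self_add) (fun _ _ => le_add_self) hξ t
    _ = 108 * znorm (duhMaj (fun t ξ => ‖v t ξ - v' t ξ‖ₑ) S) := znorm_const_mul (by simp)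
    _ ≤ _ := by
        gcongr
        refine (znorm_duhMaj_le (measurable_enorm_sub hv hv') hS).trans ?_
        gcongr
        exact le_rfl

theorem vnorm_zero : vnorm (fun _ _ => 0) = 0 := by
  simp [vnorm, znorm, timeL2]

theorem vnorm_duh_le (hv : Measurable (Function.uncurry v)) (h : vnorm v < ∞) :
    vnorm (duh v) ≤ 108 * (vnorm v * vnorm v) := by
  have := vnorm_duh_sub_le (v' := fun _ _ => 0) hv measurable_const h (by simp [vnorm_zero])
  simpa [duh_zero, vnorm_zero] using this

/-- The Picard iterates. -/
def picard (g : E3 → Idx → ℂ) : ℕ → ℝ → E3 → Idx → ℂ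
  | 0 => fun _ _ => 0
  | n + 1 => fun t ξ => linEvol g t ξ - duh (picard g n) t ξ

variable {g : E3 → Idx → ℂ} {ε : ℝ≥0∞}

theorem measurable_picard (hg : Measurable g) (n : ℕ) :
    Measurable (Function.uncurry (picard g n)) := by
  induction n with
  | zero => exact measurable_const
  | succ n ih => exact (measurable_linEvol hg).sub (measurable_duh ih)

theorem ne_top_of_small (hs : 864 * ε ≤ 1) : ε ≠ ∞ := by
  rintro rfl
  rw [ENNReal.mul_top (by norm_num)] at hs
  exact absurd hs (by simp)

theorem vnorm_picard_le (hg : Measurable g) (hε : vnorm (linEvol g) ≤ ε) (hs : 864 * ε ≤ 1)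
    (n : ℕ) : vnorm (picard g n) ≤ 2 * ε := by
  induction n with
  | zero => exact (le_of_eq vnorm_zero).trans zero_le
  | succ n ih =>
    have hm := measurable_picard hg n
    have hfin : vnorm (picard g n) < ∞ :=
      ih.trans_lt (ENNReal.mul_lt_top (by simp) (ne_top_of_small hs).lt_top)
    calc vnorm (picard g (n + 1)) ≤ vnorm (linEvol g) + vnorm (duh (picard g n)) :=
          vnorm_sub_le (measurable_linEvol hg) (measurable_duh hm)
      _ ≤ ε + 108 * ((2 * ε) * (2 * ε)) := by
          refine add_le_add hε ((vnorm_duh_le hm hfin).trans ?_)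
          exact mul_le_mul_right (mul_le_mul' ih ih) _
      _ ≤ ε + (864 * ε) * ε := by
          refine add_le_add le_rfl ?_
          calc 108 * ((2 * ε) * (2 * ε)) = 432 * ε * ε := by ring
            _ ≤ _ := by gcongr; norm_num
      _ ≤ ε + 1 * ε := by gcongr
      _ = 2 * ε := by ring

/-- The number `864 = 2 · 108 · 4` makes the Lipschitz constant `108 (‖v‖ + ‖v'‖)` of the Duhamel
term at most `1/2` on the ball of radius `2ε`. -/
theorem contraction_const (hs : 864 * ε ≤ 1) (x : ℝ≥0∞) :
    108 * (x * (2 * ε + 2 * ε)) ≤ 2⁻¹ * x := by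
  calc 108 * (x * (2 * ε + 2 * ε)) = 432 * ε * x := by ring
    _ = (2⁻¹ * 2) * (432 * ε * x) := by rw [ENNReal.inv_mul_cancel (by simp) (by simp), one_mul]
    _ = 2⁻¹ * (864 * ε * x) := by ring
    _ ≤ 2⁻¹ * (1 * x) := by gcongr
    _ = _ := by rw [one_mul]

theorem vnorm_duh_sub_le_half (hv : Measurable (Function.uncurry v))
    (hv' : Measurable (Function.uncurry v')) (h : vnorm v ≤ 2 * ε) (h' : vnorm v' ≤ 2 * ε)
    (hs : 864 * ε ≤ 1) :
    vnorm (fun t ξ => duh v t ξ - duh v' t ξ) ≤ 2⁻¹ * vnorm (fun t ξ => v t ξ - v' t ξ) := by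
  have hf : 2 * ε < ∞ := ENNReal.mul_lt_top (by simp) (ne_top_of_small hs).lt_top
  refine (vnorm_duh_sub_le hv hv' (h.trans_lt hf) (h'.trans_lt hf)).trans ?_
  refine le_trans ?_ (contraction_const hs _)
  gcongr

theorem vnorm_picard_sub_le (hg : Measurable g) (hε : vnorm (linEvol g) ≤ ε) (hs : 864 * ε ≤ 1)
    (n : ℕ) : vnorm (fun t ξ => picard g n t ξ - picard g (n + 1) t ξ) ≤ 2⁻¹ ^ n * ε := by
  induction n with
  | zero =>
    simp only [picard, duh_zero, sub_zero, zero_sub, pow_zero, one_mul]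
    rw [vnorm_neg]
    exact hε
  | succ n ih =>
    have e : vnorm (fun t ξ => picard g (n + 1) t ξ - picard g (n + 1 + 1) t ξ) =
        vnorm (fun t ξ => duh (picard g n) t ξ - duh (picard g (n + 1)) t ξ) := by
      rw [vnorm_sub_comm (v := duh (picard g n))]
      congr 1
      ext1 t
      ext1 ξ
      change linEvol g t ξ - _ - (linEvol g t ξ - _) = _
      rw [sub_sub_sub_cancel_left]
    rw [e]
    refine (vnorm_duh_sub_le_half (measurable_picard hg n) (measurable_picard hg (n + 1))
      (vnorm_picard_le hg hε hs n) (vnorm_picard_le hg hε hs _) hs).trans ?_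
    calc _ ≤ 2⁻¹ * (2⁻¹ ^ n * ε) := by gcongr
      _ = _ := by rw [pow_succ]; ring

/-- The limit is built by hand as in the proof of the Riesz–Fischer theorem. The telescoping series
of the iterates has finite norm, hence converges absolutely almost everywhere, and its tails bound
the distance to the limit. -/
theorem exists_picard_limit (hg : Measurable g) (hε : vnorm (linEvol g) ≤ ε)
    (hs : 864 * ε ≤ 1) : ∃ w : ℝ → E3 → Idx → ℂ, Measurable (Function.uncurry w) ∧
      ∀ n, vnorm (fun t ξ => picard g n t ξ - w t ξ) ≤ 2⁻¹ ^ n * (2 * ε) := by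
  let D : ℕ → ℝ → E3 → ℝ≥0∞ := fun n t ξ => ‖picard g n t ξ - picard g (n + 1) t ξ‖ₑ
  have hDm : ∀ n, Measurable (Function.uncurry (D n)) := fun n =>
    measurable_enorm_sub (measurable_picard hg n) (measurable_picard hg (n + 1))
  have hD : ∀ n, znorm (D n) ≤ 2⁻¹ ^ n * ε := vnorm_picard_sub_le hg hε hs
  have htail : ∀ n, znorm (fun t ξ => ∑' m, D (n + m) t ξ) ≤ 2⁻¹ ^ n * (2 * ε) := by
    intro n
    refine (znorm_tsum_le fun m => hDm (n + m)).trans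
      ((ENNReal.tsum_le_tsum fun m => hD (n + m)).trans (le_of_eq ?_))
    simp_rw [pow_add, mul_assoc]
    rw [ENNReal.tsum_mul_left, ENNReal.tsum_mul_right, ENNReal.tsum_geometric,
      ENNReal.one_sub_inv_two, inv_inv]
  have hsum : ∀ᵐ t ∂timeMeasure, ∀ᵐ ξ, ∑' m, D m t ξ < ∞ := by
    refine ae_ae_lt_top_of_znorm (A := fun t ξ => ∑' m, D m t ξ)
      (Measurable.tsum hDm) ?_
    have := htail 0
    simp only [zero_add, pow_zero, one_mul] at this
    exact this.trans_lt (ENNReal.mul_lt_top (by simp) (ne_top_of_small hs).lt_top)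
  have hcauchy : ∀ t ξ, ∑' m, D m t ξ < ∞ → CauchySeq fun n => picard g n t ξ := by
    intro t ξ h
    refine cauchySeq_of_edist_le_of_tsum_ne_top (fun n => D n t ξ) (fun n => ?_) h.ne
    rw [edist_eq_enorm_sub]
  have hprod : ∀ᵐ z ∂(timeMeasure.prod (volume : Measure E3)),
      ∃ l, Tendsto (fun n => Function.uncurry (picard g n) z) atTop (𝓝 l) := by
    have h1 : ∀ᵐ z ∂(timeMeasure.prod (volume : Measure E3)), ∑' m, D m z.1 z.2 < ∞ := by
      have hms : MeasurableSet {z : ℝ × E3 | ∑' m, D m z.1 z.2 < ∞} :=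
        measurableSet_lt (Measurable.tsum hDm) measurable_const
      exact (Measure.ae_prod_iff_ae_ae hms).2 hsum
    filter_upwards [h1] with z hz
    exact cauchySeq_tendsto_of_complete (hcauchy z.1 z.2 hz)
  obtain ⟨w, hw, hlim⟩ := exists_stronglyMeasurable_limit_of_tendsto_ae
    (fun n => (measurable_picard hg n).aestronglyMeasurable) hprod
  refine ⟨fun t ξ => w (t, ξ), hw.measurable, fun n => ?_⟩
  refine le_trans (znorm_mono ?_) (htail n)
  filter_upwards [Measure.ae_ae_of_ae_prod hlim, hsum] with t ht ht2
  filter_upwards [ht, ht2] with ξ hξ hξ2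
  rw [← edist_eq_enorm_sub]
  exact edist_le_tsum_of_edist_le_of_tendsto (fun n => D n t ξ)
    (fun n => by rw [edist_eq_enorm_sub]; exact le_rfl) hξ n

/-- Existence of a solution of the mild equation in `L²(0, ∞; L¹)` for small data. -/
theorem exists_mild (hg : Measurable g) (hε : vnorm (linEvol g) ≤ ε) (hs : 864 * ε ≤ 1) :
    ∃ v : ℝ → E3 → Idx → ℂ, Measurable (Function.uncurry v) ∧ vnorm v ≤ 2 * ε ∧
      ∀ t ξ, v t ξ = linEvol g t ξ - duh v t ξ := by
  obtain ⟨w, hw, hlim⟩ := exists_picard_limit hg hε hs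
  have hwz : vnorm w ≤ 2 * ε := by
    have := hlim 0
    simpa only [picard, zero_sub, vnorm_neg, pow_zero, one_mul] using this
  -- The limit `w` solves the equation only almost everywhere. The right-hand side evaluated at `w`
  -- is a version that solves it for all `t` and `ξ`, since the Duhamel term depends only on the
  -- class of `w`.
  let v : ℝ → E3 → Idx → ℂ := fun t ξ => linEvol g t ξ - duh w t ξ
  have hv : Measurable (Function.uncurry v) := (measurable_linEvol hg).sub (measurable_duh hw)
  have hzero : vnorm (fun t ξ => v t ξ - w t ξ) = 0 := by
    have hb : ∀ n : ℕ, vnorm (fun t ξ => v t ξ - w t ξ) ≤ 2⁻¹ ^ n * (4 * ε) := by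
      intro n
      refine (vnorm_sub_le_add hv (measurable_picard hg (n + 1)) hw).trans ?_
      have e : vnorm (fun t ξ => v t ξ - picard g (n + 1) t ξ) =
          vnorm (fun t ξ => duh (picard g n) t ξ - duh w t ξ) := by
        congr 1
        ext1 t
        ext1 ξ
        change linEvol g t ξ - _ - (linEvol g t ξ - _) = _
        rw [sub_sub_sub_cancel_left]
      rw [e]
      have h1 := vnorm_duh_sub_le_half (measurable_picard hg n) hw
        (vnorm_picard_le hg hε hs n) hwz hs
      calc _ ≤ 2⁻¹ * (2⁻¹ ^ n * (2 * ε)) + 2⁻¹ ^ (n + 1) * (2 * ε) :=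
            add_le_add (h1.trans (by gcongr; exact hlim n)) (hlim (n + 1))
        _ = 2⁻¹ * (2⁻¹ ^ n * (4 * ε)) + 0 := by rw [pow_succ]; ring
        _ ≤ _ := by
            rw [add_zero]
            exact mul_le_of_le_one_left zero_le (ENNReal.inv_le_one.2 (by norm_num))
    have hl : Tendsto (fun n : ℕ => (2⁻¹ : ℝ≥0∞) ^ n * (4 * ε)) atTop (𝓝 (0 * (4 * ε))) :=
      ENNReal.Tendsto.mul_const
        (ENNReal.tendsto_pow_atTop_nhds_zero_of_lt_one (ENNReal.inv_lt_one.2 (by norm_num)))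
        (Or.inr (ENNReal.mul_ne_top (by simp) (ne_top_of_small hs)))
    rw [zero_mul] at hl
    exact le_antisymm (ge_of_tendsto' hl hb) zero_le
  have hae := ae_eq_of_vnorm_sub_eq_zero hv hw hzero
  refine ⟨v, hv, (vnorm_congr hae).trans_le hwz, fun t ξ => ?_⟩
  rw [duh_congr hae]

/-- A contraction has at most one fixed point. This is needed for the reality of the solution, which
must coincide with its reflected conjugate. -/
theorem mild_unique_small {L : ℝ → E3 → Idx → ℂ} (hv : Measurable (Function.uncurry v))
    (hv' : Measurable (Function.uncurry v')) (h : vnorm v ≤ 2 * ε) (h' : vnorm v' ≤ 2 * ε)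
    (hs : 864 * ε ≤ 1) (e : ∀ t ξ, v t ξ = L t ξ - duh v t ξ)
    (e' : ∀ t ξ, v' t ξ = L t ξ - duh v' t ξ) : v = v' := by
  have h1 := vnorm_duh_sub_le_half hv' hv h' h hs
  have h2 : vnorm (fun t ξ => v t ξ - v' t ξ) =
      vnorm (fun t ξ => duh v' t ξ - duh v t ξ) := by
    congr 1
    ext1 t
    ext1 ξ
    rw [e, e', sub_sub_sub_cancel_left]
  rw [← h2, vnorm_sub_comm] at h1
  have hfin : vnorm (fun t ξ => v' t ξ - v t ξ) ≠ ∞ := by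
    have hf : 2 * ε < ∞ := ENNReal.mul_lt_top (by simp) (ne_top_of_small hs).lt_top
    exact ((vnorm_sub_le hv' hv).trans_lt (ENNReal.add_lt_top.2
      ⟨h'.trans_lt hf, h.trans_lt hf⟩)).ne
  have h0 : vnorm (fun t ξ => v' t ξ - v t ξ) = 0 := by
    by_contra hne
    have := ENNReal.half_lt_self hne hfin
    rw [ENNReal.div_eq_inv_mul] at this
    exact absurd h1 (not_le.2 this)
  have := duh_congr (ae_eq_of_vnorm_sub_eq_zero hv' hv h0)
  ext1 t
  ext1 ξ
  rw [e, e', this]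

end FixedPoint

end

section

/-! ### Weighted masses on dyadic blocks -/

/-- The mass of `F` in the `j`-th dyadic block. -/
def blk (ψ : 𝓢(E3, ℝ)) (j : ℤ) (F : E3 → ℝ≥0∞) : ℝ≥0∞ := ∫⁻ ξ, ‖dyadicSymbol ψ j ξ‖ₑ * F ξ

section Blocks

variable {ψ : 𝓢(E3, ℝ)} {j : ℤ} {F G : E3 → ℝ≥0∞}

theorem two_rpow_int (j : ℤ) : (2 : ℝ≥0∞) ^ (j : ℝ) = ENNReal.ofReal ((2 : ℝ) ^ j) := by
  rw [← Real.rpow_intCast, ← ENNReal.ofReal_rpow_of_pos two_pos, ENNReal.ofReal_ofNat]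

theorem two_rpow_mul (x y : ℝ) : (2 : ℝ≥0∞) ^ x * 2 ^ y = 2 ^ (x + y) :=
  (ENNReal.rpow_add _ _ (by simp) (by simp)).symm

theorem two_rpow_ne_top (x : ℝ) : (2 : ℝ≥0∞) ^ x ≠ ∞ :=
  ENNReal.rpow_ne_top_of_ne_zero (by simp) (by simp)

theorem two_rpow_ne_zero (x : ℝ) : (2 : ℝ≥0∞) ^ x ≠ 0 :=
  (ENNReal.rpow_pos (by simp) (by simp)).ne'

theorem two_rpow_neg_mul (x : ℝ) (a : ℝ≥0∞) : (2 : ℝ≥0∞) ^ x * (2 ^ (-x) * a) = a := by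
  rw [← mul_assoc, two_rpow_mul, add_neg_cancel, ENNReal.rpow_zero, one_mul]

theorem measurable_enorm_dyadicSymbol (ψ : 𝓢(E3, ℝ)) (j : ℤ) :
    Measurable fun ξ => ‖dyadicSymbol ψ j ξ‖ₑ := (continuous_dyadicSymbol ψ j).measurable.enorm

theorem IsDyadicPartition.tsum_enorm_dyadicSymbol (hψ : IsDyadicPartition ψ) {ξ : E3} (h : ξ ≠ 0) :
    ∑' j, ‖dyadicSymbol ψ j ξ‖ₑ = 1 := by
  have hs := hψ.sum_eq_one ξ h
  have e : ∀ j, ‖dyadicSymbol ψ j ξ‖ₑ = ENNReal.ofReal (ψ ((2 : ℝ) ^ (-j) • ξ)) := by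
    intro j
    rw [dyadicSymbol, ← ofReal_norm, Complex.norm_real, Real.norm_of_nonneg (hψ.nonneg _)]
  simp_rw [e]
  rw [← ENNReal.ofReal_tsum_of_nonneg (fun j => hψ.nonneg _) hs.summable, hs.tsum_eq,
    ENNReal.ofReal_one]

theorem ae_ne_zero : ∀ᵐ ξ : E3, ξ ≠ 0 := by
  rw [ae_iff]
  simp

theorem IsDyadicPartition.lintegral_eq_tsum_blk (hψ : IsDyadicPartition ψ) (hF : Measurable F) :
    ∫⁻ ξ, F ξ = ∑' j, blk ψ j F := by
  unfold blk
  have hm : ∀ j, AEMeasurable (fun ξ => ‖dyadicSymbol ψ j ξ‖ₑ * F ξ) :=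
    fun j => ((measurable_enorm_dyadicSymbol ψ j).mul hF).aemeasurable
  rw [← lintegral_tsum hm]
  refine lintegral_congr_ae ?_
  filter_upwards [ae_ne_zero] with ξ hξ
  rw [ENNReal.tsum_mul_right, hψ.tsum_enorm_dyadicSymbol hξ, one_mul]

theorem blk_mono_ae (h : ∀ᵐ ξ, dyadicSymbol ψ j ξ ≠ 0 → F ξ ≤ G ξ) : blk ψ j F ≤ blk ψ j G := by
  refine lintegral_mono_ae ?_
  filter_upwards [h] with ξ hξ
  by_cases h0 : dyadicSymbol ψ j ξ = 0
  · simp [h0]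
  · exact mul_le_mul_right (hξ h0) _

theorem blk_mono (h : ∀ ξ, F ξ ≤ G ξ) : blk ψ j F ≤ blk ψ j G :=
  blk_mono_ae (Eventually.of_forall fun ξ _ => h ξ)

theorem blk_const_mul {c : ℝ≥0∞} (hc : c ≠ ∞) : blk ψ j (fun ξ => c * F ξ) = c * blk ψ j F := by
  unfold blk
  rw [← lintegral_const_mul' _ _ hc]
  simp only [mul_left_comm]

theorem blk_add (hF : Measurable F) :
    blk ψ j (fun ξ => F ξ + G ξ) = blk ψ j F + blk ψ j G := by
  have hm : Measurable (fun ξ => ‖dyadicSymbol ψ j ξ‖ₑ * F ξ) :=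
    (measurable_enorm_dyadicSymbol ψ j).mul hF
  unfold blk
  rw [← lintegral_add_left hm]
  simp only [mul_add]

theorem measurable_blk {A : ℝ → E3 → ℝ≥0∞} (hA : Measurable (Function.uncurry A)) (j : ℤ) :
    Measurable fun t => blk ψ j (A t) :=
  measurable_lintegral_freq' (A := fun t ξ => ‖dyadicSymbol ψ j ξ‖ₑ * A t ξ)
    (((measurable_enorm_dyadicSymbol ψ j).comp measurable_snd).mul hA)

theorem IsDyadicPartition.blk_le_lintegral (hψ : IsDyadicPartition ψ) :
    blk ψ j F ≤ ∫⁻ ξ, F ξ :=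
  lintegral_mono fun ξ => mul_le_of_le_one_left zero_le (hψ.enorm_dyadicSymbol_le_one j ξ)

theorem IsDyadicPartition.ofReal_norm_le (hψ : IsDyadicPartition ψ) {ξ : E3}
    (h : dyadicSymbol ψ j ξ ≠ 0) : ENNReal.ofReal ‖ξ‖ ≤ 3 * 2 ^ (j : ℝ) := by
  rw [two_rpow_int, show (3 : ℝ≥0∞) = ENNReal.ofReal 3 by simp,
    ← ENNReal.ofReal_mul (by norm_num)]
  refine ENNReal.ofReal_le_ofReal ((hψ.norm_of_dyadicSymbol_ne_zero h).2.trans ?_)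
  gcongr
  norm_num

theorem IsDyadicPartition.ofReal_inv_norm_le (hψ : IsDyadicPartition ψ) {ξ : E3}
    (h : dyadicSymbol ψ j ξ ≠ 0) : ENNReal.ofReal ‖ξ‖⁻¹ ≤ ENNReal.ofReal (4 / 3) * 2 ^ (-(j : ℝ)) := by
  have h3 : (0 : ℝ) < (2 : ℝ) ^ j := by positivity
  have e : (2 : ℝ≥0∞) ^ (-(j : ℝ)) = ENNReal.ofReal ((2 : ℝ) ^ (-j)) := by
    rw [← two_rpow_int]; push_cast; rfl
  rw [e, ← ENNReal.ofReal_mul (by norm_num)]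
  refine ENNReal.ofReal_le_ofReal ?_
  have := (hψ.norm_of_dyadicSymbol_ne_zero h).1
  rw [zpow_neg]
  calc ‖ξ‖⁻¹ ≤ (3 / 4 * (2 : ℝ) ^ j)⁻¹ := inv_anti₀ (by positivity) this
    _ = _ := by rw [mul_inv]; norm_num

theorem IsDyadicPartition.ne_zero (hψ : IsDyadicPartition ψ) {ξ : E3}
    (h : dyadicSymbol ψ j ξ ≠ 0) : 0 < ‖ξ‖ :=
  lt_of_lt_of_le (by positivity) (hψ.norm_of_dyadicSymbol_ne_zero h).1

end Blocks

/-! ### Square summable sequences and Schur's test -/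

section Schur

variable {a b : ℤ → ℝ≥0∞}

theorem tsum_add_mul_self_le (a b : ℤ → ℝ≥0∞) :
    ∑' j, (a j + b j) * (a j + b j) ≤ 2 * (∑' j, a j * a j) + 2 * ∑' j, b j * b j := by
  rw [← ENNReal.tsum_mul_left, ← ENNReal.tsum_mul_left, ← ENNReal.tsum_add]
  refine ENNReal.tsum_le_tsum fun j => ?_
  calc (a j + b j) * (a j + b j) = a j * a j + b j * b j + 2 * (a j * b j) := by ring
    _ ≤ a j * a j + b j * b j + (a j * a j + b j * b j) := by gcongr; exact two_mul_mul_le _ _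
    _ = _ := by ring

theorem tsum_mul_self_le_sq (b : ℤ → ℝ≥0∞) : ∑' j, b j * b j ≤ (∑' j, b j) * ∑' j, b j := by
  rw [← ENNReal.tsum_mul_right]
  exact ENNReal.tsum_le_tsum fun j => mul_le_mul_right (ENNReal.le_tsum j) _

theorem tsum_const_mul_mul_self (c : ℝ≥0∞) (b : ℤ → ℝ≥0∞) :
    ∑' j, (c * b j) * (c * b j) = c * c * ∑' j, b j * b j := by
  rw [← ENNReal.tsum_mul_left]
  exact tsum_congr fun j => by ring

/-- Schur's test for convolution operators on `ℓ²(ℤ)`. -/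
theorem tsum_tsum_mul_le (κ b : ℤ → ℝ≥0∞) :
    ∑' j, ∑' k, κ (j - k) * (b j * b k) ≤ (∑' n, κ n) * ∑' j, b j * b j := by
  have h1 : ∑' j, ∑' k, κ (j - k) * (b j * b j) = (∑' n, κ n) * ∑' j, b j * b j := by
    rw [← ENNReal.tsum_mul_left]
    refine tsum_congr fun j => ?_
    rw [ENNReal.tsum_mul_right]
    congr 1
    exact (Equiv.subLeft j).tsum_eq κ
  have h2 : ∑' j, ∑' k, κ (j - k) * (b k * b k) = (∑' n, κ n) * ∑' j, b j * b j := by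
    rw [ENNReal.tsum_comm, ← ENNReal.tsum_mul_left]
    refine tsum_congr fun k => ?_
    rw [ENNReal.tsum_mul_right]
    congr 1
    exact (Equiv.subRight k).tsum_eq κ
  have h3 : 2 * ∑' j, ∑' k, κ (j - k) * (b j * b k) ≤ 2 * ((∑' n, κ n) * ∑' j, b j * b j) := by
    calc 2 * ∑' j, ∑' k, κ (j - k) * (b j * b k)
        = ∑' j, ∑' k, κ (j - k) * (2 * (b j * b k)) := by
          simp_rw [← ENNReal.tsum_mul_left]
          simp only [mul_left_comm]
      _ ≤ ∑' j, ∑' k, (κ (j - k) * (b j * b j) + κ (j - k) * (b k * b k)) := by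
          refine ENNReal.tsum_le_tsum fun j => ENNReal.tsum_le_tsum fun k => ?_
          rw [← mul_add]
          exact mul_le_mul_right (two_mul_mul_le _ _) _
      _ = _ := by
          simp_rw [ENNReal.tsum_add]
          rw [h1, h2, two_mul]
  exact (ENNReal.mul_le_mul_iff_right (by simp) (by simp)).1 h3

/-- A two-sided geometric sequence. -/
def geomSeq (q : ℝ) (n : ℤ) : ℝ≥0∞ := ENNReal.ofReal (q ^ n.natAbs)

theorem tsum_geomSeq_lt_top {q : ℝ} (h0 : 0 ≤ q) (h1 : q < 1) : ∑' n, geomSeq q n < ∞ := by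
  have hs : Summable fun n : ℤ => q ^ n.natAbs := by
    refine Summable.of_nat_of_neg ?_ ?_
    · simpa using summable_geometric_of_lt_one h0 h1
    · simpa using summable_geometric_of_lt_one h0 h1
  exact hs.tsum_ofReal_lt_top

theorem geomSeq_neg (q : ℝ) (n : ℤ) : geomSeq q (-n) = geomSeq q n := by
  rw [geomSeq, Int.natAbs_neg, geomSeq]

theorem two_rpow_eq_geomSeq {α : ℝ} {n : ℤ} (hn : n ≤ 0) :
    (2 : ℝ≥0∞) ^ (α * n) = geomSeq ((2 : ℝ) ^ (-α)) n := by
  rw [geomSeq, ← Real.rpow_natCast, ← Real.rpow_mul two_pos.le,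
    ← ENNReal.ofReal_rpow_of_pos two_pos, ENNReal.ofReal_ofNat]
  congr 1
  have : ((n.natAbs : ℕ) : ℝ) = -(n : ℝ) := by
    have : ((n.natAbs : ℕ) : ℤ) = -n := Int.ofNat_natAbs_of_nonpos hn
    rw [← Int.cast_natCast, this, Int.cast_neg]
  rw [this]
  ring

end Schur

/-! ### Functions with the block bounds of the heat flow -/

/-- Bounds of the blocks of a function of `(t, ξ)` which are those of a solution of the heat
equation with data in `FḂ^{-1}_{1,2}`. -/
structure IsParabolic (h : ℤ → ℝ → ℝ≥0∞) (b : ℤ → ℝ≥0∞) : Prop where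
  le : ∀ j t, 0 ≤ t → h j t ≤ 2 ^ (j : ℝ) * b j
  lintegral_le : ∀ j, ∫⁻ t, h j t ∂timeMeasure ≤ 2 ^ (-(j : ℝ)) * b j

section Parabolic

variable {h h' : ℤ → ℝ → ℝ≥0∞} {b b' : ℤ → ℝ≥0∞}

theorem ae_timeMeasure_pos : ∀ᵐ t ∂timeMeasure, 0 < t :=
  ae_restrict_mem measurableSet_Ioi

theorem IsParabolic.mono (hb : IsParabolic h b) (hh : ∀ j t, 0 ≤ t → h' j t ≤ h j t) :
    IsParabolic h' b where
  le j t ht := (hh j t ht).trans (hb.le j t ht)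
  lintegral_le j := by
    refine (lintegral_mono_ae ?_).trans (hb.lintegral_le j)
    filter_upwards [ae_timeMeasure_pos] with t ht using hh j t ht.le

theorem IsParabolic.add (hb : IsParabolic h b) (hb' : IsParabolic h' b')
    (hm : ∀ j, Measurable (h j)) :
    IsParabolic (fun j t => h j t + h' j t) (fun j => b j + b' j) where
  le j t ht := by
    rw [mul_add]
    exact add_le_add (hb.le j t ht) (hb'.le j t ht)
  lintegral_le j := by
    rw [mul_add, lintegral_add_left (hm j)]
    exact add_le_add (hb.lintegral_le j) (hb'.lintegral_le j)

theorem IsParabolic.const_mul (hb : IsParabolic h b) {c : ℝ≥0∞} (hc : c ≠ ∞) :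
    IsParabolic (fun j t => c * h j t) (fun j => c * b j) where
  le j t ht := by
    rw [mul_left_comm]
    exact mul_le_mul_right (hb.le j t ht) _
  lintegral_le j := by
    rw [mul_left_comm, lintegral_const_mul' _ _ hc]
    exact mul_le_mul_right (hb.lintegral_le j) _

/-- The block of lower frequency is bounded pointwise in time by `2^j b_j`, the other one in time
average by `2^{-k} b_k`. The mismatch of the weights is the off-diagonal decay `2^{-|j-k|}`. -/
theorem IsParabolic.lintegral_mul_le (hb : IsParabolic h b) (j k : ℤ) :
    ∫⁻ t, h j t * h k t ∂timeMeasure ≤ geomSeq 2⁻¹ (j - k) * (b j * b k) := by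
  have key : ∀ j k : ℤ, j ≤ k →
      ∫⁻ t, h j t * h k t ∂timeMeasure ≤ geomSeq 2⁻¹ (j - k) * (b j * b k) := by
    intro j k hjk
    have hM : (2 : ℝ≥0∞) ^ (-(k : ℝ)) * 2 ^ (j : ℝ) = geomSeq 2⁻¹ (j - k) := by
      have := two_rpow_eq_geomSeq (α := 1) (n := j - k) (by lia)
      rw [Real.rpow_neg_one] at this
      rw [← this, two_rpow_mul]
      push_cast
      ring_nf
    calc ∫⁻ t, h j t * h k t ∂timeMeasure
        ≤ ∫⁻ t, (2 ^ (j : ℝ) * b j) * h k t ∂timeMeasure := by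
          refine lintegral_mono_ae ?_
          filter_upwards [ae_timeMeasure_pos] with t ht
          exact mul_le_mul_left (hb.le j t ht.le) _
      _ ≤ (2 ^ (j : ℝ) * b j) * (2 ^ (-(k : ℝ)) * b k) := by
          -- An infinite bound for the lower block is harmless: either the right-hand side is
          -- infinite, or `b k = 0` forces the other block to vanish almost everywhere.
          by_cases hbj : b j = ∞
          · rw [hbj, ENNReal.mul_top (two_rpow_ne_zero _)]
            by_cases hk : b k = 0
            · have h0 : ∫⁻ t, h k t ∂timeMeasure = 0 := by
                have := hb.lintegral_le k
                rw [hk, mul_zero] at this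
                exact le_antisymm this zero_le
              have h1 : ∀ᵐ t ∂timeMeasure, h k t = 0 := by
                filter_upwards [ae_timeMeasure_pos] with t ht
                have := hb.le k t ht.le
                rw [hk, mul_zero] at this
                exact le_antisymm this zero_le
              have h2 : ∫⁻ t, ∞ * h k t ∂timeMeasure = 0 := by
                rw [lintegral_congr_ae (g := fun _ => 0), lintegral_zero]
                filter_upwards [h1] with t ht
                rw [ht, mul_zero]
              rw [h2]
              exact zero_le
            · rw [ENNReal.top_mul (mul_ne_zero (two_rpow_ne_zero _) hk)]
              exact le_top
          · rw [lintegral_const_mul' _ _ (ENNReal.mul_ne_top (two_rpow_ne_top _) hbj)]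
            exact mul_le_mul_right (hb.lintegral_le k) _
      _ = _ := by rw [← hM]; ring
  rcases le_total j k with hjk | hjk
  · exact key j k hjk
  · rw [show j - k = -(k - j) by ring, geomSeq_neg, mul_comm (b j)]
    simp_rw [mul_comm (h j _)]
    exact key k j hjk

theorem lintegral_tsum_mul_tsum_le {h : ℤ → ℝ → ℝ≥0∞} (hm : ∀ j, Measurable (h j)) {κ : ℤ → ℝ≥0∞}
    (hb : ∀ j k, ∫⁻ t, h j t * h k t ∂timeMeasure ≤ κ (j - k) * (b j * b k)) :
    ∫⁻ t, (∑' j, h j t) * (∑' j, h j t) ∂timeMeasure ≤ (∑' n, κ n) * ∑' j, b j * b j := by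
  refine le_trans (le_of_eq ?_) ((ENNReal.tsum_le_tsum fun j => ENNReal.tsum_le_tsum fun k =>
    hb j k).trans (tsum_tsum_mul_le κ b))
  simp_rw [← ENNReal.tsum_mul_right, ← ENNReal.tsum_mul_left]
  have hjk : ∀ j k, Measurable fun t => h j t * h k t := fun j k => (hm j).mul (hm k)
  rw [lintegral_tsum fun j => (Measurable.tsum (hjk j)).aemeasurable]
  refine tsum_congr fun j => ?_
  rw [lintegral_tsum fun k => (hjk j k).aemeasurable]

/-- The partition of unity makes the `L¹` norm the sum of the block masses. Expanding the square of
this sum reduces the bound to Schur's test on `ℓ²(ℤ)`. -/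
theorem znorm_sq_le_of_blk {ψ : 𝓢(E3, ℝ)} (hψ : IsDyadicPartition ψ) {A : ℝ → E3 → ℝ≥0∞}
    (hA : Measurable (Function.uncurry A)) {κ : ℤ → ℝ≥0∞}
    (hb : ∀ j k, ∫⁻ t, blk ψ j (A t) * blk ψ k (A t) ∂timeMeasure ≤ κ (j - k) * (b j * b k)) :
    znorm A ^ 2 ≤ (∑' n, κ n) * ∑' j, b j * b j := by
  refine le_trans (le_of_eq ?_) (lintegral_tsum_mul_tsum_le (measurable_blk hA) hb)
  rw [znorm, timeL2, ← ENNReal.rpow_natCast, ← ENNReal.rpow_mul]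
  norm_num
  refine lintegral_congr fun t => ?_
  rw [hψ.lintegral_eq_tsum_blk (hA.of_uncurry_left), sq]

/-- Interpolation of `L^p` in time between `L^∞` and `L¹`. For `p = 2/(1+α)` and `p = 2/(1-α)` the
weight `2/p - 1` becomes `α` and `-α`, the two regularities in `X^α`. -/
theorem IsParabolic.eLpNorm_le (hb : IsParabolic h b) (j : ℤ) {p : ℝ} (hp : 1 < p) :
    2 ^ ((j : ℝ) * (2 / p - 1)) * eLpNorm (h j) (ENNReal.ofReal p) timeMeasure ≤ b j := by
  have hp0 : 0 < p := by linarith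
  rw [eLpNorm_eq_lintegral_rpow_enorm_toReal (by simpa using hp0) (by simp),
    ENNReal.toReal_ofReal hp0.le]
  simp only [enorm_eq_self]
  by_cases hbj : b j = ∞
  · rw [hbj]; exact le_top
  have h1 : ∫⁻ t, h j t ^ p ∂timeMeasure ≤ 2 ^ ((j : ℝ) * (p - 2)) * b j ^ p := by
    calc ∫⁻ t, h j t ^ p ∂timeMeasure
        ≤ ∫⁻ t, (2 ^ (j : ℝ) * b j) ^ (p - 1) * h j t ∂timeMeasure := by
          refine lintegral_mono_ae ?_
          filter_upwards [ae_timeMeasure_pos] with t ht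
          calc h j t ^ p = h j t ^ (p - 1) * h j t ^ (1 : ℝ) := by
                rw [← ENNReal.rpow_add_of_nonneg _ _ (by linarith) zero_le_one]; ring_nf
            _ ≤ _ := by
                rw [ENNReal.rpow_one]
                exact mul_le_mul_left (ENNReal.rpow_le_rpow (hb.le j t ht.le) (by linarith)) _
      _ = (2 ^ (j : ℝ) * b j) ^ (p - 1) * ∫⁻ t, h j t ∂timeMeasure :=
          lintegral_const_mul' _ _ (ENNReal.rpow_ne_top_of_nonneg (by linarith)
            (ENNReal.mul_ne_top (two_rpow_ne_top _) hbj))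
      _ ≤ (2 ^ (j : ℝ) * b j) ^ (p - 1) * (2 ^ (-(j : ℝ)) * b j) :=
          mul_le_mul_right (hb.lintegral_le j) _
      _ = (2 ^ ((j : ℝ) * (p - 1)) * 2 ^ (-(j : ℝ))) * (b j ^ (p - 1) * b j ^ (1 : ℝ)) := by
          rw [ENNReal.mul_rpow_of_nonneg _ _ (by linarith), ← ENNReal.rpow_mul, ENNReal.rpow_one]
          ring
      _ = _ := by
          rw [two_rpow_mul, ← ENNReal.rpow_add_of_nonneg _ _ (by linarith) zero_le_one]
          ring_nf
  calc _ ≤ 2 ^ ((j : ℝ) * (2 / p - 1)) * (2 ^ ((j : ℝ) * (p - 2)) * b j ^ p) ^ (1 / p) :=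
        mul_le_mul_right (ENNReal.rpow_le_rpow h1 (by positivity)) _
    _ = (2 ^ ((j : ℝ) * (2 / p - 1)) * 2 ^ ((j : ℝ) * (p - 2) * (1 / p))) * b j := by
        rw [ENNReal.mul_rpow_of_nonneg _ _ (by positivity), ← ENNReal.rpow_mul,
          ← ENNReal.rpow_mul, mul_one_div_cancel hp0.ne', ENNReal.rpow_one, ← mul_assoc]
    _ = _ := by
        rw [two_rpow_mul]
        have : (j : ℝ) * (2 / p - 1) + (j : ℝ) * (p - 2) * (1 / p) = 0 := by field_simp; ring
        rw [this, ENNReal.rpow_zero, one_mul]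

theorem seqNorm_two_lt_top (h : ∑' j, b j * b j < ∞) : seqNorm 2 b < ∞ := by
  rw [seqNorm, if_neg (by simp)]
  refine ENNReal.rpow_lt_top_of_nonneg (by positivity) ?_
  convert h.ne using 4 with j
  rw [← sq, ← ENNReal.rpow_natCast]
  norm_num

theorem seqNorm_two_mono {a b : ℤ → ℝ≥0∞} (h : ∀ j, a j ≤ b j) : seqNorm 2 a ≤ seqNorm 2 b := by
  rw [seqNorm, if_neg (by simp), seqNorm, if_neg (by simp)]
  gcongr
  exact h _

end Parabolic

end

section

/-! ### Block bounds for the heat flow and for the Duhamel term -/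

/-- The majorant `e^{-t|ξ|²/4} G(ξ)` of the linear evolution. -/
def heatMaj (G : E3 → ℝ≥0∞) (t : ℝ) (ξ : E3) : ℝ≥0∞ :=
  ENNReal.ofReal (Real.exp (-(‖ξ‖ ^ 2 / 4) * t)) * G ξ

section Bounds

variable {ψ : 𝓢(E3, ℝ)} {G : E3 → ℝ≥0∞} {A B : ℝ → E3 → ℝ≥0∞}

theorem measurable_heatMaj (hG : Measurable G) : Measurable (Function.uncurry (heatMaj G)) := by
  have h1 : Measurable fun z : ℝ × E3 => ENNReal.ofReal (Real.exp (-(‖z.2‖ ^ 2 / 4) * z.1)) := by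
    fun_prop
  exact h1.mul (hG.comp measurable_snd)

theorem blk_lintegral (hA : Measurable (Function.uncurry A)) (j : ℤ) :
    blk ψ j (fun ξ => ∫⁻ τ, A τ ξ ∂timeMeasure) = ∫⁻ τ, blk ψ j (A τ) ∂timeMeasure := by
  have hm : Measurable fun z : ℝ × E3 => ‖dyadicSymbol ψ j z.2‖ₑ * A z.1 z.2 :=
    ((measurable_enorm_dyadicSymbol ψ j).comp measurable_snd).mul hA
  unfold blk
  rw [lintegral_lintegral_swap hm.aemeasurable]
  refine lintegral_congr fun ξ => ?_
  rw [lintegral_const_mul' _ _ (by simp)]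

theorem lintegral_heatFactor {ξ : E3} (h : 0 < ‖ξ‖) :
    ∫⁻ t, ENNReal.ofReal (Real.exp (-(‖ξ‖ ^ 2 / 4) * t)) ∂timeMeasure =
      4 * (ENNReal.ofReal ‖ξ‖⁻¹ * ENNReal.ofReal ‖ξ‖⁻¹) := by
  have := lintegral_Ioi_exp (c := ‖ξ‖ ^ 2 / 4) (by positivity) 0
  simp only [sub_zero] at this
  rw [this, ← ENNReal.ofReal_mul (by positivity), show (4 : ℝ≥0∞) = ENNReal.ofReal 4 by simp,
    ← ENNReal.ofReal_mul (by norm_num)]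
  congr 1
  field_simp

theorem isParabolic_heatMaj (hψ : IsDyadicPartition ψ) (hG : Measurable G) :
    IsParabolic (fun j t => blk ψ j (heatMaj G t))
      (fun j => 8 * (2 ^ (-(j : ℝ)) * blk ψ j G)) where
  le j t ht := by
    rw [mul_left_comm, two_rpow_neg_mul]
    calc blk ψ j (heatMaj G t) ≤ 1 * blk ψ j G := by
          rw [one_mul]
          refine blk_mono fun ξ => mul_le_of_le_one_left zero_le ?_
          rw [ENNReal.ofReal_le_one, Real.exp_le_one_iff]
          have : 0 ≤ ‖ξ‖ ^ 2 / 4 * t := by positivity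
          linarith
      _ ≤ _ := mul_le_mul_left (by norm_num) _
  lintegral_le j := by
    rw [← blk_lintegral (measurable_heatMaj hG)]
    calc blk ψ j (fun ξ => ∫⁻ t, heatMaj G t ξ ∂timeMeasure)
        ≤ blk ψ j (fun ξ => (8 * (2 ^ (-(j : ℝ)) * 2 ^ (-(j : ℝ)))) * G ξ) := by
          refine blk_mono_ae (Eventually.of_forall fun ξ hξ => ?_)
          have hm : Measurable fun t : ℝ => ENNReal.ofReal (Real.exp (-(‖ξ‖ ^ 2 / 4) * t)) := by
            fun_prop
          have h1 := hψ.ofReal_inv_norm_le hξ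
          unfold heatMaj
          rw [lintegral_mul_const _ hm, lintegral_heatFactor (hψ.ne_zero hξ)]
          refine mul_le_mul_left ?_ _
          calc 4 * (ENNReal.ofReal ‖ξ‖⁻¹ * ENNReal.ofReal ‖ξ‖⁻¹)
              ≤ 4 * ((ENNReal.ofReal (4 / 3) * 2 ^ (-(j : ℝ))) *
                  (ENNReal.ofReal (4 / 3) * 2 ^ (-(j : ℝ)))) := by gcongr
            _ = (4 * (ENNReal.ofReal (4 / 3) * ENNReal.ofReal (4 / 3))) *
                  (2 ^ (-(j : ℝ)) * 2 ^ (-(j : ℝ))) := by ring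
            -- The constant eight dominates `4 · (4/3)²`, where `4/3` comes from the lower edge
            -- `3/4` of the support of `ψ`.
            _ ≤ _ := by
                refine mul_le_mul_left ?_ _
                rw [show (4 : ℝ≥0∞) = ENNReal.ofReal 4 by simp,
                  show (8 : ℝ≥0∞) = ENNReal.ofReal 8 by simp,
                  ← ENNReal.ofReal_mul (by norm_num), ← ENNReal.ofReal_mul (by norm_num)]
                exact ENNReal.ofReal_le_ofReal (by norm_num)
      _ = _ := by
          rw [blk_const_mul (ENNReal.mul_ne_top (by simp) (ENNReal.mul_ne_top
            (two_rpow_ne_top _) (two_rpow_ne_top _)))]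
          ring

theorem lintegral_heatKernel_le (τ : ℝ) {ξ : E3} (h0 : 0 < ‖ξ‖) :
    ∫⁻ t, heatKernel t τ ξ ∂timeMeasure ≤ 2 * ENNReal.ofReal ‖ξ‖⁻¹ := by
  refine (lintegral_mono' Measure.restrict_le_self le_rfl).trans ?_
  have h1 : ∀ t, heatKernel t τ ξ = (Set.Ici τ).indicator
      (fun t => ENNReal.ofReal (‖ξ‖ * Real.exp (-(‖ξ‖ ^ 2 / 2) * (t - τ)))) t := by
    intro t
    unfold heatKernel Set.indicator
    simp only [Set.mem_Ici]
    split_ifs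
    · congr 3
      ring
    · rfl
  simp_rw [h1]
  rw [lintegral_indicator measurableSet_Ici, ← restrict_Ioi_eq_restrict_Ici]
  simp_rw [ENNReal.ofReal_mul h0.le]
  rw [lintegral_const_mul' _ _ ENNReal.ofReal_ne_top, lintegral_Ioi_exp (by positivity),
    ← ENNReal.ofReal_mul h0.le]
  have h2 : ∀ x : ℝ, 2 * ENNReal.ofReal x = ENNReal.ofReal (2 * x) := fun x => by
    rw [ENNReal.ofReal_mul two_pos.le, ENNReal.ofReal_ofNat]
  rw [h2]
  refine ENNReal.ofReal_le_ofReal (le_of_eq ?_)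
  field_simp

/-- The kernel is at most `|ξ|` pointwise and at most `2/|ξ|` after integration in `t`. With `|ξ|`
comparable to `2^j` these are the two parabolic bounds, and `3` covers both `8/3` and `2 · 4/3`. -/
theorem isParabolic_duhMaj (hψ : IsDyadicPartition ψ) (hA : Measurable (Function.uncurry A))
    (hB : Measurable (Function.uncurry B)) :
    IsParabolic (fun j t => blk ψ j (duhMaj A B t))
      (fun j => 3 * ∫⁻ τ, blk ψ j (conv (A τ) (B τ)) ∂timeMeasure) where
  le j t _ := by
    have hc := measurable_conv hA hB
    calc blk ψ j (duhMaj A B t)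
        ≤ blk ψ j (fun ξ => (3 * 2 ^ (j : ℝ)) * ∫⁻ τ, conv (A τ) (B τ) ξ ∂timeMeasure) := by
          refine blk_mono_ae (Eventually.of_forall fun ξ hξ => ?_)
          rw [← lintegral_const_mul' _ _ (ENNReal.mul_ne_top (by simp) (two_rpow_ne_top _))]
          exact lintegral_mono fun τ => mul_le_mul_left
            ((heatKernel_le t τ ξ).trans (hψ.ofReal_norm_le hξ)) _
      _ = _ := by
          rw [blk_const_mul (ENNReal.mul_ne_top (by simp) (two_rpow_ne_top _)), blk_lintegral hc]
          ring
  lintegral_le j := by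
    have hc := measurable_conv hA hB
    rw [← blk_lintegral (measurable_duhMaj hA hB), ← blk_lintegral hc]
    calc blk ψ j (fun ξ => ∫⁻ t, duhMaj A B t ξ ∂timeMeasure)
        ≤ blk ψ j (fun ξ => (3 * 2 ^ (-(j : ℝ))) * ∫⁻ τ, conv (A τ) (B τ) ξ ∂timeMeasure) := by
          refine blk_mono_ae (Eventually.of_forall fun ξ hξ => ?_)
          have hm : Measurable fun z : ℝ × ℝ => heatKernel z.1 z.2 ξ * conv (A z.2) (B z.2) ξ :=
            (measurable_heatKernel.comp
              ((measurable_fst.prodMk measurable_const).prodMk measurable_snd)).mul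
              (hc.comp (measurable_snd.prodMk measurable_const))
          have hk : ∀ τ, Measurable fun t => heatKernel t τ ξ := fun τ =>
            measurable_heatKernel.comp
              ((measurable_id.prodMk measurable_const).prodMk measurable_const)
          unfold duhMaj
          rw [lintegral_lintegral_swap hm.aemeasurable,
            ← lintegral_const_mul' _ _ (ENNReal.mul_ne_top (by simp) (two_rpow_ne_top _))]
          refine lintegral_mono fun τ => ?_
          rw [lintegral_mul_const _ (hk τ)]
          refine mul_le_mul_left ((lintegral_heatKernel_le τ (hψ.ne_zero hξ)).trans ?_) _
          refine (mul_le_mul_right (hψ.ofReal_inv_norm_le hξ) _).trans ?_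
          rw [← mul_assoc]
          refine mul_le_mul_left ?_ _
          rw [show (2 : ℝ≥0∞) = ENNReal.ofReal 2 by simp,
            show (3 : ℝ≥0∞) = ENNReal.ofReal 3 by simp, ← ENNReal.ofReal_mul (by norm_num)]
          exact ENNReal.ofReal_le_ofReal (by norm_num)
      _ = _ := by
          rw [blk_const_mul (ENNReal.mul_ne_top (by simp) (two_rpow_ne_top _))]
          ring

/-- The blocks of the forcing add up to its total mass, which is at most the square of the norm of
`A`. Duhamel terms are therefore `ℓ¹`-summable over the blocks, better than the `ℓ²` required. -/
theorem tsum_lintegral_blk_conv_lt_top (hψ : IsDyadicPartition ψ)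
    (hA : Measurable (Function.uncurry A)) (h : znorm A < ∞) :
    ∑' j, ∫⁻ τ, blk ψ j (conv (A τ) (A τ)) ∂timeMeasure < ∞ := by
  have hc := measurable_conv hA hA
  rw [← lintegral_tsum fun j => (measurable_blk hc j).aemeasurable]
  have e : ∀ τ, ∑' j, blk ψ j (conv (A τ) (A τ)) = ∫⁻ ξ, conv (A τ) (A τ) ξ := fun τ =>
    (hψ.lintegral_eq_tsum_blk hc.of_uncurry_left).symm
  simp_rw [e]
  exact (lintegral_lintegral_conv_le hA hA).trans_lt (ENNReal.mul_lt_top h h)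

theorem enorm_linEvol_le {g : E3 → Idx → ℂ} {t : ℝ} (ht : 0 ≤ t) (ξ : E3) :
    ‖linEvol g t ξ‖ₑ ≤ 3 * heatMaj (fun ξ => ‖g ξ‖ₑ) t ξ := by
  refine (enorm_semigroupSymbol_mulVec_le ht ξ (g ξ)).trans ?_
  rw [heatMaj, mul_assoc]
  have hle : Real.exp (-t * ‖ξ‖ ^ 2 / 2) ≤ Real.exp (-(‖ξ‖ ^ 2 / 4) * t) := by
    rw [Real.exp_le_exp]
    have : 0 ≤ t * ‖ξ‖ ^ 2 := by positivity
    linarith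
  gcongr

/-- Densities with finite `FḂ^{-1}_{1,2}` norm are tempered. -/
theorem isTemperedDensity_of_blk (hψ : IsDyadicPartition ψ) {F : E3 → ℂ} (hF : Measurable F)
    (h : ∑' j : ℤ, (2 ^ (-(j : ℝ)) * blk ψ j fun ξ => ‖F ξ‖ₑ) *
      (2 ^ (-(j : ℝ)) * blk ψ j fun ξ => ‖F ξ‖ₑ) < ∞) : IsTemperedDensity F := by
  have hm : Measurable fun ξ => (japanese ξ)⁻¹ * F ξ := continuous_japanese.measurable.inv.mul hF
  refine ⟨hm.aestronglyMeasurable, ?_⟩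
  have hj : ∀ ξ, ‖(japanese ξ)⁻¹‖ₑ = ENNReal.ofReal (1 + ‖ξ‖ ^ 2)⁻¹ := by
    intro ξ
    rw [← ofReal_norm, norm_inv, japanese, Complex.norm_real, Real.norm_of_nonneg (by positivity)]
  -- The weight `(1+|ξ|²)⁻¹` is bounded by `1` for `j ≤ 0` and by `|ξ|⁻²` for `j ≥ 0`. Relative to
  -- `2^{-j}` this leaves the factor `2^{-|j|}` in both cases, which pairs with the `ℓ²` sequence.
  have hb : ∀ j : ℤ, blk ψ j (fun ξ => ‖(japanese ξ)⁻¹ * F ξ‖ₑ) ≤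
      2 * geomSeq 2⁻¹ j * (2 ^ (-(j : ℝ)) * blk ψ j fun ξ => ‖F ξ‖ₑ) := by
    intro j
    rcases le_total j 0 with hj0 | hj0
    · have hg := two_rpow_eq_geomSeq (α := 1) hj0
      rw [Real.rpow_neg_one, one_mul] at hg
      rw [← hg, mul_assoc, two_rpow_neg_mul]
      refine le_trans (blk_mono fun ξ => ?_) (le_mul_of_one_le_left zero_le (by norm_num))
      rw [enorm_mul, hj]
      refine mul_le_of_le_one_left zero_le ?_
      rw [ENNReal.ofReal_le_one]
      exact inv_le_one_of_one_le₀ (by nlinarith [norm_nonneg ξ])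
    · have hg := two_rpow_eq_geomSeq (α := 1) (n := -j) (by lia)
      rw [Real.rpow_neg_one, one_mul, geomSeq_neg] at hg
      push_cast at hg
      rw [← hg, ← mul_assoc, mul_assoc 2, ← blk_const_mul (ENNReal.mul_ne_top (by simp)
        (ENNReal.mul_ne_top (two_rpow_ne_top _) (two_rpow_ne_top _)))]
      refine blk_mono_ae (Eventually.of_forall fun ξ hξ => ?_)
      rw [enorm_mul, hj]
      refine mul_le_mul_left ?_ _
      have h1 := hψ.ofReal_inv_norm_le hξ
      have h0 := hψ.ne_zero hξ
      calc ENNReal.ofReal (1 + ‖ξ‖ ^ 2)⁻¹ ≤ ENNReal.ofReal (‖ξ‖⁻¹ * ‖ξ‖⁻¹) := by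
            refine ENNReal.ofReal_le_ofReal ?_
            rw [← mul_inv]
            exact inv_anti₀ (by positivity) (by nlinarith)
        _ = ENNReal.ofReal ‖ξ‖⁻¹ * ENNReal.ofReal ‖ξ‖⁻¹ := ENNReal.ofReal_mul (by positivity)
        _ ≤ (ENNReal.ofReal (4 / 3) * 2 ^ (-(j : ℝ))) * (ENNReal.ofReal (4 / 3) * 2 ^ (-(j : ℝ))) :=
            mul_le_mul' h1 h1
        _ = (ENNReal.ofReal (4 / 3) * ENNReal.ofReal (4 / 3)) *
              (2 ^ (-(j : ℝ)) * 2 ^ (-(j : ℝ))) := by ring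
        _ ≤ _ := by
            refine mul_le_mul_left ?_ _
            rw [← ENNReal.ofReal_mul (by norm_num), show (2 : ℝ≥0∞) = ENNReal.ofReal 2 by simp]
            exact ENNReal.ofReal_le_ofReal (by norm_num)
  have hgeom : ∑' n, geomSeq 2⁻¹ n < ∞ := tsum_geomSeq_lt_top (by norm_num) (by norm_num)
  rw [HasFiniteIntegral, hψ.lintegral_eq_tsum_blk hm.enorm]
  refine lt_of_le_of_lt (b := ∑' j : ℤ, (geomSeq 2⁻¹ j +
      (2 ^ (-(j : ℝ)) * blk ψ j fun ξ => ‖F ξ‖ₑ) * (2 ^ (-(j : ℝ)) * blk ψ j fun ξ => ‖F ξ‖ₑ)))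
    (ENNReal.tsum_le_tsum fun j => (hb j).trans ?_) ?_
  · rw [mul_assoc]
    refine (two_mul_mul_le _ _).trans (add_le_add_left ?_ _)
    refine mul_le_of_le_one_left zero_le ?_
    rw [geomSeq, ENNReal.ofReal_le_one]
    exact pow_le_one₀ (by norm_num) (by norm_num)
  · rw [ENNReal.tsum_add]
    exact ENNReal.add_lt_top.2 ⟨hgeom, h⟩

end Bounds

/-! ### Regularity of the solutions -/

/-- `v` is a solution in `L²(0, ∞; L¹)` of the mild equation on the Fourier side, with data `g` of
finite `FḂ^{-1}_{1,2}` norm. -/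
structure IsFreqSolution (ψ : 𝓢(E3, ℝ)) (g : E3 → Idx → ℂ) (v : ℝ → E3 → Idx → ℂ) : Prop where
  measurable_data : Measurable g
  measurable : Measurable (Function.uncurry v)
  data : ∑' j : ℤ, (2 ^ (-(j : ℝ)) * blk ψ j fun ξ => ‖g ξ‖ₑ) *
    (2 ^ (-(j : ℝ)) * blk ψ j fun ξ => ‖g ξ‖ₑ) < ∞
  vnorm_lt : vnorm v < ∞
  eq : ∀ t ξ, v t ξ = linEvol g t ξ - duh v t ξ

section Regularity

variable {ψ : 𝓢(E3, ℝ)} {g : E3 → Idx → ℂ} {v : ℝ → E3 → Idx → ℂ}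

theorem IsFreqSolution.ae_conv (h : IsFreqSolution ψ g v) :
    ∀ᵐ ξ, ∫⁻ τ, conv (fun η => ‖v τ η‖ₑ) (fun η => ‖v τ η‖ₑ) ξ ∂timeMeasure < ∞ :=
  ae_lintegral_conv_lt_top (S := fun t ξ => ‖v t ξ‖ₑ) (measurable_enorm_vec h.measurable)
    h.vnorm_lt

theorem IsFreqSolution.enorm_le (h : IsFreqSolution ψ g v) :
    ∀ᵐ ξ, ∀ t, 0 ≤ t → ‖v t ξ‖ₑ ≤ 3 * heatMaj (fun ξ => ‖g ξ‖ₑ) t ξ +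
      108 * duhMaj (fun t ξ => ‖v t ξ‖ₑ) (fun t ξ => ‖v t ξ‖ₑ) t ξ := by
  filter_upwards [h.ae_conv] with ξ hξ t ht
  rw [h.eq]
  refine enorm_sub_le.trans (add_le_add (enorm_linEvol_le ht ξ) ?_)
  exact enorm_duh_le h.measurable (measurable_enorm_vec h.measurable) (fun _ _ => le_rfl) hξ t

/-- The regularity of the solution in one statement: the linear part inherits an `ℓ²` sequence from
the data, the Duhamel part has an `ℓ¹` sequence, and `ℓ¹ ⊂ ℓ²`. -/
theorem IsFreqSolution.exists_isParabolic (hψ : IsDyadicPartition ψ) (h : IsFreqSolution ψ g v) :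
    ∃ b : ℤ → ℝ≥0∞, ∑' j, b j * b j < ∞ ∧
      IsParabolic (fun j t => blk ψ j fun ξ => ‖v t ξ‖ₑ) b := by
  have hA := measurable_enorm_vec h.measurable
  have hg : Measurable fun ξ => ‖g ξ‖ₑ := h.measurable_data.enorm
  have h1 := (isParabolic_heatMaj hψ hg).const_mul (c := 3) (by simp)
  have h2 := (isParabolic_duhMaj hψ hA hA).const_mul (c := 108) (by simp)
  have h3 := h1.add h2 fun j => (measurable_blk (measurable_heatMaj hg) j).const_mul 3
  refine ⟨_, ?_, h3.mono fun j t ht => ?_⟩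
  · refine (tsum_add_mul_self_le _ _).trans_lt ?_
    simp_rw [tsum_const_mul_mul_self]
    have hF := tsum_lintegral_blk_conv_lt_top hψ hA h.vnorm_lt
    have hF2 := (tsum_mul_self_le_sq _).trans_lt (ENNReal.mul_lt_top hF hF)
    refine ENNReal.add_lt_top.2 ⟨?_, ?_⟩
    · exact ENNReal.mul_lt_top (by simp) (ENNReal.mul_lt_top
        (ENNReal.mul_lt_top (by simp) (by simp)) (ENNReal.mul_lt_top
        (ENNReal.mul_lt_top (by simp) (by simp)) h.data))
    · exact ENNReal.mul_lt_top (by simp) (ENNReal.mul_lt_top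
        (ENNReal.mul_lt_top (by simp) (by simp)) (ENNReal.mul_lt_top
        (ENNReal.mul_lt_top (by simp) (by simp)) hF2))
  · rw [← blk_const_mul (by simp), ← blk_const_mul (by simp), ← blk_add]
    · refine blk_mono_ae ?_
      filter_upwards [h.enorm_le] with ξ hξ _
      exact hξ t ht
    · exact (measurable_heatMaj hg).of_uncurry_left.const_mul 3

end Regularity

end

/-! ### Membership in the solution classes -/

section

section Regularity

variable {ψ : 𝓢(E3, ℝ)} {g : E3 → Idx → ℂ} {v : ℝ → E3 → Idx → ℂ}

theorem IsFreqSolution.measurable_apply (h : IsFreqSolution ψ g v) (t : ℝ) (a : Idx) :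
    Measurable fun ξ => v t ξ a :=
  (measurable_pi_apply a).comp h.measurable.of_uncurry_left

theorem IsParabolic.two_rpow_mul_blk_le {b : ℤ → ℝ≥0∞}
    (hb : IsParabolic (fun j t => blk ψ j fun ξ => ‖v t ξ‖ₑ) b) {t : ℝ} (ht : 0 ≤ t) (j : ℤ) :
    2 ^ (-(j : ℝ)) * blk ψ j (fun ξ => ‖v t ξ‖ₑ) ≤ b j := by
  refine (mul_le_mul_right (hb.le j t ht) _).trans ?_
  have := two_rpow_neg_mul (-(j : ℝ)) (b j)
  rw [neg_neg] at this
  exact this.le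

theorem IsFreqSolution.isTemperedDensity (hψ : IsDyadicPartition ψ) (h : IsFreqSolution ψ g v)
    {t : ℝ} (ht : 0 ≤ t) (a : Idx) : IsTemperedDensity fun ξ => v t ξ a := by
  obtain ⟨b, hb, hp⟩ := h.exists_isParabolic hψ
  refine isTemperedDensity_of_blk hψ (h.measurable_apply t a) (lt_of_le_of_lt ?_ hb)
  refine ENNReal.tsum_le_tsum fun j => ?_
  have : 2 ^ (-(j : ℝ)) * blk ψ j (fun ξ => ‖v t ξ a‖ₑ) ≤ b j :=
    (mul_le_mul_right (blk_mono fun ξ => enorm_apply_le _ _) _).trans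
      (hp.two_rpow_mul_blk_le ht j)
  exact mul_le_mul' this this

/-- The velocity and microrotation fields given by their Fourier transforms. -/
def toField (v : ℝ → E3 → Idx → ℂ) (t : ℝ) (a : Idx) : Dist := ofDensity fun ξ => v t ξ a

theorem IsFreqSolution.hasFourierDensity (hψ : IsDyadicPartition ψ) (h : IsFreqSolution ψ g v)
    {t : ℝ} (ht : 0 ≤ t) (a : Idx) : HasFourierDensity (toField v t a) fun ξ => v t ξ a :=
  (h.isTemperedDensity hψ ht a).hasFourierDensity

theorem IsFreqSolution.memFB (hψ : IsDyadicPartition ψ) (h : IsFreqSolution ψ g v)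
    {t : ℝ} (ht : 0 ≤ t) (a : Idx) : MemFB ψ (-1) 1 2 (toField v t a) := by
  obtain ⟨b, hb, hp⟩ := h.exists_isParabolic hψ
  have hd := h.hasFourierDensity hψ ht a
  refine ⟨⟨_, hd⟩, (seqNorm_two_mono fun j => ?_).trans_lt (seqNorm_two_lt_top hb)⟩
  rw [distLpNorm_one_fourierD_dyadicBlock hψ hd, mul_neg_one]
  exact (mul_le_mul_right (blk_mono fun ξ => enorm_apply_le _ _) _).trans
    (hp.two_rpow_mul_blk_le ht j)

theorem IsFreqSolution.clNorm_lt_top (hψ : IsDyadicPartition ψ) (h : IsFreqSolution ψ g v)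
    {p : ℝ} (hp : 1 < p) (a : Idx) :
    clNorm ψ (ENNReal.ofReal p) (2 / p - 1) 1 2 (fun t => toField v t a) < ∞ := by
  obtain ⟨b, hb, hpar⟩ := h.exists_isParabolic hψ
  refine (seqNorm_two_mono fun j => ?_).trans_lt (seqNorm_two_lt_top hb)
  refine le_trans (mul_le_mul_right (eLpNorm_mono_enorm_ae ?_) _) (hpar.eLpNorm_le j hp)
  filter_upwards [ae_timeMeasure_pos] with t ht
  rw [distLpNorm_one_fourierD_dyadicBlock hψ (h.hasFourierDensity hψ ht.le a), enorm_eq_self,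
    enorm_eq_self]
  exact blk_mono fun ξ => enorm_apply_le _ _

/-! ### Continuity in time -/

section Continuity

attribute [local irreducible] semigroupSymbol nonlinearity

/-- Dominated convergence over all positive `τ`, with the upper limit of integration written as an
indicator. The integrand may jump in `s` only at `s = τ`, so only the single time `τ = t` is lost.
-/
theorem tendsto_duh (hv : Measurable (Function.uncurry v)) {ξ : E3}
    (hξ : ∫⁻ τ, conv (fun η => ‖v τ η‖ₑ) (fun η => ‖v τ η‖ₑ) ξ ∂timeMeasure < ∞) (t : ℝ) :
    Tendsto (fun s => duh v s ξ) (𝓝 t) (𝓝 (duh v t ξ)) := by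
  have hN := integrableOn_nonlinearity (S := fun t ξ => ‖v t ξ‖ₑ) hv (measurable_enorm_vec hv)
    (fun _ _ => le_rfl) hξ
  have e : ∀ s, duh v s ξ = ∫ τ in Set.Ioi 0, (Set.Iic s).indicator
      (fun τ => semigroupSymbol (s - τ) ξ *ᵥ nonlinearity (v τ) ξ) τ := by
    intro s
    rw [setIntegral_indicator measurableSet_Iic, Set.Ioi_inter_Iic, duh]
  simp_rw [e]
  refine tendsto_integral_filter_of_dominated_convergence
    (fun τ => 3 * ‖nonlinearity (v τ) ξ‖) ?_ ?_ (hN.norm.const_mul 3) ?_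
  · refine Eventually.of_forall fun s => ?_
    have hm : Measurable fun τ => semigroupSymbol (s - τ) ξ *ᵥ nonlinearity (v τ) ξ :=
      (measurable_duh_integrand hv).comp (measurable_prodMk_left (x := ((s, ξ) : ℝ × E3)))
    exact (hm.indicator measurableSet_Iic).aestronglyMeasurable
  · refine Eventually.of_forall fun s => Eventually.of_forall fun τ => ?_
    by_cases hτ : τ ∈ Set.Iic s
    · rw [Set.indicator_of_mem hτ]
      have hs : 0 ≤ s - τ := sub_nonneg.2 hτ
      refine (norm_semigroupSymbol_mulVec_le hs ξ _).trans ?_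
      refine mul_le_mul_of_nonneg_right ?_ (norm_nonneg _)
      have : Real.exp (-(s - τ) * ‖ξ‖ ^ 2 / 2) ≤ 1 := by
        rw [Real.exp_le_one_iff]
        have : 0 ≤ (s - τ) * ‖ξ‖ ^ 2 := by positivity
        linarith
      linarith
    · rw [Set.indicator_of_notMem hτ, norm_zero]
      positivity
  · have hne : ∀ᵐ τ ∂(volume.restrict (Set.Ioi (0 : ℝ))), τ ≠ t :=
      ae_restrict_of_ae (by rw [ae_iff]; simp)
    filter_upwards [hne] with τ hτ
    rcases lt_or_gt_of_ne hτ with h1 | h1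
    · have hc : Tendsto (fun s => semigroupSymbol (s - τ) ξ *ᵥ nonlinearity (v τ) ξ) (𝓝 t)
          (𝓝 (semigroupSymbol (t - τ) ξ *ᵥ nonlinearity (v τ) ξ)) := by
        have hcs : Continuous fun s : ℝ => semigroupSymbol (s - τ) ξ :=
          continuous_semigroupSymbol.comp
            ((continuous_id.sub continuous_const).prodMk continuous_const)
        exact (hcs.matrix_mulVec continuous_const).tendsto t
      rw [Set.indicator_of_mem (Set.mem_Iic.2 h1.le)]
      refine hc.congr' ?_
      filter_upwards [lt_mem_nhds h1] with s hs
      rw [Set.indicator_of_mem (Set.mem_Iic.2 hs.le)]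
    · rw [Set.indicator_of_notMem (by simpa using h1)]
      refine tendsto_const_nhds.congr' ?_
      filter_upwards [gt_mem_nhds h1] with s hs
      rw [Set.indicator_of_notMem (by simpa using hs)]

theorem tendsto_linEvol (g : E3 → Idx → ℂ) (t : ℝ) (ξ : E3) :
    Tendsto (fun s => linEvol g s ξ) (𝓝 t) (𝓝 (linEvol g t ξ)) := by
  have hcs : Continuous fun s : ℝ => semigroupSymbol s ξ :=
    continuous_semigroupSymbol.comp (continuous_id.prodMk continuous_const)
  exact (hcs.matrix_mulVec continuous_const).tendsto t

end Continuity

theorem IsFreqSolution.blk_data_lt_top (h : IsFreqSolution ψ g v) (j : ℤ) :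
    blk ψ j (fun ξ => ‖g ξ‖ₑ) < ∞ := by
  by_contra hc
  have hc : blk ψ j (fun ξ => ‖g ξ‖ₑ) = ∞ := not_lt_top_iff.1 hc
  have h1 := (ENNReal.le_tsum j).trans_lt h.data
  rw [hc, ENNReal.mul_top (two_rpow_ne_zero _), ENNReal.top_mul_top] at h1
  exact lt_irrefl _ h1

/-- A majorant independent of time, obtained from `e^{-t|ξ|²/4} ≤ 1` and from the bound `|ξ|` for
the kernel. It serves dominated convergence within a block, so only finiteness of each block is
required. -/
theorem IsFreqSolution.exists_blk_bound (hψ : IsDyadicPartition ψ) (h : IsFreqSolution ψ g v) :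
    ∃ M : E3 → ℝ≥0∞, Measurable M ∧ (∀ j, blk ψ j M < ∞) ∧
      ∀ᵐ ξ, ∀ t, 0 ≤ t → ‖v t ξ‖ₑ ≤ M ξ := by
  have hA := measurable_enorm_vec h.measurable
  have hc := measurable_conv hA hA
  have hcm : Measurable fun ξ => ∫⁻ τ, conv (fun η => ‖v τ η‖ₑ) (fun η => ‖v τ η‖ₑ) ξ
      ∂timeMeasure := (hc.comp measurable_swap).lintegral_prod_right'
  refine ⟨fun ξ => 3 * ‖g ξ‖ₑ + 108 * (ENNReal.ofReal ‖ξ‖ *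
    ∫⁻ τ, conv (fun η => ‖v τ η‖ₑ) (fun η => ‖v τ η‖ₑ) ξ ∂timeMeasure), ?_, fun j => ?_, ?_⟩
  · exact (h.measurable_data.enorm.const_mul 3).add
      ((measurable_norm.ennreal_ofReal.mul hcm).const_mul 108)
  · rw [blk_add (h.measurable_data.enorm.const_mul 3), blk_const_mul (by simp),
      blk_const_mul (by simp)]
    refine ENNReal.add_lt_top.2 ⟨ENNReal.mul_lt_top (by simp) (h.blk_data_lt_top j),
      ENNReal.mul_lt_top (by simp) ?_⟩
    have hF := (ENNReal.le_tsum j).trans_lt (tsum_lintegral_blk_conv_lt_top hψ hA h.vnorm_lt)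
    refine lt_of_le_of_lt (blk_mono_ae (G := fun ξ => (3 * 2 ^ (j : ℝ)) *
      ∫⁻ τ, conv (fun η => ‖v τ η‖ₑ) (fun η => ‖v τ η‖ₑ) ξ ∂timeMeasure)
      (Eventually.of_forall fun ξ hξ => mul_le_mul_left (hψ.ofReal_norm_le hξ) _)) ?_
    have hct : (3 * 2 ^ (j : ℝ) : ℝ≥0∞) ≠ ∞ := ENNReal.mul_ne_top (by simp) (two_rpow_ne_top _)
    rw [blk_const_mul hct, blk_lintegral hc]
    exact ENNReal.mul_lt_top hct.lt_top hF
  · filter_upwards [h.enorm_le] with ξ hξ t ht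
    refine (hξ t ht).trans (add_le_add (mul_le_mul_right ?_ _) (mul_le_mul_right ?_ _))
    · refine mul_le_of_le_one_left zero_le ?_
      rw [ENNReal.ofReal_le_one, Real.exp_le_one_iff]
      have : 0 ≤ ‖ξ‖ ^ 2 / 4 * t := by positivity
      linarith
    · rw [← lintegral_const_mul' _ _ ENNReal.ofReal_ne_top]
      exact lintegral_mono fun τ => mul_le_mul_left (heatKernel_le t τ ξ) _

theorem IsFreqSolution.tendsto_blk (hψ : IsDyadicPartition ψ) (h : IsFreqSolution ψ g v)
    {t : ℝ} (ht : 0 ≤ t) (j : ℤ) (a : Idx) :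
    Tendsto (fun s => blk ψ j fun ξ => ‖v s ξ a - v t ξ a‖ₑ) (𝓝[Set.Ici 0] t) (𝓝 0) := by
  obtain ⟨M, hM, hMj, hMv⟩ := h.exists_blk_bound hψ
  have h0 : blk ψ j (fun _ => 0) = 0 := by simp [blk]
  rw [← h0]
  refine tendsto_lintegral_filter_of_dominated_convergence
    (fun ξ => ‖dyadicSymbol ψ j ξ‖ₑ * (2 * M ξ)) ?_ ?_ ?_ ?_
  · refine Eventually.of_forall fun s => (measurable_enorm_dyadicSymbol ψ j).mul ?_
    exact ((h.measurable_apply s a).sub (h.measurable_apply t a)).enorm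
  · filter_upwards [self_mem_nhdsWithin] with s hs
    filter_upwards [hMv] with ξ hξ
    refine mul_le_mul_right ?_ _
    calc ‖v s ξ a - v t ξ a‖ₑ ≤ ‖v s ξ a‖ₑ + ‖v t ξ a‖ₑ := enorm_sub_le
      _ ≤ M ξ + M ξ := add_le_add ((enorm_apply_le _ _).trans (hξ s hs))
          ((enorm_apply_le _ _).trans (hξ t ht))
      _ = _ := (two_mul _).symm
  · have : blk ψ j (fun ξ => 2 * M ξ) < ∞ := by
      rw [blk_const_mul (by simp)]
      exact ENNReal.mul_lt_top (by simp) (hMj j)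
    exact this.ne
  · filter_upwards [h.ae_conv] with ξ hξ
    have h1 : Tendsto (fun s => v s ξ) (𝓝 t) (𝓝 (v t ξ)) := by
      simp_rw [h.eq]
      exact (tendsto_linEvol g t ξ).sub (tendsto_duh h.measurable hξ t)
    have h2 : Tendsto (fun s => v s ξ a - v t ξ a) (𝓝 t) (𝓝 0) := by
      have := ((continuous_apply a).tendsto (v t ξ)).comp h1
      simpa using this.sub_const (v t ξ a)
    have h3 : Tendsto (fun s => ‖v s ξ a - v t ξ a‖ₑ) (𝓝 t) (𝓝 0) := by
      simpa using h2.enorm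
    have h4 := ENNReal.Tendsto.const_mul (a := ‖dyadicSymbol ψ j ξ‖ₑ) h3 (Or.inr (by simp))
    exact h4.mono_left nhdsWithin_le_nhds

/-- Two dominated convergences are nested: each block is continuous in time, and the sum over the
blocks is dominated by the summable sequence `(2 b_j)²`. -/
theorem IsFreqSolution.isContinuousFB (hψ : IsDyadicPartition ψ) (h : IsFreqSolution ψ g v) :
    IsContinuousFB ψ (toField v) := by
  refine fun a t ht => ⟨h.memFB hψ ht a, ?_⟩
  obtain ⟨b, hb, hp⟩ := h.exists_isParabolic hψ
  have h1 : Tendsto (fun s => ∑' j : ℤ, (2 ^ (-(j : ℝ)) *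
      blk ψ j fun ξ => ‖v s ξ a - v t ξ a‖ₑ) ^ (2 : ℝ)) (𝓝[Set.Ici 0] t) (𝓝 0) := by
    simp_rw [← lintegral_count]
    rw [← lintegral_zero (μ := (Measure.count : Measure ℤ))]
    refine tendsto_lintegral_filter_of_dominated_convergence
      (fun j => (2 * b j) * (2 * b j)) ?_ ?_ ?_ ?_
    · exact Eventually.of_forall fun s => measurable_of_countable _
    · filter_upwards [self_mem_nhdsWithin] with s hs
      refine Eventually.of_forall fun j => ?_
      have : 2 ^ (-(j : ℝ)) * blk ψ j (fun ξ => ‖v s ξ a - v t ξ a‖ₑ) ≤ 2 * b j := by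
        calc _ ≤ 2 ^ (-(j : ℝ)) * blk ψ j (fun ξ => ‖v s ξ‖ₑ + ‖v t ξ‖ₑ) := by
              refine mul_le_mul_right (blk_mono fun ξ => ?_) _
              exact enorm_sub_le.trans (add_le_add (enorm_apply_le _ _) (enorm_apply_le _ _))
          _ = 2 ^ (-(j : ℝ)) * blk ψ j (fun ξ => ‖v s ξ‖ₑ) +
                2 ^ (-(j : ℝ)) * blk ψ j (fun ξ => ‖v t ξ‖ₑ) := by
              rw [blk_add (h.measurable.of_uncurry_left.enorm), mul_add]
          _ ≤ b j + b j := add_le_add (hp.two_rpow_mul_blk_le hs j) (hp.two_rpow_mul_blk_le ht j)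
          _ = _ := (two_mul _).symm
      rw [ENNReal.rpow_two, sq]
      exact mul_le_mul' this this
    · rw [lintegral_count, tsum_const_mul_mul_self]
      exact ENNReal.mul_ne_top (ENNReal.mul_ne_top (by simp) (by simp)) hb.ne
    · refine Eventually.of_forall fun j => ?_
      have h2 := ENNReal.Tendsto.const_mul (a := 2 ^ (-(j : ℝ))) (h.tendsto_blk hψ ht j a)
        (Or.inr (two_rpow_ne_top _))
      have h3 := (ENNReal.continuous_rpow_const (y := 2)).tendsto 0 |>.comp
        (by simpa using h2)
      rw [ENNReal.zero_rpow_of_pos (by norm_num)] at h3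
      exact h3
  have h2 := (ENNReal.continuous_rpow_const (y := 1 / 2)).tendsto 0 |>.comp h1
  rw [ENNReal.zero_rpow_of_pos (by norm_num)] at h2
  refine h2.congr' ?_
  filter_upwards [self_mem_nhdsWithin] with s hs
  rw [fbNorm, seqNorm, if_neg (by simp)]
  have hd := (h.hasFourierDensity hψ hs a).sub (h.hasFourierDensity hψ ht a)
  simp_rw [distLpNorm_one_fourierD_dyadicBlock hψ hd, mul_neg_one, ENNReal.toReal_ofNat]
  rfl

/-! ### Solenoidal and real solutions -/

theorem sum_mul_leraySymbol (ξ : E3) (w : Fin 3 → ℂ) :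
    ∑ k : Fin 3, (ξ k : ℂ) * (leraySymbol ξ *ᵥ w) k = 0 := by
  by_cases hξ : ξ = 0
  · simp [hξ]
  have hn : ((‖ξ‖ ^ 2 : ℝ) : ℂ) ≠ 0 := by
    have : ‖ξ‖ ≠ 0 := norm_ne_zero_iff.2 hξ
    exact_mod_cast pow_ne_zero 2 this
  have hs : ((‖ξ‖ ^ 2 : ℝ) : ℂ) = (ξ 0 : ℂ) ^ 2 + (ξ 1 : ℂ) ^ 2 + (ξ 2 : ℂ) ^ 2 := by
    rw [EuclideanSpace.real_norm_sq_eq]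
    push_cast [Fin.sum_univ_three]
    ring
  simp only [Matrix.mulVec, dotProduct, leraySymbol, Matrix.of_apply, Fin.sum_univ_three]
  simp only [Fin.isValue, zero_ne_one, Fin.reduceEq, if_true, if_false, one_ne_zero]
  field_simp
  rw [hs]
  ring

theorem sum_mul_duh (v : ℝ → E3 → Idx → ℂ) (t : ℝ) (ξ : E3) :
    ∑ k : Fin 3, (ξ k : ℂ) * duh v t ξ (Sum.inl k) = 0 := by
  by_cases hi : IntegrableOn (fun τ => semigroupSymbol (t - τ) ξ *ᵥ nonlinearity (v τ) ξ)
    (Set.Ioc 0 t)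
  · let L : (Idx → ℂ) →L[ℂ] ℂ :=
      ∑ k : Fin 3, (ξ k : ℂ) • ContinuousLinearMap.proj (Sum.inl k)
    have hL : ∀ x, L x = ∑ k : Fin 3, (ξ k : ℂ) * x (Sum.inl k) := by
      intro x
      simp [L]
    rw [← hL, duh, ← L.integral_comp_comm hi]
    refine integral_eq_zero_of_ae (Eventually.of_forall fun τ => ?_)
    change L _ = 0
    rw [hL]
    exact sum_mul_semigroupSymbol_eq_zero _ _ (sum_mul_leraySymbol ξ _)
  -- At frequencies where the integral diverges the Bochner integral is zero by convention, so the
  -- identity holds at every `ξ`.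
  · rw [duh, integral_undef hi]
    simp

theorem IsFreqSolution.isDivFree (hψ : IsDyadicPartition ψ) (h : IsFreqSolution ψ g v)
    (hg : ∀ ξ, ∑ k : Fin 3, (ξ k : ℂ) * g ξ (Sum.inl k) = 0) {t : ℝ} (ht : 0 ≤ t) :
    IsDivFree fun k => toField v t (Sum.inl k) := by
  refine isDivFree_ofDensity (g := fun k ξ => v t ξ (Sum.inl k))
    (fun k => h.isTemperedDensity hψ ht _) fun ξ => ?_
  simp_rw [h.eq t ξ, Pi.sub_apply, mul_sub, Finset.sum_sub_distrib]
  rw [sum_mul_duh, sub_zero]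
  exact sum_mul_semigroupSymbol_eq_zero _ _ (hg ξ)

theorem fourierProd_conj (f g : E3 → ℂ) (ξ : E3) :
    fourierProd (fun η => star (f (-η))) (fun η => star (g (-η))) ξ =
      star (fourierProd f g (-ξ)) := by
  have h1 : ∫ η, star (f (-(ξ - η))) * star (g (-η)) = star (∫ η, f (-ξ - η) * g η) := by
    rw [← integral_neg_eq_self (fun η => star (f (-(ξ - η))) * star (g (-η)))]
    have h2 := integral_conj (f := fun η => f (-ξ - η) * g η) (μ := volume)
    rw [show star (∫ η, f (-ξ - η) * g η) = starRingEnd ℂ (∫ η, f (-ξ - η) * g η) from rfl, ← h2]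
    refine integral_congr_ae (Eventually.of_forall fun η => ?_)
    simp only [neg_neg, map_mul, starRingEnd_apply]
    congr 3
    abel
  unfold fourierProd
  rw [h1, star_mul']
  congr 1
  simp

theorem leraySymbol_neg (ξ : E3) : leraySymbol (-ξ) = leraySymbol ξ := by
  ext i l
  simp [leraySymbol]

theorem leraySymbol_conj (ξ : E3) (w : Fin 3 → ℂ) :
    leraySymbol ξ *ᵥ star w = star (leraySymbol ξ *ᵥ w) := by
  ext i
  simp only [Matrix.mulVec, dotProduct, Pi.star_apply, star_sum, star_mul']
  refine Finset.sum_congr rfl fun l _ => ?_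
  congr 1
  simp only [leraySymbol, Matrix.of_apply, star_sub, star_div₀, star_mul', Complex.star_def,
    Complex.conj_ofReal]
  split_ifs <;> simp

theorem divTensor_conj (u w : Fin 3 → E3 → ℂ) (ξ : E3) :
    divTensor (fun k η => star (u k (-η))) (fun k η => star (w k (-η))) ξ =
      star (divTensor u w (-ξ)) := by
  ext l
  simp only [divTensor, fourierProd_conj, Pi.star_apply, star_sum, star_mul']
  refine Finset.sum_congr rfl fun k _ => ?_
  congr 1
  simp

theorem nonlinearity_conj (w : E3 → Idx → ℂ) (ξ : E3) :
    nonlinearity (fun η => star (w (-η))) ξ = star (nonlinearity w (-ξ)) := by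
  have h1 := divTensor_conj (fun k η => w η (Sum.inl k)) (fun k η => w η (Sum.inl k)) ξ
  have h2 := divTensor_conj (fun k η => w η (Sum.inl k)) (fun k η => w η (Sum.inr k)) ξ
  ext a
  rcases a with a | a
  · simp only [nonlinearity, Sum.elim_inl, Pi.star_apply]
    rw [h1, leraySymbol_conj, leraySymbol_neg]
    rfl
  · simp only [nonlinearity, Sum.elim_inr, Pi.star_apply]
    rw [h2]
    rfl

theorem semigroupSymbol_conj (t : ℝ) (ξ : E3) (x : Idx → ℂ) :
    semigroupSymbol t ξ *ᵥ star x = star (semigroupSymbol t (-ξ) *ᵥ x) := by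
  rw [semigroupSymbol_neg]
  ext a
  simp [Matrix.mulVec, dotProduct]

theorem duh_conj (v : ℝ → E3 → Idx → ℂ) (t : ℝ) (ξ : E3) :
    duh (fun t η => star (v t (-η))) t ξ = star (duh v t (-ξ)) := by
  have h := ContinuousLinearEquiv.integral_comp_comm
    (starL' ℝ : (Idx → ℂ) ≃L[ℝ] (Idx → ℂ)) (μ := volume.restrict (Set.Ioc 0 t))
    (fun τ => semigroupSymbol (t - τ) (-ξ) *ᵥ nonlinearity (v τ) (-ξ))
  refine Eq.trans ?_ h
  refine integral_congr_ae (Eventually.of_forall fun τ => ?_)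
  simp only [nonlinearity_conj, semigroupSymbol_conj]
  rfl

theorem vnorm_conj (v : ℝ → E3 → Idx → ℂ) : vnorm (fun t η => star (v t (-η))) = vnorm v := by
  unfold vnorm znorm
  congr 1
  ext1 t
  rw [← lintegral_neg_eq_self (fun ξ => ‖v t ξ‖ₑ)]
  refine lintegral_congr fun ξ => ?_
  change ‖star (v t (-ξ))‖ₑ = _
  rw [← ofReal_norm, norm_star, ofReal_norm]

/-- The equation and the norm are invariant under `v(t, ξ) ↦ star (v(t, -ξ))`, and so are the data.
Uniqueness of the small solution makes it invariant too. -/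
theorem IsFreqSolution.conj_eq {ε : ℝ≥0∞} (h : IsFreqSolution ψ g v) (hv : vnorm v ≤ 2 * ε)
    (hs : 864 * ε ≤ 1) (hg : ∀ ξ, g (-ξ) = star (g ξ)) (t : ℝ) (ξ : E3) :
    v t (-ξ) = star (v t ξ) := by
  have hm : Measurable (Function.uncurry fun t η => star (v t (-η))) := by
    have h1 : Measurable fun z : ℝ × E3 => v z.1 (-z.2) :=
      h.measurable.comp (measurable_fst.prodMk measurable_snd.neg)
    exact continuous_star.measurable.comp h1
  have := mild_unique_small (L := linEvol g) h.measurable hm hv ((vnorm_conj v).trans_le hv) hs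
    h.eq fun t ξ => by
      rw [duh_conj, h.eq t (-ξ), star_sub]
      congr 1
      rw [linEvol, linEvol, hg, ← neg_neg ξ, ← semigroupSymbol_conj, neg_neg]
      simp
  have h2 := congr_fun (congr_fun this t) (-ξ)
  simpa using h2

theorem IsFreqSolution.isRealDist {ε : ℝ≥0∞} (hψ : IsDyadicPartition ψ)
    (h : IsFreqSolution ψ g v) (hv : vnorm v ≤ 2 * ε)
    (hs : 864 * ε ≤ 1) (hg : ∀ ξ, g (-ξ) = star (g ξ)) {t : ℝ} (ht : 0 ≤ t) (a : Idx) :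
    IsRealDist (toField v t a) := by
  refine isRealDist_ofDensity (h.isTemperedDensity hψ ht a) fun ξ => ?_
  rw [h.conj_eq hv hs hg]
  rfl

theorem IsFreqSolution.apply_zero (h : IsFreqSolution ψ g v) (ξ : E3) : v 0 ξ = g ξ := by
  rw [h.eq, linEvol, semigroupSymbol_zero, Matrix.one_mulVec, duh]
  simp

theorem IsFreqSolution.isMildSolution (hψ : IsDyadicPartition ψ) (h : IsFreqSolution ψ g v) :
    IsMildSolution (toField v 0) (toField v) := by
  refine ⟨g, v, fun a => ?_, fun t ht a => h.hasFourierDensity hψ ht a,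
    h.measurable.aestronglyMeasurable, ?_, fun t _ => ?_⟩
  · have := h.hasFourierDensity hψ le_rfl a
    simpa only [h.apply_zero] using this
  · filter_upwards [ae_lintegral_lt_top_of_znorm (measurable_enorm_vec h.measurable) h.vnorm_lt]
      with t ht
    exact ⟨h.measurable.of_uncurry_left.aestronglyMeasurable, ht⟩
  · filter_upwards [h.ae_conv] with ξ hξ
    exact ⟨integrableOn_duh_integrand h.measurable (measurable_enorm_vec h.measurable)
      (fun _ _ => le_rfl) hξ t, h.eq t ξ⟩

/-- A small solution on the Fourier side is a solution in all the classes `X^α`. -/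
theorem IsFreqSolution.isSolution {ε : ℝ≥0∞} (hψ : IsDyadicPartition ψ)
    (h : IsFreqSolution ψ g v) (hv : vnorm v ≤ 2 * ε) (hs : 864 * ε ≤ 1)
    (hg : ∀ ξ, g (-ξ) = star (g ξ))
    (hdiv : ∀ ξ, ∑ k : Fin 3, (ξ k : ℂ) * g ξ (Sum.inl k) = 0) {α : ℝ} (h0 : 0 < α) (h1 : α < 1) :
    IsSolution ψ α (toField v 0) (toField v) where
  initial := rfl
  real _ ht a := h.isRealDist hψ hv hs hg ht a
  divFree _ ht := h.isDivFree hψ hdiv ht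
  continuous := h.isContinuousFB hψ
  high a := by
    have := h.clNorm_lt_top hψ (p := 2 / (1 + α)) (by rw [lt_div_iff₀] <;> linarith) a
    rwa [div_div_cancel₀ two_ne_zero, add_sub_cancel_left] at this
  low a := by
    have := h.clNorm_lt_top hψ (p := 2 / (1 - α)) (by rw [lt_div_iff₀] <;> linarith) a
    rwa [div_div_cancel₀ two_ne_zero, show 1 - α - 1 = -α by ring] at this
  mild := h.isMildSolution hψ

end Regularity

end

section

/-! ### Uniqueness in `L²(0, ∞; L¹)` -/

section Uniqueness

variable {ψ : 𝓢(E3, ℝ)} {g : E3 → Idx → ℂ} {v w : ℝ → E3 → Idx → ℂ} {W S : ℝ → E3 → ℝ≥0∞}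

theorem conv_eq_zero_of_ae {a b : E3 → ℝ≥0∞} (ha : a =ᵐ[volume] 0) (ξ : E3) : conv a b ξ = 0 := by
  rw [conv_comm, conv]
  refine (lintegral_congr_ae (g := fun _ => 0) ?_).trans lintegral_zero
  filter_upwards [ha] with η hη
  rw [hη, Pi.zero_apply, mul_zero]

/-- The restriction of a function of `(t, ξ)` to the times in a set. -/
def cut (I : Set ℝ) (A : ℝ → E3 → ℝ≥0∞) (t : ℝ) (ξ : E3) : ℝ≥0∞ := I.indicator (fun t => A t ξ) t

theorem cut_of_mem {I : Set ℝ} {t : ℝ} (h : t ∈ I) (A : ℝ → E3 → ℝ≥0∞) : cut I A t = A t := by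
  ext ξ
  rw [cut, Set.indicator_of_mem h]

theorem cut_of_notMem {I : Set ℝ} {t : ℝ} (h : t ∉ I) (A : ℝ → E3 → ℝ≥0∞) : cut I A t = 0 := by
  ext ξ
  rw [cut, Set.indicator_of_notMem h, Pi.zero_apply]

theorem measurable_cut {I : Set ℝ} (hI : MeasurableSet I) {A : ℝ → E3 → ℝ≥0∞}
    (hA : Measurable (Function.uncurry A)) : Measurable (Function.uncurry (cut I A)) := by
  have h := hA.indicator (measurable_fst hI : MeasurableSet (Prod.fst ⁻¹' I : Set (ℝ × E3)))
  convert h using 1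
  ext1 z
  by_cases hz : z.1 ∈ I
  · rw [Set.indicator_of_mem (by exact hz), Function.uncurry, cut_of_mem hz]
    rfl
  · rw [Set.indicator_of_notMem (by exact hz), Function.uncurry, cut_of_notMem hz]
    rfl

theorem znorm_cut_le (I : Set ℝ) (A : ℝ → E3 → ℝ≥0∞) : znorm (cut I A) ≤ znorm A := by
  refine znorm_mono (Eventually.of_forall fun t => Eventually.of_forall fun ξ => ?_)
  by_cases h : t ∈ I
  · rw [cut_of_mem h]
  · rw [cut_of_notMem h]
    exact zero_le

/-- Absolute continuity of the integral: the length `h` of the time window does not depend on its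
position, so the continuation in time takes steps of constant length. -/
theorem exists_znorm_cut_le (hS : znorm S < ∞) {c : ℝ≥0∞} (hc : c ≠ 0) :
    ∃ h : ℝ, 0 < h ∧ ∀ T, znorm (cut (Set.Ioc T (T + h)) S) ≤ c := by
  have h1 := lintegral_sq_lt_top_of_znorm hS
  obtain ⟨δ, hδ, hs⟩ := exists_pos_setLIntegral_lt_of_measure_lt h1.ne (mul_ne_zero hc hc)
  obtain ⟨h, h0, hhδ⟩ := ENNReal.lt_iff_exists_nnreal_btwn.1 hδ
  refine ⟨h, by exact_mod_cast h0, fun T => timeL2_le_of_sq_le ?_⟩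
  have h2 := hs (Set.Ioc T (T + h)) (lt_of_le_of_lt (Measure.restrict_le_self _)
    (by rw [Real.volume_Ioc, add_sub_cancel_left, ENNReal.ofReal_coe_nnreal]; exact hhδ))
  refine le_trans (le_of_eq ?_) h2.le
  rw [← lintegral_indicator measurableSet_Ioc]
  refine lintegral_congr fun t => ?_
  by_cases ht : t ∈ Set.Ioc T (T + h)
  · rw [cut_of_mem ht, Set.indicator_of_mem ht, ENNReal.rpow_two, sq]
  · rw [cut_of_notMem ht, Set.indicator_of_notMem ht]
    simp

/-- A nonnegative function dominated by its own Duhamel term vanishes. -/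
theorem ae_ae_eq_zero_of_le_duhMaj (hW : Measurable (Function.uncurry W))
    (hS : Measurable (Function.uncurry S)) (hWz : znorm W < ∞) (hSz : znorm S < ∞)
    (h : ∀ᵐ ξ, ∀ t, W t ξ ≤ 108 * duhMaj W S t ξ) :
    ∀ᵐ t ∂timeMeasure, ∀ᵐ ξ, W t ξ = 0 := by
  obtain ⟨d, hd, hSd⟩ := exists_znorm_cut_le hSz (c := 216⁻¹) (by simp)
  -- Continuation by steps of length `d`. On a window of this length `S` has norm at most `1/216`,
  -- which turns the constant `108` into the contraction factor `1/2`.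
  have step : ∀ n : ℕ, ∀ᵐ t ∂timeMeasure, t ≤ n * d → ∀ᵐ ξ, W t ξ = 0 := by
    intro n
    induction n with
    | zero =>
      filter_upwards [ae_timeMeasure_pos] with t ht h0
      simp only [Nat.cast_zero, zero_mul] at h0
      linarith
    | succ n ih =>
      set T : ℝ := n * d with hT
      have hT' : ((n + 1 : ℕ) : ℝ) * d = T + d := by push_cast; ring
      rw [hT']
      let W1 := cut (Set.Iic (T + d)) W
      let S1 := cut (Set.Ioc T (T + d)) S
      have hW1 : Measurable (Function.uncurry W1) := measurable_cut measurableSet_Iic hW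
      have hS1 : Measurable (Function.uncurry S1) := measurable_cut measurableSet_Ioc hS
      -- Times before `T` drop out because `W` already vanishes there, times after `t` because the
      -- kernel does. Only `S` on `(T, T + d]` matters.
      have hmono : ∀ t ≤ T + d, ∀ ξ, duhMaj W S t ξ ≤ duhMaj W1 S1 t ξ := by
        intro t ht ξ
        refine lintegral_mono_ae ?_
        filter_upwards [ih] with τ hτ
        rcases le_or_gt τ t with hτt | hτt
        · rcases le_or_gt τ T with hτT | hτT
          · rw [conv_eq_zero_of_ae (hτ hτT), mul_zero]
            exact zero_le
          · have e1 : W1 τ = W τ := cut_of_mem (Set.mem_Iic.2 (hτt.trans ht)) W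
            have e2 : S1 τ = S τ := cut_of_mem (Set.mem_Ioc.2 ⟨hτT, hτt.trans ht⟩) S
            rw [e1, e2]
        · rw [heatKernel, if_neg (not_le.2 hτt), zero_mul]
          exact zero_le
      have hle : znorm W1 ≤ znorm (fun t ξ => 108 * duhMaj W1 S1 t ξ) := by
        refine znorm_mono (Eventually.of_forall fun t => ?_)
        filter_upwards [h] with ξ hξ
        by_cases ht : t ≤ T + d
        · have e1 : W1 t = W t := cut_of_mem (Set.mem_Iic.2 ht) W
          rw [e1]
          exact (hξ t).trans (mul_le_mul_right (hmono t ht ξ) _)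
        · have e1 : W1 t = 0 := cut_of_notMem (by simpa using ht) W
          rw [e1]
          exact zero_le
      have hfin : znorm W1 ≠ ∞ := ((znorm_cut_le _ _).trans_lt hWz).ne
      have hz : znorm W1 = 0 := by
        by_contra hne
        have h1 : znorm W1 ≤ znorm W1 / 2 := by
          calc znorm W1 ≤ 108 * znorm (duhMaj W1 S1) := by
                rw [← znorm_const_mul (by simp)]; exact hle
            _ ≤ 108 * (znorm W1 * 216⁻¹) := by
                gcongr
                exact (znorm_duhMaj_le hW1 hS1).trans (mul_le_mul_right (hSd T) _)
            _ = (108 * 216⁻¹) * znorm W1 := by ring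
            _ = znorm W1 / 2 := by
                rw [ENNReal.div_eq_inv_mul]
                congr 1
                rw [show (216 : ℝ≥0∞) = 108 * 2 by norm_num,
                  ENNReal.mul_inv (by simp) (by simp), ← mul_assoc,
                  ENNReal.mul_inv_cancel (by simp) (by simp), one_mul]
        exact absurd h1 (not_le.2 (ENNReal.half_lt_self hne hfin))
      filter_upwards [ae_ae_eq_zero_of_znorm hW1 hz] with t ht htT
      filter_upwards [ht] with ξ hξ
      have e1 : W1 t = W t := cut_of_mem (Set.mem_Iic.2 htT) W
      rwa [e1] at hξ
  filter_upwards [ae_all_iff.2 step] with t ht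
  obtain ⟨n, hn⟩ := exists_nat_ge (t / d)
  exact ht n ((div_le_iff₀ hd).1 hn)

/-- Uniqueness of the solution of the mild equation in `L²(0, ∞; L¹)`. -/
theorem IsFreqSolution.unique (h : IsFreqSolution ψ g v) (h' : IsFreqSolution ψ g w) : v = w := by
  have hv := h.measurable
  have hw := h'.measurable
  let S : ℝ → E3 → ℝ≥0∞ := fun t ξ => ‖v t ξ‖ₑ + ‖w t ξ‖ₑ
  have hS : Measurable (Function.uncurry S) := (measurable_enorm_vec hv).add (measurable_enorm_vec hw)
  have hSz : znorm S < ∞ := (znorm_add_le (measurable_enorm_vec hv)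
    (measurable_enorm_vec hw)).trans_lt (ENNReal.add_lt_top.2 ⟨h.vnorm_lt, h'.vnorm_lt⟩)
  have hz : ∀ᵐ t ∂timeMeasure, ∀ᵐ ξ, ‖v t ξ - w t ξ‖ₑ = 0 := by
    refine ae_ae_eq_zero_of_le_duhMaj (W := fun t ξ => ‖v t ξ - w t ξ‖ₑ)
      (measurable_enorm_sub hv hw) hS ((vnorm_sub_le hv hw).trans_lt
        (ENNReal.add_lt_top.2 ⟨h.vnorm_lt, h'.vnorm_lt⟩)) hSz ?_
    filter_upwards [ae_lintegral_conv_lt_top hS hSz] with ξ hξ t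
    have e : v t ξ - w t ξ = duh w t ξ - duh v t ξ := by
      rw [h.eq, h'.eq, sub_sub_sub_cancel_left]
    rw [e, enorm_sub_rev]
    exact duh_sub_le hv hw hS (fun _ _ => le_self_add) (fun _ _ => le_add_self) hξ t
  have hd : duh v = duh w := by
    refine duh_congr ?_
    filter_upwards [hz] with t ht
    filter_upwards [ht] with ξ hξ
    exact sub_eq_zero.1 (enorm_eq_zero.1 hξ)
  ext1 t
  ext1 ξ
  rw [h.eq, h'.eq, hd]

/-! ### Uniqueness in the classes `X^α` -/

theorem tsum_mul_self_lt_top_of_seqNorm {b : ℤ → ℝ≥0∞} (h : seqNorm 2 b < ∞) :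
    ∑' j, b j * b j < ∞ := by
  rw [seqNorm, if_neg (by simp)] at h
  have h1 := (ENNReal.rpow_lt_top_iff_of_pos (by simp)).1 h
  refine lt_of_le_of_lt (le_of_eq (tsum_congr fun j => ?_)) h1
  rw [ENNReal.toReal_ofNat, ENNReal.rpow_two, sq]

/-- The embedding of `X^α` into `L²(0,∞; L¹)`. The exponents `2/(1+α)` and `2/(1-α)` are conjugate,
so Hölder's inequality in time, with the block of higher frequency in the first space and the other
one in the second, gives the decay `2^{-α|j-k|}` required by Schur's test. -/
theorem znorm_lt_top_of_mixed (hψ : IsDyadicPartition ψ) {A : ℝ → E3 → ℝ≥0∞}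
    (hA : Measurable (Function.uncurry A)) {α : ℝ} (h0 : 0 < α) (h1 : α < 1)
    (hhigh : seqNorm 2 (fun j => 2 ^ ((j : ℝ) * α) * eLpNorm (fun t => blk ψ j (A t))
      (ENNReal.ofReal (2 / (1 + α))) timeMeasure) < ∞)
    (hlow : seqNorm 2 (fun j => 2 ^ ((j : ℝ) * (-α)) * eLpNorm (fun t => blk ψ j (A t))
      (ENNReal.ofReal (2 / (1 - α))) timeMeasure) < ∞) : znorm A < ∞ := by
  set p : ℝ := 2 / (1 + α) with hp
  set q : ℝ := 2 / (1 - α) with hq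
  have h1p : 0 < 1 + α := by linarith
  have h1q : 0 < 1 - α := by linarith
  have hp0 : 0 < p := by positivity
  have hq0 : 0 < q := by positivity
  have hpq : p.HolderConjugate q := by
    refine ⟨?_, hp0, hq0⟩
    rw [hp, hq]
    field_simp
    ring
  let P : ℤ → ℝ≥0∞ := fun j => 2 ^ ((j : ℝ) * α) * eLpNorm (fun t => blk ψ j (A t))
      (ENNReal.ofReal p) timeMeasure
  let Q : ℤ → ℝ≥0∞ := fun j => 2 ^ ((j : ℝ) * (-α)) * eLpNorm (fun t => blk ψ j (A t))
      (ENNReal.ofReal q) timeMeasure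
  have hPQ : ∑' j, (P j + Q j) * (P j + Q j) < ∞ :=
    (tsum_add_mul_self_le P Q).trans_lt (ENNReal.add_lt_top.2
      ⟨ENNReal.mul_lt_top (by simp) (tsum_mul_self_lt_top_of_seqNorm hhigh),
        ENNReal.mul_lt_top (by simp) (tsum_mul_self_lt_top_of_seqNorm hlow)⟩)
  have hm : ∀ j, AEMeasurable (fun t => blk ψ j (A t)) timeMeasure :=
    fun j => (measurable_blk hA j).aemeasurable
  have hH : ∀ j k : ℤ, k ≤ j → ∫⁻ t, blk ψ j (A t) * blk ψ k (A t) ∂timeMeasure ≤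
      geomSeq (2 ^ (-α)) (k - j) * ((P j + Q j) * (P k + Q k)) := by
    intro j k hkj
    have hκ := two_rpow_eq_geomSeq (α := α) (n := k - j) (by lia)
    calc ∫⁻ t, blk ψ j (A t) * blk ψ k (A t) ∂timeMeasure
        ≤ eLpNorm (fun t => blk ψ j (A t)) (ENNReal.ofReal p) timeMeasure *
          eLpNorm (fun t => blk ψ k (A t)) (ENNReal.ofReal q) timeMeasure := by
          rw [eLpNorm_eq_lintegral_rpow_enorm_toReal (by simpa using hp0) (by simp),
            eLpNorm_eq_lintegral_rpow_enorm_toReal (by simpa using hq0) (by simp),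
            ENNReal.toReal_ofReal hp0.le, ENNReal.toReal_ofReal hq0.le]
          simp only [enorm_eq_self]
          exact ENNReal.lintegral_mul_le_Lp_mul_Lq timeMeasure hpq (hm j) (hm k)
      _ = geomSeq (2 ^ (-α)) (k - j) * (P j * Q k) := by
          have e1 := two_rpow_neg_mul (-((j : ℝ) * α))
            (eLpNorm (fun t => blk ψ j (A t)) (ENNReal.ofReal p) timeMeasure)
          have e2 := two_rpow_neg_mul (-((k : ℝ) * (-α)))
            (eLpNorm (fun t => blk ψ k (A t)) (ENNReal.ofReal q) timeMeasure)
          rw [neg_neg] at e1 e2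
          have e3 : (2 : ℝ≥0∞) ^ (-((j : ℝ) * α)) * 2 ^ (-((k : ℝ) * (-α))) =
              geomSeq (2 ^ (-α)) (k - j) := by
            rw [← hκ, two_rpow_mul]
            push_cast
            ring_nf
          rw [← e3]
          nth_rewrite 1 [← e1, ← e2]
          ring
      _ ≤ _ := by
          gcongr
          · exact le_self_add
          · exact le_add_self
  have hb : ∀ j k : ℤ, ∫⁻ t, blk ψ j (A t) * blk ψ k (A t) ∂timeMeasure ≤
      geomSeq (2 ^ (-α)) (j - k) * ((P j + Q j) * (P k + Q k)) := by
    intro j k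
    rcases le_total k j with hkj | hkj
    · rw [← geomSeq_neg, neg_sub]
      exact hH j k hkj
    · rw [mul_comm (P j + Q j)]
      simp_rw [mul_comm (blk ψ j (A _))]
      exact hH k j hkj
  have hfin := (znorm_sq_le_of_blk (b := fun j => P j + Q j) hψ hA hb).trans_lt
    (ENNReal.mul_lt_top (tsum_geomSeq_lt_top (by positivity)
      (Real.rpow_lt_one_of_one_lt_of_neg one_lt_two (by linarith))) hPQ)
  by_contra hc
  rw [not_lt_top_iff.1 hc] at hfin
  simp at hfin

theorem vnorm_lt_top_of_apply (hv : Measurable (Function.uncurry v))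
    (h : ∀ a, znorm (fun t ξ => ‖v t ξ a‖ₑ) < ∞) : vnorm v < ∞ := by
  have hm : ∀ a, Measurable (Function.uncurry fun t ξ => ‖v t ξ a‖ₑ) := fun a =>
    ((measurable_pi_apply a).comp hv).enorm
  have key : ∀ s : Finset Idx, znorm (fun t ξ => ∑ a ∈ s, ‖v t ξ a‖ₑ) < ∞ := by
    intro s
    induction s using Finset.induction_on with
    | empty => simp [znorm, timeL2]
    | insert a s ha ih =>
      simp_rw [Finset.sum_insert ha]
      refine (znorm_add_le (hm a) ?_).trans_lt (ENNReal.add_lt_top.2 ⟨h a, ih⟩)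
      exact Finset.measurable_fun_sum s fun a _ => hm a
  refine lt_of_le_of_lt (znorm_mono ?_) (key Finset.univ)
  refine Eventually.of_forall fun t => Eventually.of_forall fun ξ => enorm_pi_le fun a => ?_
  exact Finset.single_le_sum (f := fun a => ‖v t ξ a‖ₑ) (fun _ _ => zero_le) (Finset.mem_univ a)

/-- Uniqueness in the class `X^α`. -/
theorem IsFreqSolution.eq_of_isSolution (hψ : IsDyadicPartition ψ) (h : IsFreqSolution ψ g v)
    {α : ℝ} (h0 : 0 < α) (h1 : α < 1) {V : ℝ → VField} (hV : IsSolution ψ α (toField v 0) V)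
    {s : ℝ} (hs : 0 ≤ s) : V s = toField v s := by
  obtain ⟨v₀, u, hv₀, hu, hum, -, hueq⟩ := hV.mild
  have hv₀g : v₀ =ᵐ[volume] g := by
    have : ∀ a, (fun ξ => v₀ ξ a) =ᵐ[volume] fun ξ => g ξ a := fun a => by
      have h2 := h.hasFourierDensity hψ le_rfl a
      simp_rw [h.apply_zero] at h2
      exact (hv₀ a).ae_eq h2
    filter_upwards [ae_all_iff.2 this] with ξ hξ
    exact funext hξ
  -- The densities of a mild solution are only almost everywhere measurable in `(t, ξ)`. A
  -- measurable version is chosen first.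
  let u' : ℝ → E3 → Idx → ℂ := fun t ξ => hum.mk _ (t, ξ)
  have hu'm : Measurable (Function.uncurry u') := hum.stronglyMeasurable_mk.measurable
  have huu' : ∀ᵐ t ∂timeMeasure, u t =ᵐ[volume] u' t := Measure.ae_ae_of_ae_prod hum.ae_eq_mk
  have hblk : ∀ᵐ t ∂timeMeasure, ∀ a j, distLpNorm 1 (fourierD (dyadicBlock ψ j (V t a))) =
      blk ψ j fun ξ => ‖u' t ξ a‖ₑ := by
    filter_upwards [huu', ae_timeMeasure_pos] with t ht ht0 a j
    rw [distLpNorm_one_fourierD_dyadicBlock hψ (hu t ht0.le a)]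
    refine lintegral_congr_ae ?_
    filter_upwards [ht] with ξ hξ
    rw [hξ]
  have hu'z : vnorm u' < ∞ := by
    refine vnorm_lt_top_of_apply hu'm fun a => znorm_lt_top_of_mixed hψ
      ((measurable_pi_apply a).comp hu'm).enorm h0 h1 ?_ ?_
    · refine lt_of_le_of_lt (seqNorm_two_mono fun j => le_of_eq ?_) (hV.high a)
      congr 1
      refine eLpNorm_congr_ae ?_
      filter_upwards [hblk] with t ht
      exact (ht a j).symm
    · refine lt_of_le_of_lt (seqNorm_two_mono fun j => le_of_eq ?_) (hV.low a)
      congr 1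
      refine eLpNorm_congr_ae ?_
      filter_upwards [hblk] with t ht
      exact (ht a j).symm
  -- This corrected version satisfies the equation pointwise and still agrees with the given
  -- densities at every time `t ≥ 0`, for almost every `ξ`.
  let w : ℝ → E3 → Idx → ℂ := fun t ξ => linEvol g t ξ - duh u' t ξ
  have huw : ∀ t, 0 ≤ t → u t =ᵐ[volume] w t := by
    intro t ht
    filter_upwards [hueq t ht, hv₀g] with ξ hξ hξ2
    rw [hξ.2, hξ2]
    change linEvol g t ξ - duh u t ξ = linEvol g t ξ - duh u' t ξ
    rw [duh_congr huu']
  have hwu' : ∀ᵐ t ∂timeMeasure, w t =ᵐ[volume] u' t := by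
    filter_upwards [huu', ae_timeMeasure_pos] with t ht ht0
    exact (huw t ht0.le).symm.trans ht
  have hw : IsFreqSolution ψ g w :=
    { measurable_data := h.measurable_data
      measurable := (measurable_linEvol h.measurable_data).sub (measurable_duh hu'm)
      data := h.data
      vnorm_lt := (vnorm_congr hwu').trans_lt hu'z
      eq := fun t ξ => by rw [duh_congr hwu'] }
  have hvw := h.unique hw
  ext1 a
  refine ((hu s hs a).congr ?_).dist_eq (h.hasFourierDensity hψ hs a)
  filter_upwards [huw s hs] with ξ hξ
  rw [hξ, hvw]

end Uniqueness

end

section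

/-! ### Lacunary data -/

/-- The points `(3/2) 2^k e₃` around which the data are concentrated on the Fourier side. -/
def bumpCenter (k : ℕ) : E3 := EuclideanSpace.single 2 (3 / 2 * 2 ^ k)

/-- The sum of the indicator functions of the balls of radius `3` about `±(3/2) 2^k e₃`, `k ∈ s`. -/
def lacunary (s : Finset ℕ) (η : E3) : ℝ :=
  ∑ k ∈ s, ((Metric.closedBall (bumpCenter k) 3).indicator 1 η +
    (Metric.closedBall (-bumpCenter k) 3).indicator 1 η)

/-- The volume of a ball of radius `3`. -/
def ballVol : ℝ≥0∞ := volume (Metric.closedBall (0 : E3) 3)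

section Lacunary

variable {s : Finset ℕ} {k : ℕ} {η : E3} {ψ : 𝓢(E3, ℝ)}

theorem ballVol_ne_top : ballVol ≠ ∞ := measure_closedBall_lt_top.ne

theorem norm_bumpCenter (k : ℕ) : ‖bumpCenter k‖ = 3 / 2 * 2 ^ k := by
  rw [bumpCenter, PiLp.norm_single, Real.norm_of_nonneg (by positivity)]

theorem two_pow_ge (hk : 7 ≤ k) : (128 : ℝ) ≤ 2 ^ k := by
  calc (128 : ℝ) = 2 ^ 7 := by norm_num
    _ ≤ 2 ^ k := pow_le_pow_right₀ one_le_two hk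

theorem mem_closedBall_neg_bumpCenter :
    -η ∈ Metric.closedBall (bumpCenter k) 3 ↔ η ∈ Metric.closedBall (-bumpCenter k) 3 := by
  rw [mem_closedBall_iff_norm, mem_closedBall_iff_norm, ← norm_neg]
  congr! 2
  abel

theorem lacunary_neg (s : Finset ℕ) (η : E3) : lacunary s (-η) = lacunary s η := by
  refine Finset.sum_congr rfl fun k _ => ?_
  rw [add_comm]
  congr 1
  · unfold Set.indicator
    congr 1
    rw [← mem_closedBall_neg_bumpCenter, neg_neg]
  · unfold Set.indicator
    congr 1
    rw [mem_closedBall_neg_bumpCenter]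

theorem lacunary_term_nonneg (k : ℕ) (η : E3) :
    0 ≤ (Metric.closedBall (bumpCenter k) 3).indicator (1 : E3 → ℝ) η +
      (Metric.closedBall (-bumpCenter k) 3).indicator 1 η :=
  add_nonneg (Set.indicator_nonneg (fun _ _ => zero_le_one) _)
    (Set.indicator_nonneg (fun _ _ => zero_le_one) _)

theorem lacunary_nonneg (s : Finset ℕ) (η : E3) : 0 ≤ lacunary s η :=
  Finset.sum_nonneg fun k _ => lacunary_term_nonneg k η

theorem exists_mem_of_term_ne_zero
    (h : (Metric.closedBall (bumpCenter k) 3).indicator (1 : E3 → ℝ) η +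
      (Metric.closedBall (-bumpCenter k) 3).indicator 1 η ≠ 0) :
    η ∈ Metric.closedBall (bumpCenter k) 3 ∨ η ∈ Metric.closedBall (-bumpCenter k) 3 := by
  by_contra hc
  push Not at hc
  rw [Set.indicator_of_notMem hc.1, Set.indicator_of_notMem hc.2, add_zero] at h
  exact h rfl

theorem exists_mem_of_lacunary_ne_zero (h : lacunary s η ≠ 0) :
    ∃ k ∈ s, η ∈ Metric.closedBall (bumpCenter k) 3 ∨
      η ∈ Metric.closedBall (-bumpCenter k) 3 := by
  obtain ⟨k, hk, hne⟩ := Finset.exists_ne_zero_of_sum_ne_zero h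
  exact ⟨k, hk, exists_mem_of_term_ne_zero hne⟩

theorem measurable_lacunary (s : Finset ℕ) : Measurable (lacunary s) := by
  refine Finset.measurable_fun_sum s fun k _ => ?_
  exact (measurable_one.indicator Metric.isClosed_closedBall.measurableSet).add
    (measurable_one.indicator Metric.isClosed_closedBall.measurableSet)

theorem norm_of_mem_closedBall_bumpCenter (hk : 7 ≤ k)
    (h : η ∈ Metric.closedBall (bumpCenter k) 3) :
    (2 : ℝ) ^ k ≤ ‖η‖ ∧ ‖η‖ ≤ 2 * 2 ^ k := by
  rw [mem_closedBall_iff_norm] at h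
  have h1 := norm_bumpCenter k
  have h2 := two_pow_ge hk
  have h3 := norm_sub_norm_le η (bumpCenter k)
  have h4 := norm_sub_norm_le (bumpCenter k) η
  rw [norm_sub_rev] at h4
  constructor <;> linarith

theorem norm_of_mem (hk : 7 ≤ k) (h : η ∈ Metric.closedBall (bumpCenter k) 3 ∨
    η ∈ Metric.closedBall (-bumpCenter k) 3) : (2 : ℝ) ^ k ≤ ‖η‖ ∧ ‖η‖ ≤ 2 * 2 ^ k := by
  rcases h with h | h
  · exact norm_of_mem_closedBall_bumpCenter hk h
  · rw [← norm_neg]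
    exact norm_of_mem_closedBall_bumpCenter hk (mem_closedBall_neg_bumpCenter.2 h)

theorem ofReal_lacunary (s : Finset ℕ) (η : E3) : ENNReal.ofReal (lacunary s η) =
    ∑ k ∈ s, ((Metric.closedBall (bumpCenter k) 3).indicator 1 η +
      (Metric.closedBall (-bumpCenter k) 3).indicator 1 η) := by
  have hi : ∀ (t : Set E3), ENNReal.ofReal (t.indicator 1 η) = t.indicator 1 η := by
    intro t
    by_cases h : η ∈ t <;> simp [h]
  rw [lacunary, ENNReal.ofReal_sum_of_nonneg fun k _ => lacunary_term_nonneg k η]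
  refine Finset.sum_congr rfl fun k _ => ?_
  have hn : ∀ t : Set E3, 0 ≤ t.indicator (1 : E3 → ℝ) η := fun t =>
    Set.indicator_nonneg (fun _ _ => zero_le_one) _
  rw [ENNReal.ofReal_add (hn _) (hn _), hi, hi]

theorem lintegral_term (k : ℕ) :
    ∫⁻ η, ((Metric.closedBall (bumpCenter k) 3).indicator (1 : E3 → ℝ≥0∞) η +
      (Metric.closedBall (-bumpCenter k) 3).indicator 1 η) = 2 * ballVol := by
  rw [lintegral_add_left (measurable_one.indicator Metric.isClosed_closedBall.measurableSet),
    lintegral_indicator_one Metric.isClosed_closedBall.measurableSet,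
    lintegral_indicator_one Metric.isClosed_closedBall.measurableSet,
    Measure.addHaar_closedBall_center _ (bumpCenter k),
    Measure.addHaar_closedBall_center _ (-bumpCenter k), ← two_mul]
  rfl

theorem measurable_term (k : ℕ) :
    Measurable fun η => ((Metric.closedBall (bumpCenter k) 3).indicator (1 : E3 → ℝ≥0∞) η +
      (Metric.closedBall (-bumpCenter k) 3).indicator 1 η) :=
  (measurable_one.indicator Metric.isClosed_closedBall.measurableSet).add
    (measurable_one.indicator Metric.isClosed_closedBall.measurableSet)

theorem lintegral_lacunary (s : Finset ℕ) :
    ∫⁻ η, ENNReal.ofReal (lacunary s η) = s.card * (2 * ballVol) := by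
  simp_rw [ofReal_lacunary]
  rw [lintegral_finsetSum _ fun k _ => measurable_term k]
  simp_rw [lintegral_term]
  rw [Finset.sum_const, nsmul_eq_mul]

theorem IsDyadicPartition.abs_sub_le_one (hψ : IsDyadicPartition ψ) {j : ℤ} (hk : 7 ≤ k)
    (h0 : dyadicSymbol ψ j η ≠ 0) (h : η ∈ Metric.closedBall (bumpCenter k) 3 ∨
      η ∈ Metric.closedBall (-bumpCenter k) 3) : (k : ℤ) ∈ Finset.Icc (j - 1) (j + 1) := by
  have h1 := hψ.norm_of_dyadicSymbol_ne_zero h0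
  have h2 := norm_of_mem hk h
  have hj : (0 : ℝ) < 2 ^ j := by positivity
  have hk0 : (0 : ℝ) < 2 ^ (k : ℤ) := by positivity
  rw [← zpow_natCast] at h2
  have e1 : (2 : ℝ) ^ j < 2 ^ ((k : ℤ) + 2) := by
    rw [zpow_add₀ two_ne_zero]
    norm_num at *
    linarith
  have e2 : (2 : ℝ) ^ (k : ℤ) < 2 ^ (j + 2) := by
    rw [zpow_add₀ two_ne_zero]
    norm_num at *
    linarith
  have e3 := (zpow_lt_zpow_iff_right₀ one_lt_two).1 e1
  have e4 := (zpow_lt_zpow_iff_right₀ one_lt_two).1 e2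
  rw [Finset.mem_Icc]
  lia

/-- Lacunarity: a dyadic block meets at most three of the indices `k`, so the bound does not depend
on the number of bumps. -/
theorem blk_lacunary_le (hψ : IsDyadicPartition ψ) (hs : ∀ k ∈ s, 7 ≤ k) (j : ℤ) :
    blk ψ j (fun η => ENNReal.ofReal (lacunary s η)) ≤ 6 * ballVol := by
  let T := s.filter fun k : ℕ => (k : ℤ) ∈ Finset.Icc (j - 1) (j + 1)
  have hT : T.card ≤ 3 := by
    have : T.card ≤ (Finset.Icc (j - 1) (j + 1)).card :=
      Finset.card_le_card_of_injOn (fun k : ℕ => (k : ℤ))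
        (fun k hk => (Finset.mem_filter.1 hk).2) (fun a _ b _ hab => Nat.cast_injective hab)
    refine this.trans ?_
    rw [Int.card_Icc]
    lia
  calc blk ψ j (fun η => ENNReal.ofReal (lacunary s η))
      ≤ blk ψ j (fun η => ENNReal.ofReal (lacunary T η)) := by
        refine blk_mono_ae (Eventually.of_forall fun η hη => ?_)
        rw [ofReal_lacunary, ofReal_lacunary, Finset.sum_filter]
        refine Finset.sum_le_sum fun k hk => ?_
        split_ifs with hjk
        · exact le_rfl
        · rw [Set.indicator_of_notMem, Set.indicator_of_notMem, add_zero]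
          · exact fun h => hjk (hψ.abs_sub_le_one (hs k hk) hη (Or.inr h))
          · exact fun h => hjk (hψ.abs_sub_le_one (hs k hk) hη (Or.inl h))
    _ ≤ T.card * (2 * ballVol) := hψ.blk_le_lintegral.trans (lintegral_lacunary T).le
    _ ≤ 3 * (2 * ballVol) := by
        gcongr
        exact_mod_cast hT
    _ = _ := by ring

end Lacunary

/-- The Fourier transform `i a ρ(η) η × e₂` of each of the two fields of the data, where `ρ` is a
lacunary sum of indicator functions. -/
def dataVec (a : ℝ) (s : Finset ℕ) (η : E3) : Fin 3 → ℂ :=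
  ![-(Complex.I * ((a * lacunary s η * η 2 : ℝ) : ℂ)), 0,
    Complex.I * ((a * lacunary s η * η 0 : ℝ) : ℂ)]

/-- The Fourier transform of the data. -/
def dataFreq (a : ℝ) (s : Finset ℕ) (η : E3) : Idx → ℂ :=
  Sum.elim (dataVec a s η) (dataVec a s η)

section Data

variable {a : ℝ} {s : Finset ℕ} {ψ : 𝓢(E3, ℝ)}

theorem measurable_dataFreq (a : ℝ) (s : Finset ℕ) : Measurable (dataFreq a s) := by
  have h : ∀ i : Fin 3, Measurable fun η : E3 => Complex.I * ((a * lacunary s η * η i : ℝ) : ℂ) := by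
    intro i
    have hc : Measurable fun η : E3 => η i := by fun_prop
    exact (Complex.measurable_ofReal.comp
      (((measurable_lacunary s).const_mul a).mul hc)).const_mul Complex.I
  have hv : ∀ i, Measurable fun η => dataVec a s η i := by
    intro i
    fin_cases i
    · exact (h 2).neg
    · exact measurable_const
    · exact h 0
  refine measurable_pi_lambda _ fun i => ?_
  rcases i with i | i
  · exact hv i
  · exact hv i

theorem sum_mul_dataVec (a : ℝ) (s : Finset ℕ) (ξ : E3) :
    ∑ k : Fin 3, (ξ k : ℂ) * dataVec a s ξ k = 0 := by
  simp only [Fin.sum_univ_three, dataVec, Matrix.cons_val]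
  push_cast
  ring

theorem dataFreq_neg (a : ℝ) (s : Finset ℕ) (ξ : E3) :
    dataFreq a s (-ξ) = star (dataFreq a s ξ) := by
  have hv : ∀ i, dataVec a s (-ξ) i = star (dataVec a s ξ i) := by
    intro i
    fin_cases i <;> simp [dataVec, lacunary_neg]
  ext i
  rcases i with i | i
  · exact hv i
  · exact hv i

theorem norm_dataVec_le (ha : 0 ≤ a) (s : Finset ℕ) (ξ : E3) (i : Fin 3) :
    ‖dataVec a s ξ i‖ ≤ a * lacunary s ξ * ‖ξ‖ := by
  have h0 := mul_nonneg ha (lacunary_nonneg s ξ)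
  have hc : ∀ k : Fin 3, |a * lacunary s ξ * ξ k| ≤ a * lacunary s ξ * ‖ξ‖ := by
    intro k
    rw [abs_mul, abs_of_nonneg h0]
    exact mul_le_mul_of_nonneg_left (by simpa using PiLp.norm_apply_le ξ k) h0
  fin_cases i
  · simpa [dataVec, -Complex.ofReal_mul, Complex.norm_real] using hc 2
  · simpa [dataVec] using mul_nonneg h0 (norm_nonneg ξ)
  · simpa [dataVec, -Complex.ofReal_mul, Complex.norm_real] using hc 0

theorem enorm_dataFreq_le (ha : 0 ≤ a) (s : Finset ℕ) (ξ : E3) :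
    ‖dataFreq a s ξ‖ₑ ≤ ENNReal.ofReal a * ENNReal.ofReal (lacunary s ξ) * ENNReal.ofReal ‖ξ‖ := by
  rw [← ENNReal.ofReal_mul ha, ← ENNReal.ofReal_mul (mul_nonneg ha (lacunary_nonneg s ξ))]
  refine enorm_pi_le fun i => ?_
  rw [← ofReal_norm]
  refine ENNReal.ofReal_le_ofReal ?_
  rcases i with i | i
  · exact norm_dataVec_le ha s ξ i
  · exact norm_dataVec_le ha s ξ i

theorem dataFreq_ne_zero {ξ : E3} (h : dataFreq a s ξ ≠ 0) : lacunary s ξ ≠ 0 := by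
  intro h0
  refine h (funext fun i => ?_)
  rcases i with i | i
  · fin_cases i <;> simp [dataFreq, dataVec, h0]
  · fin_cases i <;> simp [dataFreq, dataVec, h0]

/-- The weighted block masses of the data. -/
def dataSeq (ψ : 𝓢(E3, ℝ)) (a : ℝ) (s : Finset ℕ) (j : ℤ) : ℝ≥0∞ :=
  3 * (ENNReal.ofReal a * blk ψ j fun η => ENNReal.ofReal (lacunary s η))

theorem two_rpow_mul_blk_dataFreq_le (hψ : IsDyadicPartition ψ) (ha : 0 ≤ a) (j : ℤ) :
    2 ^ (-(j : ℝ)) * blk ψ j (fun ξ => ‖dataFreq a s ξ‖ₑ) ≤ dataSeq ψ a s j := by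
  calc 2 ^ (-(j : ℝ)) * blk ψ j (fun ξ => ‖dataFreq a s ξ‖ₑ)
      ≤ 2 ^ (-(j : ℝ)) * blk ψ j (fun ξ => (3 * 2 ^ (j : ℝ) * ENNReal.ofReal a) *
          ENNReal.ofReal (lacunary s ξ)) := by
        refine mul_le_mul_right (blk_mono_ae (Eventually.of_forall fun ξ hξ => ?_)) _
        refine (enorm_dataFreq_le ha s ξ).trans ?_
        calc _ ≤ ENNReal.ofReal a * ENNReal.ofReal (lacunary s ξ) * (3 * 2 ^ (j : ℝ)) :=
              mul_le_mul_right (hψ.ofReal_norm_le hξ) _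
          _ = _ := by ring
    _ = 2 ^ (-(j : ℝ)) * (2 ^ (- -(j : ℝ)) * dataSeq ψ a s j) := by
        rw [blk_const_mul (ENNReal.mul_ne_top (ENNReal.mul_ne_top (by simp) (two_rpow_ne_top _))
          ENNReal.ofReal_ne_top), neg_neg, dataSeq]
        ring
    _ = _ := two_rpow_neg_mul _ _

theorem dataSeq_le (hψ : IsDyadicPartition ψ) (hs : ∀ k ∈ s, 7 ≤ k) (j : ℤ) :
    dataSeq ψ a s j ≤ 18 * ballVol * ENNReal.ofReal a := by
  calc dataSeq ψ a s j ≤ 3 * (ENNReal.ofReal a * (6 * ballVol)) := by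
        unfold dataSeq
        gcongr
        exact blk_lacunary_le hψ hs j
    _ = _ := by ring

theorem tsum_dataSeq_le (hψ : IsDyadicPartition ψ) :
    ∑' j, dataSeq ψ a s j ≤ 18 * ballVol * ENNReal.ofReal a * s.card := by
  unfold dataSeq
  rw [ENNReal.tsum_mul_left, ENNReal.tsum_mul_left,
    ← hψ.lintegral_eq_tsum_blk (measurable_lacunary s).ennreal_ofReal, lintegral_lacunary]
  calc _ = 6 * (ballVol * ENNReal.ofReal a * s.card) := by ring
    _ ≤ 18 * (ballVol * ENNReal.ofReal a * s.card) := by gcongr; norm_num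
    _ = _ := by ring

/-- The `ℓ²` size is bounded through `ℓ^∞` and `ℓ¹`. It depends on `a² · card` only, the quantity
that is kept equal to `δ²`. -/
theorem tsum_dataSeq_sq_le (hψ : IsDyadicPartition ψ) (hs : ∀ k ∈ s, 7 ≤ k) (ha : 0 ≤ a) :
    ∑' j, dataSeq ψ a s j * dataSeq ψ a s j ≤
      (18 * ballVol) ^ 2 * ENNReal.ofReal (a ^ 2 * s.card) := by
  calc ∑' j, dataSeq ψ a s j * dataSeq ψ a s j
      ≤ ∑' j, (18 * ballVol * ENNReal.ofReal a) * dataSeq ψ a s j :=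
        ENNReal.tsum_le_tsum fun j => mul_le_mul_left (dataSeq_le hψ hs j) _
    _ ≤ (18 * ballVol * ENNReal.ofReal a) * (18 * ballVol * ENNReal.ofReal a * s.card) := by
        rw [ENNReal.tsum_mul_left]
        exact mul_le_mul_right (tsum_dataSeq_le hψ) _
    _ = (18 * ballVol) ^ 2 * (ENNReal.ofReal a ^ 2 * s.card) := by ring
    _ = _ := by
        rw [ENNReal.ofReal_mul (by positivity), ENNReal.ofReal_pow ha, ENNReal.ofReal_natCast]

/-- The `ℓ^r` norm of a sequence is controlled by its `ℓ^∞` and `ℓ¹` norms. -/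
theorem seqNorm_le_of_le {b : ℤ → ℝ≥0∞} {m : ℝ≥0∞} {n : ℝ} (hn : 1 ≤ n) {r : ℝ≥0∞} (hr : 2 < r)
    (h1 : ∀ j, b j ≤ m) (h2 : ∑' j, b j ≤ m * ENNReal.ofReal n) :
    seqNorm r b ≤ m * ENNReal.ofReal (n ^ (1 / r).toReal) := by
  unfold seqNorm
  split_ifs with h
  · rw [h]
    simpa using h1
  · have hr2 : 2 < r.toReal := by
      have := (ENNReal.toReal_lt_toReal (by simp) h).2 hr
      simpa using this
    have hr0 : 0 < r.toReal := by linarith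
    have h3 : ∑' j, b j ^ r.toReal ≤ m ^ r.toReal * ENNReal.ofReal n := by
      calc ∑' j, b j ^ r.toReal = ∑' j, b j ^ (r.toReal - 1) * b j ^ (1 : ℝ) := by
            refine tsum_congr fun j => ?_
            rw [← ENNReal.rpow_add_of_nonneg _ _ (by linarith) zero_le_one, sub_add_cancel]
        _ ≤ ∑' j, m ^ (r.toReal - 1) * b j := by
            refine ENNReal.tsum_le_tsum fun j => ?_
            rw [ENNReal.rpow_one]
            exact mul_le_mul_left (ENNReal.rpow_le_rpow (h1 j) (by linarith)) _
        _ ≤ m ^ (r.toReal - 1) * (m ^ (1 : ℝ) * ENNReal.ofReal n) := by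
            rw [ENNReal.tsum_mul_left, ENNReal.rpow_one]
            exact mul_le_mul_right h2 _
        _ = _ := by
            rw [← mul_assoc, ← ENNReal.rpow_add_of_nonneg _ _ (by linarith) zero_le_one,
              sub_add_cancel]
    refine (ENNReal.rpow_le_rpow h3 (by positivity)).trans (le_of_eq ?_)
    rw [ENNReal.mul_rpow_of_nonneg _ _ (by positivity), ← ENNReal.rpow_mul,
      mul_one_div_cancel hr0.ne', ENNReal.rpow_one,
      ENNReal.ofReal_rpow_of_pos (by linarith)]
    congr 3
    rw [ENNReal.toReal_div, ENNReal.toReal_one]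

end Data

end

section

/-! ### Linear estimates for the data -/

/-- The Fourier transform of the heat evolution `e^{tΔ} f`. -/
def heatEvol (g : E3 → Idx → ℂ) (t : ℝ) (ξ : E3) : Idx → ℂ := Real.exp (-(‖ξ‖ ^ 2 * t)) • g ξ

section Linear

variable {g : E3 → Idx → ℂ} {ψ : 𝓢(E3, ℝ)}

theorem measurable_heatEvol (hg : Measurable g) : Measurable (Function.uncurry (heatEvol g)) := by
  have h1 : Measurable fun z : ℝ × E3 => Real.exp (-(‖z.2‖ ^ 2 * z.1)) := by fun_prop
  exact h1.smul (hg.comp measurable_snd)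

theorem vnorm_linEvol_le (g : E3 → Idx → ℂ) :
    vnorm (linEvol g) ≤ 3 * znorm (heatMaj fun ξ => ‖g ξ‖ₑ) := by
  rw [← znorm_const_mul (by simp)]
  refine znorm_mono ?_
  filter_upwards [ae_timeMeasure_pos] with t ht
  exact Eventually.of_forall fun ξ => enorm_linEvol_le ht.le ξ

theorem vnorm_heatEvol_le (g : E3 → Idx → ℂ) :
    vnorm (heatEvol g) ≤ znorm (heatMaj fun ξ => ‖g ξ‖ₑ) := by
  refine znorm_mono ?_
  filter_upwards [ae_timeMeasure_pos] with t ht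
  refine Eventually.of_forall fun ξ => ?_
  rw [heatEvol, heatMaj, enorm_smul, Real.enorm_eq_ofReal (Real.exp_pos _).le]
  have : 0 ≤ ‖ξ‖ ^ 2 * t := by positivity
  gcongr
  linarith

/-- When `div ω = 0` the second-order term `∇ div` drops out, and `𝓐 - |ξ|²` consists of the
first-order curl and the damping only. -/
theorem norm_linSymbol_mulVec_sub_le {ξ : E3} {x : Idx → ℂ}
    (hx : ∑ k : Fin 3, (ξ k : ℂ) * x (Sum.inr k) = 0) :
    ‖linSymbol ξ *ᵥ x - ‖ξ‖ ^ 2 • x‖ ≤ (2 * ‖ξ‖ + 2) * ‖x‖ := by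
  have hc : ∀ k : Fin 3, ‖(ξ k : ℂ)‖ ≤ ‖ξ‖ := fun k => by
    rw [Complex.norm_real]; exact PiLp.norm_apply_le ξ k
  have hxn : ∀ i, ‖x i‖ ≤ ‖x‖ := norm_le_pi_norm x
  have hcurl : ∀ (y : Fin 3 → ℂ), (∀ i, ‖y i‖ ≤ ‖x‖) → ∀ i,
      ‖(curlSymbol ξ *ᵥ y) i‖ ≤ 2 * ‖ξ‖ * ‖x‖ := by
    intro y hy i
    have h2 : ∀ (k l m n : Fin 3), ‖(ξ k : ℂ) * y l - (ξ m : ℂ) * y n‖ ≤ 2 * ‖ξ‖ * ‖x‖ := by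
      intro k l m n
      refine (norm_sub_le _ _).trans ?_
      rw [norm_mul, norm_mul]
      have e1 := mul_le_mul (hc k) (hy l) (norm_nonneg _) (norm_nonneg _)
      have e2 := mul_le_mul (hc m) (hy n) (norm_nonneg _) (norm_nonneg _)
      linarith
    have hI : ∀ z : ℂ, ‖Complex.I * z‖ = ‖z‖ := fun z => by simp
    fin_cases i
    · convert h2 2 1 1 2 using 1
      refine Eq.trans ?_ (hI _)
      congr 1
      simp [curlSymbol, Matrix.mulVec, dotProduct, Fin.sum_univ_three]
      ring
    · convert h2 0 2 2 0 using 1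
      refine Eq.trans ?_ (hI _)
      congr 1
      simp [curlSymbol, Matrix.mulVec, dotProduct, Fin.sum_univ_three]
      ring
    · convert h2 1 0 0 1 using 1
      refine Eq.trans ?_ (hI _)
      congr 1
      simp [curlSymbol, Matrix.mulVec, dotProduct, Fin.sum_univ_three]
      ring
  have hgrad : ∀ i, (gradDivSymbol ξ *ᵥ fun k => x (Sum.inr k)) i = 0 := by
    intro i
    have : (gradDivSymbol ξ *ᵥ fun k => x (Sum.inr k)) i =
        (ξ i : ℂ) * ∑ k : Fin 3, (ξ k : ℂ) * x (Sum.inr k) := by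
      rw [Finset.mul_sum]
      simp only [gradDivSymbol, Matrix.mulVec, dotProduct, Matrix.of_apply]
      exact Finset.sum_congr rfl fun k _ => by ring
    rw [this, hx, mul_zero]
  have hb : 0 ≤ (2 * ‖ξ‖ + 2) * ‖x‖ := by positivity
  refine (pi_norm_le_iff_of_nonneg hb).2 fun i => ?_
  have hxx := norm_nonneg x
  rcases i with i | i
  · have e : (linSymbol ξ *ᵥ x - ‖ξ‖ ^ 2 • x) (Sum.inl i) =
        (curlSymbol ξ *ᵥ fun k => x (Sum.inr k)) i := by
      rw [linSymbol, Matrix.fromBlocks_mulVec]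
      simp only [Pi.sub_apply, Pi.smul_apply, Sum.elim_inl, Pi.add_apply, Matrix.smul_mulVec,
        Matrix.one_mulVec, Function.comp_apply, Complex.real_smul, smul_eq_mul]
      rw [add_sub_cancel_left]
      rfl
    rw [e]
    have := hcurl (fun k => x (Sum.inr k)) (fun k => hxn _) i
    linarith
  · have e : (linSymbol ξ *ᵥ x - ‖ξ‖ ^ 2 • x) (Sum.inr i) =
        (curlSymbol ξ *ᵥ fun k => x (Sum.inl k)) i + 2 * x (Sum.inr i) := by
      have hg := hgrad i
      rw [linSymbol, Matrix.fromBlocks_mulVec]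
      simp only [Pi.sub_apply, Pi.smul_apply, Sum.elim_inr, Pi.add_apply, Matrix.smul_mulVec,
        Matrix.one_mulVec, Function.comp_apply, Complex.real_smul, smul_eq_mul, Matrix.add_mulVec]
      change _ + (_ + (gradDivSymbol ξ *ᵥ fun k => x (Sum.inr k)) i) - _ = _
      rw [hg]
      push_cast
      change (curlSymbol ξ *ᵥ fun k => x (Sum.inl k)) i + _ - _ = _
      ring
    rw [e]
    refine (norm_add_le _ _).trans ?_
    rw [norm_mul]
    have h1 := hcurl (fun k => x (Sum.inl k)) (fun k => hxn _) i
    have h2 := hxn (Sum.inr i)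
    norm_num
    linarith

theorem enorm_linEvol_sub_heatEvol_le {R : ℝ} (hR : 1 ≤ R)
    (hg : ∀ ξ, g ξ ≠ 0 → R ≤ ‖ξ‖) (hdiv : ∀ ξ, ∑ k : Fin 3, (ξ k : ℂ) * g ξ (Sum.inr k) = 0)
    {t : ℝ} (ht : 0 ≤ t) (ξ : E3) :
    ‖linEvol g t ξ - heatEvol g t ξ‖ₑ ≤
      ENNReal.ofReal (48 / R) * heatMaj (fun ξ => ‖g ξ‖ₑ) t ξ := by
  by_cases h0 : g ξ = 0
  · simp [linEvol, heatEvol, h0]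
  have hξ : R ≤ ‖ξ‖ := hg ξ h0
  have hξ0 : 0 < ‖ξ‖ := by linarith
  have h1 := norm_semigroupSymbol_sub_le ht ξ (g ξ) (sq_nonneg ‖ξ‖) le_rfl
  have h2 := norm_linSymbol_mulVec_sub_le (hdiv ξ)
  set y : ℝ := ‖ξ‖ ^ 2 / 4 * t with hy
  have hy0 : 0 ≤ y := by positivity
  have hexp : Real.exp (-(‖ξ‖ ^ 2 * t) / 2) = Real.exp (-y) * Real.exp (-y) := by
    rw [← Real.exp_add]; congr 1; rw [hy]; ring
  have hye : y * Real.exp (-y) ≤ 1 := by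
    rw [Real.exp_neg, ← div_eq_mul_inv, div_le_one (Real.exp_pos _)]
    linarith [Real.add_one_le_exp y]
  -- The difference of the two flows is of size `t |ξ|` times a decaying exponential. Half of the
  -- exponent absorbs `t|ξ|²`, through `y e^{-y} ≤ 1`, and leaves the gain `1/|ξ| ≤ 1/R`. The other
  -- half is why the majorant `heatMaj` decays only like `e^{-t|ξ|²/4}`.
  have hkey : ‖linEvol g t ξ - heatEvol g t ξ‖ ≤ 48 / R * (Real.exp (-y) * ‖g ξ‖) := by
    calc ‖linEvol g t ξ - heatEvol g t ξ‖
        ≤ 3 * t * Real.exp (-(‖ξ‖ ^ 2 * t) / 2) * ((2 * ‖ξ‖ + 2) * ‖g ξ‖) :=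
          h1.trans (mul_le_mul_of_nonneg_left h2 (by positivity))
      _ ≤ 3 * t * Real.exp (-(‖ξ‖ ^ 2 * t) / 2) * ((4 * ‖ξ‖) * ‖g ξ‖) := by
          gcongr
          linarith
      _ = 48 / ‖ξ‖ * (y * Real.exp (-y)) * (Real.exp (-y) * ‖g ξ‖) := by
          rw [hexp, hy]
          field_simp
          ring
      _ ≤ 48 / ‖ξ‖ * 1 * (Real.exp (-y) * ‖g ξ‖) := by gcongr
      _ = 48 / ‖ξ‖ * (Real.exp (-y) * ‖g ξ‖) := by ring
      _ ≤ _ := by gcongr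
  calc ‖linEvol g t ξ - heatEvol g t ξ‖ₑ = ENNReal.ofReal ‖linEvol g t ξ - heatEvol g t ξ‖ :=
        (ofReal_norm _).symm
    _ ≤ ENNReal.ofReal (48 / R * (Real.exp (-y) * ‖g ξ‖)) := ENNReal.ofReal_le_ofReal hkey
    _ = _ := by
        rw [ENNReal.ofReal_mul (by positivity), ENNReal.ofReal_mul (Real.exp_pos _).le, ofReal_norm,
          heatMaj, hy, neg_mul]

theorem vnorm_linEvol_sub_heatEvol_le {R : ℝ} (hR : 1 ≤ R)
    (hg : ∀ ξ, g ξ ≠ 0 → R ≤ ‖ξ‖) (hdiv : ∀ ξ, ∑ k : Fin 3, (ξ k : ℂ) * g ξ (Sum.inr k) = 0) :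
    vnorm (fun t ξ => linEvol g t ξ - heatEvol g t ξ) ≤
      ENNReal.ofReal (48 / R) * znorm (heatMaj fun ξ => ‖g ξ‖ₑ) := by
  rw [← znorm_const_mul ENNReal.ofReal_ne_top]
  refine znorm_mono ?_
  filter_upwards [ae_timeMeasure_pos] with t ht
  exact Eventually.of_forall fun ξ => enorm_linEvol_sub_heatEvol_le hR hg hdiv ht.le ξ

/-- The constant in the linear estimate for the data. -/
def dataConst : ℝ≥0∞ := 144 * (∑' n, geomSeq 2⁻¹ n) * ballVol

theorem dataConst_ne_top : dataConst ≠ ∞ :=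
  ENNReal.mul_ne_top (ENNReal.mul_ne_top (by simp)
    (tsum_geomSeq_lt_top (by norm_num) (by norm_num)).ne) ballVol_ne_top

theorem znorm_heatMaj_dataFreq_le (hψ : IsDyadicPartition ψ) {s : Finset ℕ} (hs : ∀ k ∈ s, 7 ≤ k)
    {a δ : ℝ} (ha : 0 ≤ a) (hδ : 0 ≤ δ) (haδ : a ^ 2 * s.card = δ ^ 2) :
    znorm (heatMaj fun ξ => ‖dataFreq a s ξ‖ₑ) ≤ dataConst * ENNReal.ofReal δ := by
  have hg : Measurable fun ξ => ‖dataFreq a s ξ‖ₑ := (measurable_dataFreq a s).enorm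
  have h1 := znorm_sq_le_of_blk hψ (measurable_heatMaj hg)
    (isParabolic_heatMaj hψ hg).lintegral_mul_le
  set D := ∑' n, geomSeq 2⁻¹ n with hD
  have hD1 : 1 ≤ D := by
    have : geomSeq 2⁻¹ 0 = 1 := by simp [geomSeq]
    rw [← this]
    exact ENNReal.le_tsum 0
  have h2 : znorm (heatMaj fun ξ => ‖dataFreq a s ξ‖ₑ) ^ 2 ≤ (dataConst * ENNReal.ofReal δ) ^ 2 := by
    calc _ ≤ D * ∑' j : ℤ, (8 * (2 ^ (-(j : ℝ)) * blk ψ j fun ξ => ‖dataFreq a s ξ‖ₑ)) *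
          (8 * (2 ^ (-(j : ℝ)) * blk ψ j fun ξ => ‖dataFreq a s ξ‖ₑ)) := h1
      _ ≤ D * (8 * 8 * ∑' j, dataSeq ψ a s j * dataSeq ψ a s j) := by
          rw [tsum_const_mul_mul_self]
          gcongr with j <;> exact two_rpow_mul_blk_dataFreq_le hψ ha _
      _ ≤ D * (8 * 8 * ((18 * ballVol) ^ 2 * ENNReal.ofReal (a ^ 2 * s.card))) := by
          gcongr
          exact tsum_dataSeq_sq_le hψ hs ha
      -- A second factor `D ≥ 1` is inserted to make the bound a perfect square, with `144 = 8 ·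
      -- 18`.
      _ ≤ (D * D) * (8 * 8 * ((18 * ballVol) ^ 2 * ENNReal.ofReal (δ ^ 2))) := by
          rw [haδ]
          gcongr
          exact le_mul_of_one_le_left zero_le hD1
      _ = _ := by
          rw [ENNReal.ofReal_pow hδ, dataConst, ← hD]
          ring
  exact (ENNReal.pow_le_pow_left_iff two_ne_zero).1 h2

end Linear

end

section

/-! ### The resonant interaction -/

/-- The functional `x ↦ Im (ξ₂ x₁ - ξ₁ x₂)`, applied to the fields selected by `e`; it does not see
gradients. -/
def testFun (e : Fin 3 → Idx) (ξ : E3) : (Idx → ℂ) →L[ℝ] ℝ :=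
  Complex.imCLM.comp (((ξ 1 : ℂ) • ContinuousLinearMap.proj (R := ℂ) (φ := fun _ : Idx => ℂ) (e 0) -
    (ξ 0 : ℂ) • ContinuousLinearMap.proj (e 1)).restrictScalars ℝ)

theorem testFun_apply (e : Fin 3 → Idx) (ξ : E3) (x : Idx → ℂ) :
    testFun e ξ x = ((ξ 1 : ℂ) * x (e 0) - (ξ 0 : ℂ) * x (e 1)).im := by
  simp [testFun]

/-- The Leray projection subtracts a multiple of `ξ`, on which this component of the curl vanishes.
With equal fields in both slots, `u` and `ω` therefore give the same value. -/
theorem testFun_nonlinearity {w : E3 → Idx → ℂ} {c : E3 → Fin 3 → ℂ}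
    (hl : ∀ η k, w η (Sum.inl k) = c η k) (hr : ∀ η k, w η (Sum.inr k) = c η k)
    {e : Fin 3 → Idx} (he : e = Sum.inl ∨ e = Sum.inr) (ξ : E3) :
    testFun e ξ (nonlinearity w ξ) =
      ((ξ 1 : ℂ) * divTensor (fun k η => c η k) (fun k η => c η k) ξ 0 -
        (ξ 0 : ℂ) * divTensor (fun k η => c η k) (fun k η => c η k) ξ 1).im := by
  rw [testFun_apply]
  unfold nonlinearity
  simp only [hl, hr]
  set D := divTensor (fun k η => c η k) (fun k η => c η k) ξ
  congr 1
  rcases he with rfl | rfl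
  · simp only [Sum.elim_inl, Matrix.mulVec, dotProduct, leraySymbol, Matrix.of_apply,
      Fin.sum_univ_three]
    simp only [Fin.isValue, zero_ne_one, Fin.reduceEq, if_true, if_false, one_ne_zero]
    ring
  · simp only [Sum.elim_inr]

section Interaction

variable {a τ : ℝ} {s : Finset ℕ} {ξ η : E3}

/-- The amplitude of the heat evolution of the data. -/
def amplitude (a τ : ℝ) (s : Finset ℕ) (η : E3) : ℝ :=
  Real.exp (-(‖η‖ ^ 2 * τ)) * (a * lacunary s η)

/-- The integrand of the interaction. -/
def interaction (a τ : ℝ) (s : Finset ℕ) (ξ η : E3) : ℝ :=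
  amplitude a τ s (ξ - η) * amplitude a τ s η * (ξ 1 * (η 2 * (ξ 0 * η 2 - ξ 2 * η 0)))

theorem heatEvol_dataFreq_inl (a τ : ℝ) (s : Finset ℕ) (η : E3) (k : Fin 3) :
    heatEvol (dataFreq a s) τ η (Sum.inl k) =
      (Real.exp (-(‖η‖ ^ 2 * τ)) • dataVec a s η) k := rfl

theorem heatEvol_dataFreq_inr (a τ : ℝ) (s : Finset ℕ) (η : E3) (k : Fin 3) :
    heatEvol (dataFreq a s) τ η (Sum.inr k) =
      (Real.exp (-(‖η‖ ^ 2 * τ)) • dataVec a s η) k := rfl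

theorem smul_dataVec (a τ : ℝ) (s : Finset ℕ) (η : E3) :
    Real.exp (-(‖η‖ ^ 2 * τ)) • dataVec a s η =
      ![-(Complex.I * ((amplitude a τ s η * η 2 : ℝ) : ℂ)), 0,
        Complex.I * ((amplitude a τ s η * η 0 : ℝ) : ℂ)] := by
  ext i
  fin_cases i
  · simp [dataVec, amplitude, -Complex.ofReal_exp]; ring
  · simp [dataVec]
  · simp [dataVec, amplitude, -Complex.ofReal_exp]; ring

/-- The component of index `1` of the data is zero, so only two products survive. Their terms in
`ξ₀ξ₂` cancel, which leaves the factor `ξ₁ η₂ (ξ₀η₂ - ξ₂η₀)`. -/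
theorem testFun_nonlinearity_heatEvol {e : Fin 3 → Idx} (he : e = Sum.inl ∨ e = Sum.inr)
    (hi : ∀ k l : Fin 3, Integrable fun η => heatEvol (dataFreq a s) τ (ξ - η) (Sum.inl k) *
      heatEvol (dataFreq a s) τ η (Sum.inl l)) :
    Integrable (interaction a τ s ξ) ∧
      testFun e ξ (nonlinearity (heatEvol (dataFreq a s) τ) ξ) =
        ((2 * Real.pi) ^ 3)⁻¹ * ∫ η, interaction a τ s ξ η := by
  set c : E3 → Fin 3 → ℂ := fun η => Real.exp (-(‖η‖ ^ 2 * τ)) • dataVec a s η with hc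
  have hi' : ∀ k l : Fin 3, Integrable fun η => c (ξ - η) k * c η l := hi
  have c0 : ∀ η, c η 0 = -(Complex.I * ((amplitude a τ s η * η 2 : ℝ) : ℂ)) := fun η => by
    rw [hc]; simp only; rw [smul_dataVec]; rfl
  have c1 : ∀ η, c η 1 = 0 := fun η => by
    rw [hc]; simp only; rw [smul_dataVec]; rfl
  have c2 : ∀ η, c η 2 = Complex.I * ((amplitude a τ s η * η 0 : ℝ) : ℂ) := fun η => by
    rw [hc]; simp only; rw [smul_dataVec]; rfl
  have hint : ∀ η, ((interaction a τ s ξ η : ℝ) : ℂ) =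
      (ξ 0 : ℂ) * (ξ 1 : ℂ) * (c (ξ - η) 0 * c η 0) +
        (ξ 1 : ℂ) * (ξ 2 : ℂ) * (c (ξ - η) 2 * c η 0) := by
    intro η
    rw [c0, c0, c2, interaction]
    simp only [PiLp.sub_apply]
    push_cast
    ring_nf
    rw [Complex.I_sq]
    ring
  have hI : Integrable fun η => ((interaction a τ s ξ η : ℝ) : ℂ) := by
    simp_rw [hint]
    exact ((hi' 0 0).const_mul _).add ((hi' 2 0).const_mul _)
  refine ⟨by simpa using hI.re, ?_⟩
  rw [testFun_nonlinearity (c := c) (heatEvol_dataFreq_inl a τ s) (heatEvol_dataFreq_inr a τ s) he]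
  have hz : ∀ k, fourierProd (fun η => c η k) (fun η => c η 1) ξ = 0 := fun k => by
    simp [fourierProd, c1]
  have hz' : ∀ l, fourierProd (fun η => c η 1) (fun η => c η l) ξ = 0 := fun l => by
    simp [fourierProd, c1]
  have e1 : (ξ 1 : ℂ) * divTensor (fun k η => c η k) (fun k η => c η k) ξ 0 -
        (ξ 0 : ℂ) * divTensor (fun k η => c η k) (fun k η => c η k) ξ 1 =
      Complex.I * ((((2 * Real.pi) ^ 3)⁻¹ * ∫ η, interaction a τ s ξ η : ℝ) : ℂ) := by
    simp only [divTensor, Fin.sum_univ_three, hz, hz']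
    rw [Complex.ofReal_mul, ← integral_complex_ofReal]
    simp_rw [hint]
    rw [integral_add ((hi' 0 0).const_mul _) ((hi' 2 0).const_mul _), integral_const_mul,
      integral_const_mul, fourierProd, fourierProd]
    push_cast
    ring
  rw [e1, Complex.I_mul_im, Complex.ofReal_re]

theorem apply_bounds_of_mem {k : ℕ} (hk : 7 ≤ k)
    (h : η ∈ Metric.closedBall (bumpCenter k) 3 ∨ η ∈ Metric.closedBall (-bumpCenter k) 3) :
    |η 0| ≤ 3 ∧ (2 : ℝ) ^ k ≤ |η 2| := by
  have h2 := two_pow_ge hk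
  have key : ∀ ζ : E3, ζ ∈ Metric.closedBall (bumpCenter k) 3 →
      |ζ 0| ≤ 3 ∧ (2 : ℝ) ^ k ≤ |ζ 2| := by
    intro ζ hζ
    rw [mem_closedBall_iff_norm] at hζ
    have e0 := (PiLp.norm_apply_le (ζ - bumpCenter k) 0).trans hζ
    have e2 := (PiLp.norm_apply_le (ζ - bumpCenter k) 2).trans hζ
    simp only [PiLp.sub_apply, bumpCenter, PiLp.single_apply, Fin.isValue, Fin.reduceEq, if_false,
      if_true, Real.norm_eq_abs, sub_zero] at e0 e2
    refine ⟨by simpa using e0, ?_⟩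
    have := (abs_le.1 e2).1
    have h3 := le_abs_self (ζ 2)
    linarith
  rcases h with h | h
  · exact key η h
  · have := key (-η) (mem_closedBall_neg_bumpCenter.2 h)
    simpa using this

/-- The frequencies at which the interaction is tested. -/
def testRegion : Set E3 := {ξ | 1 / 2 ≤ ξ 0 ∧ 1 / 2 ≤ ξ 1 ∧ ‖ξ‖ ≤ 2}

/-- The leading term `ξ₀ξ₁η₂²` is at least `η₂²/4` and beats the correction, since `|η₂| ≥ 128`
while `η₀` and `ξ₂` stay bounded. Its sign does not depend on that of `η₂`, so a bump, its
reflection and all the scales reinforce each other. -/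
theorem interaction_factor_ge (hξ : ξ ∈ testRegion) {k : ℕ} (hk : 7 ≤ k)
    (h : η ∈ Metric.closedBall (bumpCenter k) 3 ∨ η ∈ Metric.closedBall (-bumpCenter k) 3) :
    4 ^ k / 8 ≤ ξ 1 * (η 2 * (ξ 0 * η 2 - ξ 2 * η 0)) := by
  obtain ⟨h0, h1, hn⟩ := hξ
  obtain ⟨b0, b2⟩ := apply_bounds_of_mem hk h
  have h128 := two_pow_ge hk
  have hξ2 : |ξ 2| ≤ 2 := (by simpa using PiLp.norm_apply_le ξ 2 : |ξ 2| ≤ ‖ξ‖).trans hn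
  have e4 : (4 : ℝ) ^ k = 2 ^ k * 2 ^ k := by rw [← mul_pow]; norm_num
  have hc : η 2 * (ξ 2 * η 0) ≤ |η 2| * 6 := by
    calc η 2 * (ξ 2 * η 0) ≤ |η 2 * (ξ 2 * η 0)| := le_abs_self _
      _ = |η 2| * (|ξ 2| * |η 0|) := by rw [abs_mul, abs_mul]
      _ ≤ |η 2| * (2 * 3) := by gcongr
      _ = _ := by ring
  have hsq : η 2 * η 2 = |η 2| * |η 2| := (abs_mul_abs_self _).symm
  set y := |η 2|
  have hy : 128 ≤ y := h128.trans b2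
  have hmain : y * y / 4 ≤ η 2 * (ξ 0 * η 2 - ξ 2 * η 0) := by
    have : η 2 * (ξ 0 * η 2 - ξ 2 * η 0) = ξ 0 * (y * y) - η 2 * (ξ 2 * η 0) := by
      rw [← hsq]; ring
    rw [this]
    nlinarith
  have hyy : (4 : ℝ) ^ k ≤ y * y := by
    rw [e4]
    exact mul_le_mul b2 b2 (by positivity) (by positivity)
  have hpos : 0 ≤ y * y / 4 := by positivity
  nlinarith

theorem amplitude_nonneg (ha : 0 ≤ a) (η : E3) : 0 ≤ amplitude a τ s η :=
  mul_nonneg (Real.exp_pos _).le (mul_nonneg ha (lacunary_nonneg s η))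

/-- The contribution of the `k`-th bump to the interaction is bounded below by this function. -/
def bumpLower (τ : ℝ) (k : ℕ) : ℝ := Real.exp (-(8 * 4 ^ k * τ)) * (4 ^ k / 8)

theorem one_le_lacunary {k : ℕ} (hk : k ∈ s) (h : η ∈ Metric.closedBall (bumpCenter k) 3 ∨
    η ∈ Metric.closedBall (-bumpCenter k) 3) : 1 ≤ lacunary s η := by
  refine le_trans ?_ (Finset.single_le_sum (fun k _ => lacunary_term_nonneg k η) hk)
  have hn : ∀ t : Set E3, 0 ≤ t.indicator (1 : E3 → ℝ) η := fun t =>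
    Set.indicator_nonneg (fun _ _ => zero_le_one) _
  rcases h with h | h
  · rw [Set.indicator_of_mem h, Pi.one_apply]
    exact le_add_of_nonneg_right (hn _)
  · rw [Set.indicator_of_mem h (f := (1 : E3 → ℝ)), Pi.one_apply]
    exact le_add_of_nonneg_left (hn _)

/-- For each `k` only the pairs with `η` near one centre and `ξ - η` near the opposite one are kept.
All the other contributions are nonnegative. The radius `3` of the bumps is `1 + 2`: if `η` is
within `1` of its centre and `|ξ| ≤ 2`, then `ξ - η` lies in the reflected bump. -/
theorem interaction_ge (ha : 0 ≤ a) (hτ : 0 ≤ τ) (hs : ∀ k ∈ s, 7 ≤ k) (hξ : ξ ∈ testRegion)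
    (η : E3) :
    ∑ k ∈ s, (Metric.closedBall (bumpCenter k) 1).indicator (fun _ => a ^ 2 * bumpLower τ k) η ≤
      interaction a τ s ξ η := by
  have e : interaction a τ s ξ η = ∑ k ∈ s,
      ((Metric.closedBall (bumpCenter k) 3).indicator (1 : E3 → ℝ) η +
        (Metric.closedBall (-bumpCenter k) 3).indicator 1 η) *
      (a * amplitude a τ s (ξ - η) * Real.exp (-(‖η‖ ^ 2 * τ)) *
        (ξ 1 * (η 2 * (ξ 0 * η 2 - ξ 2 * η 0)))) := by
    rw [← Finset.sum_mul, interaction]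
    change _ = lacunary s η * _
    rw [show amplitude a τ s η = Real.exp (-(‖η‖ ^ 2 * τ)) * (a * lacunary s η) from rfl]
    ring
  rw [e]
  refine Finset.sum_le_sum fun k hk => ?_
  have hk7 := hs k hk
  have h128 := two_pow_ge hk7
  have hamp : 0 ≤ a * amplitude a τ s (ξ - η) * Real.exp (-(‖η‖ ^ 2 * τ)) :=
    mul_nonneg (mul_nonneg ha (amplitude_nonneg ha _)) (Real.exp_pos _).le
  have h4 : (0 : ℝ) ≤ 4 ^ k / 8 := by positivity
  by_cases h1 : η ∈ Metric.closedBall (bumpCenter k) 1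
  · have h3 : η ∈ Metric.closedBall (bumpCenter k) 3 :=
      Metric.closedBall_subset_closedBall (by norm_num) h1
    have hξη : ξ - η ∈ Metric.closedBall (-bumpCenter k) 3 := by
      rw [mem_closedBall_iff_norm] at h1 ⊢
      calc ‖ξ - η - -bumpCenter k‖ = ‖ξ - (η - bumpCenter k)‖ := by congr 1; abel
        _ ≤ ‖ξ‖ + ‖η - bumpCenter k‖ := norm_sub_le _ _
        _ ≤ 2 + 1 := add_le_add hξ.2.2 h1
        _ = 3 := by norm_num
    have hf := interaction_factor_ge hξ hk7 (Or.inl h3)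
    have hn1 := (norm_of_mem hk7 (Or.inl h3)).2
    have hn2 := (norm_of_mem hk7 (Or.inr hξη)).2
    have hsq : ∀ ζ : E3, ‖ζ‖ ≤ 2 * 2 ^ k → ‖ζ‖ ^ 2 ≤ 4 * 4 ^ k := by
      intro ζ hζ
      calc ‖ζ‖ ^ 2 ≤ (2 * 2 ^ k) ^ 2 := pow_le_pow_left₀ (norm_nonneg _) hζ 2
        _ = 4 * 4 ^ k := by rw [mul_pow, ← pow_mul, mul_comm k 2, pow_mul]; norm_num
    have hexp : Real.exp (-(8 * 4 ^ k * τ)) ≤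
        Real.exp (-(‖ξ - η‖ ^ 2 * τ)) * Real.exp (-(‖η‖ ^ 2 * τ)) := by
      rw [← Real.exp_add, Real.exp_le_exp]
      have e1 := mul_le_mul_of_nonneg_right (hsq _ hn1) hτ
      have e2 := mul_le_mul_of_nonneg_right (hsq _ hn2) hτ
      linarith
    have hone : 1 ≤ (Metric.closedBall (bumpCenter k) 3).indicator (1 : E3 → ℝ) η +
        (Metric.closedBall (-bumpCenter k) 3).indicator 1 η := by
      rw [Set.indicator_of_mem h3, Pi.one_apply]
      exact le_add_of_nonneg_right (Set.indicator_nonneg (fun _ _ => zero_le_one) _)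
    have hl := one_le_lacunary hk (Or.inr hξη)
    rw [Set.indicator_of_mem h1]
    calc a ^ 2 * bumpLower τ k
        = a * a * Real.exp (-(8 * 4 ^ k * τ)) * (4 ^ k / 8) := by rw [bumpLower]; ring
      _ ≤ a * a * (Real.exp (-(‖ξ - η‖ ^ 2 * τ)) * Real.exp (-(‖η‖ ^ 2 * τ))) * (4 ^ k / 8) := by
          gcongr
      _ = a * (Real.exp (-(‖ξ - η‖ ^ 2 * τ)) * (a * 1)) * Real.exp (-(‖η‖ ^ 2 * τ)) *
            (4 ^ k / 8) := by ring
      _ ≤ a * amplitude a τ s (ξ - η) * Real.exp (-(‖η‖ ^ 2 * τ)) * (4 ^ k / 8) := by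
          unfold amplitude
          gcongr
      _ ≤ a * amplitude a τ s (ξ - η) * Real.exp (-(‖η‖ ^ 2 * τ)) *
            (ξ 1 * (η 2 * (ξ 0 * η 2 - ξ 2 * η 0))) := mul_le_mul_of_nonneg_left hf hamp
      _ ≤ _ := le_mul_of_one_le_left (mul_nonneg hamp (h4.trans hf)) hone
  · rw [Set.indicator_of_notMem h1]
    by_cases h0 : (Metric.closedBall (bumpCenter k) 3).indicator (1 : E3 → ℝ) η +
        (Metric.closedBall (-bumpCenter k) 3).indicator 1 η = 0
    · rw [h0, zero_mul]
    · exact mul_nonneg (lacunary_term_nonneg k η) (mul_nonneg hamp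
        (h4.trans (interaction_factor_ge hξ hk7 (exists_mem_of_term_ne_zero h0))))

/-- The volume of the unit ball. -/
def unitVol : ℝ := volume.real (Metric.closedBall (0 : E3) 1)

theorem unitVol_pos : 0 < unitVol :=
  ENNReal.toReal_pos (Metric.measure_closedBall_pos volume 0 one_pos).ne'
    measure_closedBall_lt_top.ne

theorem integral_interaction_ge (ha : 0 ≤ a) (hτ : 0 ≤ τ) (hs : ∀ k ∈ s, 7 ≤ k)
    (hξ : ξ ∈ testRegion) (hi : Integrable (interaction a τ s ξ)) :
    a ^ 2 * unitVol * ∑ k ∈ s, bumpLower τ k ≤ ∫ η, interaction a τ s ξ η := by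
  have hint : ∀ k, Integrable ((Metric.closedBall (bumpCenter k) 1).indicator
      (fun _ : E3 => a ^ 2 * bumpLower τ k)) := fun k =>
    (integrable_indicator_iff Metric.isClosed_closedBall.measurableSet).2
      (integrableOn_const measure_closedBall_lt_top.ne)
  refine le_trans (le_of_eq ?_) (integral_mono (integrable_finsetSum s fun k _ => hint k) hi
    (interaction_ge ha hτ hs hξ))
  rw [integral_finsetSum s fun k _ => hint k, Finset.mul_sum]
  refine Finset.sum_congr rfl fun k _ => ?_
  rw [integral_indicator_const _ Metric.isClosed_closedBall.measurableSet, smul_eq_mul,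
    measureReal_def, Measure.addHaar_closedBall_center, unitVol, measureReal_def]
  ring

theorem integrableOn_bumpLower (t : ℝ) (k : ℕ) :
    IntegrableOn (fun τ => bumpLower τ k) (Set.Ioc 0 t) := by
  have hc : Continuous fun τ => bumpLower τ k := by unfold bumpLower; fun_prop
  exact (hc.integrableOn_Icc (a := 0) (b := t)).mono_set Set.Ioc_subset_Icc_self

/-- After the time `4^{-k}` the interaction of the `k`-th bump has saturated: the integral is `(1 -
e^{-8·4^k t})/64`, and the exponential is at most `1/2`. The factor `4^k` is consumed by the time
integration, so all scales count equally. -/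
theorem integral_bumpLower_ge {t : ℝ} {k : ℕ} (ht : 0 ≤ t) (hk : 1 ≤ 4 ^ k * t) :
    1 / 128 ≤ ∫ τ in Set.Ioc 0 t, bumpLower τ k := by
  have hd : ∀ τ : ℝ, HasDerivAt (fun τ : ℝ => -(1 / 64) * Real.exp (-(8 * 4 ^ k * τ)))
      (bumpLower τ k) τ := by
    intro τ
    have h1 : HasDerivAt (fun τ : ℝ => -(8 * 4 ^ k * τ)) (-(8 * 4 ^ k)) τ := by
      have h := ((hasDerivAt_id τ).const_mul (8 * 4 ^ k : ℝ)).fun_neg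
      rwa [mul_one] at h
    refine (h1.exp.const_mul (-(1 / 64))).congr_deriv ?_
    unfold bumpLower
    ring
  have hc : Continuous fun τ => bumpLower τ k := by unfold bumpLower; fun_prop
  rw [← intervalIntegral.integral_of_le ht,
    intervalIntegral.integral_eq_sub_of_hasDerivAt (fun τ _ => hd τ)
      (hc.intervalIntegrable _ _)]
  simp only [mul_zero, neg_zero, Real.exp_zero]
  have h2 : Real.exp (-(8 * 4 ^ k * t)) ≤ 1 / 2 := by
    rw [Real.exp_neg, one_div]
    refine inv_anti₀ two_pos ?_
    linarith [Real.add_one_le_exp (8 * 4 ^ k * t)]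
  linarith

/-- Lower bound for the resonant interaction. -/
theorem testFun_integral_nonlinearity_ge (ha : 0 ≤ a) (hs : ∀ k ∈ s, 7 ≤ k)
    {e : Fin 3 → Idx} (he : e = Sum.inl ∨ e = Sum.inr) (hξ : ξ ∈ testRegion) {t : ℝ} (ht : 0 ≤ t)
    (hst : ∀ k ∈ s, 1 ≤ 4 ^ k * t)
    (hfin : ∫⁻ τ, conv (fun η => ‖heatEvol (dataFreq a s) τ η‖ₑ)
      (fun η => ‖heatEvol (dataFreq a s) τ η‖ₑ) ξ ∂timeMeasure < ∞) :
    ((2 * Real.pi) ^ 3)⁻¹ * (unitVol / 128) * (a ^ 2 * s.card) ≤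
      testFun e ξ (∫ τ in Set.Ioc 0 t, nonlinearity (heatEvol (dataFreq a s) τ) ξ) := by
  have hm := measurable_heatEvol (measurable_dataFreq a s)
  have hS := measurable_enorm_vec hm
  have hN := (integrableOn_nonlinearity hm hS (fun _ _ => le_rfl) hfin).mono_set
    (Set.Ioc_subset_Ioi_self : Set.Ioc 0 t ⊆ Set.Ioi 0)
  have hV := unitVol_pos
  rw [← (testFun e ξ).integral_comp_comm hN]
  have hlow : IntegrableOn (fun τ => ((2 * Real.pi) ^ 3)⁻¹ *
      (a ^ 2 * unitVol * ∑ k ∈ s, bumpLower τ k)) (Set.Ioc 0 t) :=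
    ((integrable_finsetSum s fun k _ => integrableOn_bumpLower t k).const_mul _).const_mul _
  refine le_trans ?_ (integral_mono_ae hlow ((testFun e ξ).integrable_comp hN) ?_)
  · rw [integral_const_mul, integral_const_mul,
      integral_finsetSum s fun k _ => integrableOn_bumpLower t k]
    have h1 : (s.card : ℝ) * (1 / 128) ≤ ∑ k ∈ s, ∫ τ in Set.Ioc 0 t, bumpLower τ k := by
      rw [← nsmul_eq_mul]
      exact Finset.card_nsmul_le_sum s _ _ fun k hk => integral_bumpLower_ge ht (hst k hk)
    calc _ = ((2 * Real.pi) ^ 3)⁻¹ * (a ^ 2 * unitVol * ((s.card : ℝ) * (1 / 128))) := by ring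
      _ ≤ _ := by gcongr
  · have h1 : ∀ᵐ τ ∂(volume.restrict (Set.Ioc 0 t)),
        conv (fun η => ‖heatEvol (dataFreq a s) τ η‖ₑ)
          (fun η => ‖heatEvol (dataFreq a s) τ η‖ₑ) ξ < ∞ :=
      ae_restrict_of_ae_restrict_of_subset Set.Ioc_subset_Ioi_self
        (ae_conv_lt_top (S := fun τ η => ‖heatEvol (dataFreq a s) τ η‖ₑ) hS hfin)
    filter_upwards [h1, ae_restrict_mem measurableSet_Ioc] with τ hτ hτ0
    have hms : ∀ k : Fin 3, Measurable fun η => heatEvol (dataFreq a s) τ η (Sum.inl k) := fun k =>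
      (measurable_pi_apply _).comp hm.of_uncurry_left
    obtain ⟨hi, heq⟩ := testFun_nonlinearity_heatEvol (a := a) (τ := τ) (s := s) (ξ := ξ) he
      fun k l => integrable_conv_integrand (hms k) (hms l) (fun η => enorm_apply_le _ _)
        (fun η => enorm_apply_le _ _) hτ
    rw [heq]
    refine mul_le_mul_of_nonneg_left (integral_interaction_ge ha hτ0.1.le hs hξ hi) (by positivity)

end Interaction

end

section

/-! ### Perturbation of the resonant interaction -/

theorem exists_norm_linSymbol_mulVec_le :
    ∃ L : ℝ, 0 ≤ L ∧ ∀ ξ : E3, ‖ξ‖ ≤ 2 → ∀ x, ‖linSymbol ξ *ᵥ x‖ ≤ L * ‖x‖ := by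
  have hc : Continuous fun ξ => ∑ i, ∑ j, ‖linSymbol ξ i j‖ :=
    continuous_finsetSum _ fun i _ => continuous_finsetSum _ fun j _ =>
      (continuous_linSymbol.matrix_elem i j).norm
  obtain ⟨L, hL⟩ := (isCompact_closedBall (0 : E3) 2).exists_bound_of_continuousOn hc.continuousOn
  refine ⟨max L 0, le_max_right _ _, fun ξ hξ x => ?_⟩
  have h1 := hL ξ (mem_closedBall_zero_iff.2 hξ)
  have hL0 : 0 ≤ max L 0 * ‖x‖ := mul_nonneg (le_max_right _ _) (norm_nonneg _)
  refine (pi_norm_le_iff_of_nonneg hL0).2 fun i => ?_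
  calc ‖(linSymbol ξ *ᵥ x) i‖ ≤ ∑ j, ‖linSymbol ξ i j * x j‖ :=
        norm_sum_le Finset.univ fun j => linSymbol ξ i j * x j
    _ ≤ ∑ j, ‖linSymbol ξ i j‖ * ‖x‖ := by
        refine Finset.sum_le_sum fun j _ => ?_
        rw [norm_mul]
        exact mul_le_mul_of_nonneg_left (norm_le_pi_norm x j) (norm_nonneg _)
    _ = (∑ j, ‖linSymbol ξ i j‖) * ‖x‖ := (Finset.sum_mul _ _ _).symm
    _ ≤ max L 0 * ‖x‖ := by
        refine mul_le_mul_of_nonneg_right ?_ (norm_nonneg _)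
        refine le_trans ?_ (le_max_left _ _)
        refine le_trans ?_ ((le_abs_self _).trans h1)
        exact Finset.single_le_sum (f := fun i => ∑ j, ‖linSymbol ξ i j‖)
          (fun i _ => Finset.sum_nonneg fun j _ => norm_nonneg _) (Finset.mem_univ i)

section Perturbation

variable {v w : ℝ → E3 → Idx → ℂ} {S : ℝ → E3 → ℝ≥0∞} {t L : ℝ} {ξ : E3}

attribute [local irreducible] semigroupSymbol nonlinearity

/-- At frequencies `|ξ| ≤ 2` the symbol `𝓐` is bounded and the semigroup is within `O(t)` of the
identity. The constant is `216 = 3 · 36 · 2`. -/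
theorem enorm_duh_sub_integral_le (hL0 : 0 ≤ L)
    (hL : ∀ ξ : E3, ‖ξ‖ ≤ 2 → ∀ x, ‖linSymbol ξ *ᵥ x‖ ≤ L * ‖x‖)
    (hw : Measurable (Function.uncurry w)) (hS : Measurable (Function.uncurry S))
    (hwS : ∀ t ξ, ‖w t ξ‖ₑ ≤ S t ξ) (hξ2 : ‖ξ‖ ≤ 2)
    (hξ : ∫⁻ τ, conv (S τ) (S τ) ξ ∂timeMeasure < ∞) (ht : 0 ≤ t) :
    ‖duh w t ξ - ∫ τ in Set.Ioc 0 t, nonlinearity (w τ) ξ‖ₑ ≤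
      ENNReal.ofReal (216 * L * t) * ∫⁻ τ, conv (S τ) (S τ) ξ ∂timeMeasure := by
  have hN := (integrableOn_nonlinearity hw hS hwS hξ).mono_set
    (Set.Ioc_subset_Ioi_self : Set.Ioc 0 t ⊆ Set.Ioi 0)
  have hD := integrableOn_duh_integrand hw hS hwS hξ t
  have hξe : ‖ξ‖ₑ ≤ 2 := by
    rw [← ofReal_norm]
    exact (ENNReal.ofReal_le_ofReal hξ2).trans (by simp)
  rw [duh, ← integral_sub hD hN, ← lintegral_const_mul' _ _ ENNReal.ofReal_ne_top]
  refine (enorm_integral_le_lintegral_enorm _).trans ?_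
  have hsub : volume.restrict (Set.Ioc 0 t) ≤ timeMeasure :=
    Measure.restrict_mono Set.Ioc_subset_Ioi_self le_rfl
  refine le_trans (lintegral_mono_ae ?_) (lintegral_mono' hsub le_rfl)
  have h1 : ∀ᵐ τ ∂(volume.restrict (Set.Ioc 0 t)), conv (S τ) (S τ) ξ < ∞ :=
    ae_restrict_of_ae_restrict_of_subset Set.Ioc_subset_Ioi_self (ae_conv_lt_top hS hξ)
  filter_upwards [h1, ae_restrict_mem measurableSet_Ioc] with τ hτ hτt
  have hSs : Measurable (S τ) := hS.comp measurable_prodMk_left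
  have hws : Measurable (w τ) := hw.comp measurable_prodMk_left
  have hn := enorm_nonlinearity_sub_le (w' := fun _ => 0) hws measurable_const
    (hwS τ) (fun η => by simp) (D := S τ) (fun η => by simpa using hwS τ η) hSs hSs hτ
  rw [nonlinearity_zero, sub_zero] at hn
  set x := nonlinearity (w τ) ξ
  have hs0 : 0 ≤ t - τ := sub_nonneg.2 hτt.2
  have h2 : ‖semigroupSymbol (t - τ) ξ *ᵥ x - x‖ ≤ 3 * t * (L * ‖x‖) := by
    have := norm_semigroupSymbol_sub_le hs0 ξ x le_rfl (sq_nonneg ‖ξ‖)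
    simp only [zero_mul, neg_zero, Real.exp_zero, one_smul, zero_div, mul_one, zero_smul,
      sub_zero] at this
    refine this.trans ?_
    have hle : t - τ ≤ t := by linarith [hτt.1]
    have := hL ξ hξ2 x
    gcongr
  calc ‖semigroupSymbol (t - τ) ξ *ᵥ x - x‖ₑ ≤ ENNReal.ofReal (3 * L * t * ‖x‖) := by
        rw [← ofReal_norm]
        exact ENNReal.ofReal_le_ofReal (h2.trans (le_of_eq (by ring)))
    _ = ENNReal.ofReal (3 * L * t) * ‖x‖ₑ := by
        rw [ENNReal.ofReal_mul (by positivity), ofReal_norm]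
    _ ≤ ENNReal.ofReal (3 * L * t) * (36 * 2 * conv (S τ) (S τ) ξ) := by
        gcongr
        refine hn.trans ?_
        gcongr
    _ = _ := by
        rw [show 216 * L * t = (36 * 2) * (3 * L * t) by ring,
          ENNReal.ofReal_mul (p := 36 * 2) (by norm_num), ENNReal.ofReal_mul (p := 36) (by norm_num)]
        simp only [ENNReal.ofReal_ofNat]
        ring

/-- The bound for the error in `duh_sub_integral_nonlinearity`. -/
def errMaj (W S : ℝ → E3 → ℝ≥0∞) (c : ℝ) (ξ : E3) : ℝ≥0∞ :=
  216 * (∫⁻ τ, conv (W τ) (S τ) ξ ∂timeMeasure) +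
    ENNReal.ofReal c * ∫⁻ τ, conv (S τ) (S τ) ξ ∂timeMeasure

/-- Two replacements are made in turn: `v` by `w` inside the Duhamel term, then the semigroup by the
identity. In the application `w` is the heat flow of the data. -/
theorem enorm_duh_sub_integral_nonlinearity_le (hL0 : 0 ≤ L)
    (hL : ∀ ξ : E3, ‖ξ‖ ≤ 2 → ∀ x, ‖linSymbol ξ *ᵥ x‖ ≤ L * ‖x‖)
    (hv : Measurable (Function.uncurry v)) (hw : Measurable (Function.uncurry w))
    (hS : Measurable (Function.uncurry S)) (hvS : ∀ t ξ, ‖v t ξ‖ₑ ≤ S t ξ)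
    (hwS : ∀ t ξ, ‖w t ξ‖ₑ ≤ S t ξ) (hξ2 : ‖ξ‖ ≤ 2)
    (hξ : ∫⁻ τ, conv (S τ) (S τ) ξ ∂timeMeasure < ∞) (ht : 0 ≤ t) :
    ‖duh v t ξ - ∫ τ in Set.Ioc 0 t, nonlinearity (w τ) ξ‖ₑ ≤
      errMaj (fun t ξ => ‖v t ξ - w t ξ‖ₑ) S (216 * L * t) ξ := by
  have hξe : ENNReal.ofReal ‖ξ‖ ≤ 2 := (ENNReal.ofReal_le_ofReal hξ2).trans (by simp)
  rw [← sub_add_sub_cancel _ (duh w t ξ)]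
  refine (enorm_add_le _ _).trans (add_le_add ?_
    (enorm_duh_sub_integral_le hL0 hL hw hS hwS hξ2 hξ ht))
  refine (duh_sub_le hv hw hS hvS hwS hξ t).trans ?_
  calc _ ≤ 108 * (2 * ∫⁻ τ, conv (fun ξ => ‖v τ ξ - w τ ξ‖ₑ) (S τ) ξ ∂timeMeasure) := by
        refine mul_le_mul_right ?_ _
        rw [← lintegral_const_mul' _ _ (by simp)]
        exact lintegral_mono fun τ => mul_le_mul_left ((heatKernel_le t τ ξ).trans hξe) _
    _ = _ := by ring

theorem measurable_lintegral_conv {A B : ℝ → E3 → ℝ≥0∞} (hA : Measurable (Function.uncurry A))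
    (hB : Measurable (Function.uncurry B)) :
    Measurable fun ξ => ∫⁻ τ, conv (A τ) (B τ) ξ ∂timeMeasure :=
  ((measurable_conv hA hB).comp measurable_swap).lintegral_prod_right'

theorem lintegral_lintegral_conv_swap_le {A B : ℝ → E3 → ℝ≥0∞}
    (hA : Measurable (Function.uncurry A)) (hB : Measurable (Function.uncurry B)) :
    ∫⁻ ξ, (∫⁻ τ, conv (A τ) (B τ) ξ ∂timeMeasure) ≤ znorm A * znorm B := by
  rw [← lintegral_lintegral_swap (measurable_conv hA hB).aemeasurable]
  exact lintegral_lintegral_conv_le hA hB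

theorem measurable_errMaj {W : ℝ → E3 → ℝ≥0∞} (hW : Measurable (Function.uncurry W))
    (hS : Measurable (Function.uncurry S)) (c : ℝ) : Measurable (errMaj W S c) :=
  ((measurable_lintegral_conv hW hS).const_mul _).add
    ((measurable_lintegral_conv hS hS).const_mul _)

theorem lintegral_errMaj_le {W : ℝ → E3 → ℝ≥0∞} (hW : Measurable (Function.uncurry W))
    (hS : Measurable (Function.uncurry S)) (c : ℝ) :
    ∫⁻ ξ, errMaj W S c ξ ≤ 216 * (znorm W * znorm S) + ENNReal.ofReal c * (znorm S * znorm S) := by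
  unfold errMaj
  have h1 := (measurable_lintegral_conv hW hS).const_mul 216
  rw [lintegral_add_left h1, lintegral_const_mul' _ _ (by simp),
    lintegral_const_mul' _ _ ENNReal.ofReal_ne_top]
  gcongr
  · exact lintegral_lintegral_conv_swap_le hW hS
  · exact lintegral_lintegral_conv_swap_le hS hS

end Perturbation

/-! ### Testing a dyadic block -/

/-- A smooth function concentrated in the test region, seen by the block `j`. -/
structure IsTestFunction (ψ : 𝓢(E3, ℝ)) (j : ℤ) (χ : E3 → ℝ) : Prop where
  contDiff : ContDiff ℝ (⊤ : ℕ∞) χ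
  hasCompactSupport : HasCompactSupport χ
  nonneg : ∀ ξ, 0 ≤ χ ξ
  le_one : ∀ ξ, χ ξ ≤ 1
  mem_testRegion : ∀ ξ, χ ξ ≠ 0 → ξ ∈ testRegion
  integral_pos : 0 < ∫ ξ, χ ξ * ψ ((2 : ℝ) ^ (-j) • ξ)

section Testing

variable {ψ : 𝓢(E3, ℝ)} {j : ℤ} {χ : E3 → ℝ}

/-- A bump around `(1, 1, 0)`, an interior point of the test region. Since the partition of unity
sums to one there, some block sees this point. -/
theorem exists_isTestFunction (hψ : IsDyadicPartition ψ) : ∃ j χ, IsTestFunction ψ j χ := by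
  let p : E3 := !₂[1, 1, 0]
  have hp : p ≠ 0 := fun h => by
    have := congrArg (fun x : E3 => x 0) h
    simp [p] at this
  have hpn : ‖p‖ ≤ 3 / 2 := by
    rw [EuclideanSpace.norm_eq, Real.sqrt_le_left (by norm_num)]
    simp [p, Fin.sum_univ_three]
    norm_num
  obtain ⟨j, hj⟩ : ∃ j : ℤ, ψ ((2 : ℝ) ^ (-j) • p) ≠ 0 := by
    by_contra hc
    push Not at hc
    have := hψ.sum_eq_one p hp
    simp_rw [hc] at this
    exact zero_ne_one (hasSum_zero.unique this)
  let b : ContDiffBump p := ⟨1 / 4, 1 / 2, by norm_num, by norm_num⟩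
  have hcψ : Continuous fun ξ : E3 => ψ ((2 : ℝ) ^ (-j) • ξ) := by fun_prop
  refine ⟨j, b, b.contDiff, b.hasCompactSupport, fun ξ => b.nonneg, fun ξ => b.le_one,
    fun ξ hξ => ?_, ?_⟩
  · have hm : ξ ∈ Metric.ball p (1 / 2) := by
      have : ξ ∈ Function.support b := hξ
      rwa [b.support_eq] at this
    rw [mem_ball_iff_norm] at hm
    have h0 := (PiLp.norm_apply_le (ξ - p) 0).trans hm.le
    have h1 := (PiLp.norm_apply_le (ξ - p) 1).trans hm.le
    simp only [PiLp.sub_apply, Real.norm_eq_abs] at h0 h1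
    have e0 : p 0 = 1 := by simp [p]
    have e1 : p 1 = 1 := by simp [p]
    rw [e0] at h0
    rw [e1] at h1
    refine ⟨by linarith [(abs_le.1 h0).1], by linarith [(abs_le.1 h1).1], ?_⟩
    linarith [norm_sub_norm_le ξ p]
  · refine (b.continuous.mul hcψ).integral_pos_of_hasCompactSupport_nonneg_nonzero
      (b.hasCompactSupport.mul_right) (fun ξ => mul_nonneg b.nonneg (hψ.nonneg _)) (x := p) ?_
    have hb1 : b p = 1 := b.one_of_mem_closedBall (Metric.mem_closedBall_self (by norm_num))
    change b p * ψ ((2 : ℝ) ^ (-j) • p) ≠ 0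
    rwa [hb1, one_mul]

theorem IsTestFunction.continuous (h : IsTestFunction ψ j χ) : Continuous χ := h.contDiff.continuous

/-- The Schwartz function `χ(ξ) ξ_i`. -/
def testSchwartz (h : IsTestFunction ψ j χ) (i : Fin 3) : 𝓢(E3, ℂ) :=
  HasCompactSupport.toSchwartzMap (f := fun ξ => ((χ ξ : ℝ) : ℂ) * ((ξ i : ℝ) : ℂ))
    ((h.hasCompactSupport.comp_left (g := fun x : ℝ => (x : ℂ)) Complex.ofReal_zero).mul_right)
    ((Complex.ofRealCLM.contDiff.comp h.contDiff).mul
      (Complex.ofRealCLM.contDiff.comp (EuclideanSpace.proj i : E3 →L[ℝ] ℝ).contDiff))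

theorem testSchwartz_apply (h : IsTestFunction ψ j χ) (i : Fin 3) (ξ : E3) :
    testSchwartz h i ξ = ((χ ξ : ℝ) : ℂ) * ((ξ i : ℝ) : ℂ) := rfl

theorem le_seqNorm {r : ℝ≥0∞} (hr : r ≠ 0) (b : ℤ → ℝ≥0∞) (j : ℤ) : b j ≤ seqNorm r b := by
  unfold seqNorm
  split_ifs with h
  · exact le_iSup b j
  · have hr0 : 0 < r.toReal := ENNReal.toReal_pos hr h
    calc b j = (b j ^ r.toReal) ^ (1 / r.toReal) := by
          rw [← ENNReal.rpow_mul, mul_one_div_cancel hr0.ne', ENNReal.rpow_one]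
      _ ≤ _ := ENNReal.rpow_le_rpow (ENNReal.le_tsum j) (by positivity)

theorem distLpNorm_dyadicBlock_le_besovNormVec {ι : Type} [Fintype ι] {r : ℝ≥0∞} (hr : r ≠ 0)
    (f : ι → Dist) (i : ι) (j : ℤ) :
    distLpNorm ∞ (dyadicBlock ψ j (f i)) ≤ 2 ^ (j : ℝ) * besovNormVec ψ (-1) ∞ r f := by
  have h1 := le_seqNorm hr
    (fun j : ℤ => (2 : ℝ≥0∞) ^ ((j : ℝ) * (-1)) * distLpNorm ∞ (dyadicBlock ψ j (f i))) j
  have h2 : besovNorm ψ (-1) ∞ r (f i) ≤ besovNormVec ψ (-1) ∞ r f :=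
    Finset.single_le_sum (f := fun i => besovNorm ψ (-1) ∞ r (f i)) (fun _ _ => zero_le)
      (Finset.mem_univ i)
  have h3 := mul_le_mul_right (h1.trans h2) ((2 : ℝ≥0∞) ^ (j : ℝ))
  rwa [mul_neg_one, two_rpow_neg_mul] at h3

/-- The constant in the lower bound of the Besov norm by a tested quantity. -/
def testConst (h : IsTestFunction ψ j χ) : ℝ≥0∞ :=
  (2 + eLpNorm (fourierS (testSchwartz h 0)) 1 volume +
    eLpNorm (fourierS (testSchwartz h 1)) 1 volume) * 2 ^ (j : ℝ)

theorem testConst_ne_top (h : IsTestFunction ψ j χ) : testConst h ≠ ∞ := by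
  have hi : ∀ i, eLpNorm (fourierS (testSchwartz h i)) 1 volume ≠ ∞ := fun i =>
    (memLp_one_iff_integrable.2 (fourierS (testSchwartz h i)).integrable).2.ne
  exact ENNReal.mul_ne_top (ENNReal.add_ne_top.2
    ⟨ENNReal.add_ne_top.2 ⟨by simp, hi 0⟩, hi 1⟩) (two_rpow_ne_top _)

theorem testConst_ne_zero (h : IsTestFunction ψ j χ) : testConst h ≠ 0 := by
  refine mul_ne_zero ?_ (two_rpow_ne_zero _)
  simp

theorem mul_testFun_eq (h : IsTestFunction ψ j χ) (e : Fin 3 → Idx) (w : E3 → Idx → ℂ) (ξ : E3) :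
    χ ξ * ψ ((2 : ℝ) ^ (-j) • ξ) * testFun e ξ (w ξ) =
      (testSchwartz h 1 ξ * (dyadicSymbol ψ j ξ * w ξ (e 0)) -
        testSchwartz h 0 ξ * (dyadicSymbol ψ j ξ * w ξ (e 1))).im := by
  rw [testFun_apply, testSchwartz_apply, testSchwartz_apply, dyadicSymbol, ← Complex.im_ofReal_mul]
  congr 1
  push_cast
  ring

theorem integrable_testSchwartz_mul (hψ : IsDyadicPartition ψ) (h : IsTestFunction ψ j χ)
    {f : Dist} {g : E3 → ℂ} (hd : HasFourierDensity f g) (i : Fin 3) :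
    Integrable fun ξ => testSchwartz h i ξ * (dyadicSymbol ψ j ξ * g ξ) := by
  have := hd.integrable_mul ((testSchwartz h i).continuous.mul (continuous_dyadicSymbol ψ j))
    ((hψ.hasCompactSupport j).mul_left)
  simpa only [Pi.mul_apply, mul_assoc] using this

/-- The tested quantity is the imaginary part of a difference of two pairings of a single dyadic
block with fixed Schwartz functions. A single block is controlled by the Besov norm for every
nonzero `r`. -/
theorem enorm_integral_testFun_le (hψ : IsDyadicPartition ψ) (h : IsTestFunction ψ j χ)
    {r : ℝ≥0∞} (hr : r ≠ 0) {e : Fin 3 → Idx} {U : VField} {w : E3 → Idx → ℂ}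
    (hd : ∀ a, HasFourierDensity (U a) fun ξ => w ξ a) :
    (Integrable fun ξ => χ ξ * ψ ((2 : ℝ) ^ (-j) • ξ) * testFun e ξ (w ξ)) ∧
      ‖∫ ξ, χ ξ * ψ ((2 : ℝ) ^ (-j) • ξ) * testFun e ξ (w ξ)‖ₑ ≤
        testConst h * besovNormVec ψ (-1) ∞ r fun k => U (e k) := by
  have h1 := integrable_testSchwartz_mul hψ h (hd (e 0)) 1
  have h0 := integrable_testSchwartz_mul hψ h (hd (e 1)) 0
  simp_rw [mul_testFun_eq h]
  refine ⟨(h1.sub h0).im, ?_⟩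
  have e1 := integral_im (h1.sub h0)
  simp only [RCLike.im_to_complex, Pi.sub_apply] at e1
  rw [e1, integral_sub h1 h0]
  set B := besovNormVec ψ (-1) ∞ r fun k => U (e k)
  have b1 := (enorm_integral_mul_dyadicSymbol_le hψ (hd (e 0)) j (testSchwartz h 1)).trans
    (mul_le_mul_right (distLpNorm_dyadicBlock_le_besovNormVec hr (fun k => U (e k)) 0 j) _)
  have b0 := (enorm_integral_mul_dyadicSymbol_le hψ (hd (e 1)) j (testSchwartz h 0)).trans
    (mul_le_mul_right (distLpNorm_dyadicBlock_le_besovNormVec hr (fun k => U (e k)) 1 j) _)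
  have him : ∀ z : ℂ, ‖z.im‖ₑ ≤ ‖z‖ₑ := fun z => by
    rw [← ofReal_norm, ← ofReal_norm]
    exact ENNReal.ofReal_le_ofReal (Complex.abs_im_le_norm z)
  refine (him _).trans (enorm_sub_le.trans ((add_le_add b1 b0).trans (le_of_eq ?_)))
  rw [testConst]
  ring

theorem abs_testFun_le {ξ : E3} (hξ : ‖ξ‖ ≤ 2) (e : Fin 3 → Idx) (x : Idx → ℂ) :
    |testFun e ξ x| ≤ 4 * ‖x‖ := by
  rw [testFun_apply]
  refine (Complex.abs_im_le_norm _).trans ((norm_sub_le _ _).trans ?_)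
  rw [norm_mul, norm_mul, Complex.norm_real, Complex.norm_real]
  have e1 := mul_le_mul ((PiLp.norm_apply_le ξ 1).trans hξ) (norm_le_pi_norm x (e 0))
    (norm_nonneg _) (by norm_num)
  have e0 := mul_le_mul ((PiLp.norm_apply_le ξ 0).trans hξ) (norm_le_pi_norm x (e 1))
    (norm_nonneg _) (by norm_num)
  linarith

end Testing

end

section

/-! ### Norm inflation -/

section Inflation

variable {ψ : 𝓢(E3, ℝ)} {j : ℤ} {χ : E3 → ℝ} {a t L : ℝ} {s : Finset ℕ} {v : ℝ → E3 → Idx → ℂ}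

/-- The constant in the lower bound for the resonant interaction. -/
def interactionConst : ℝ := ((2 * Real.pi) ^ 3)⁻¹ * (unitVol / 128)

theorem interactionConst_pos : 0 < interactionConst := by
  have := unitVol_pos
  have := Real.pi_pos
  unfold interactionConst
  positivity

theorem two_pow_le_norm_of_dataFreq_ne_zero {K : ℕ} (hK : 7 ≤ K) (hs : ∀ k ∈ s, K ≤ k) {ξ : E3}
    (h : dataFreq a s ξ ≠ 0) : (2 : ℝ) ^ K ≤ ‖ξ‖ := by
  obtain ⟨k, hk, hm⟩ := exists_mem_of_lacunary_ne_zero (dataFreq_ne_zero h)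
  exact (pow_le_pow_right₀ one_le_two (hs k hk)).trans (norm_of_mem (hK.trans (hs k hk)) hm).1

/-- The sum of the moduli of `v` and of the heat evolution of the data. -/
def modulusSum (a : ℝ) (s : Finset ℕ) (v : ℝ → E3 → Idx → ℂ) (t : ℝ) (ξ : E3) : ℝ≥0∞ :=
  ‖v t ξ‖ₑ + ‖heatEvol (dataFreq a s) t ξ‖ₑ

/-- The error in the approximation of the solution by the resonant interaction. -/
def solErr (a : ℝ) (s : Finset ℕ) (v : ℝ → E3 → Idx → ℂ) (c : ℝ) (ξ : E3) : ℝ≥0∞ :=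
  errMaj (fun t ξ => ‖v t ξ - heatEvol (dataFreq a s) t ξ‖ₑ) (modulusSum a s v) c ξ

theorem measurable_modulusSum (hv : Measurable (Function.uncurry v)) :
    Measurable (Function.uncurry (modulusSum a s v)) :=
  (measurable_enorm_vec hv).add
    (measurable_enorm_vec (measurable_heatEvol (measurable_dataFreq a s)))

theorem znorm_modulusSum_le (hv : Measurable (Function.uncurry v)) :
    znorm (modulusSum a s v) ≤ vnorm v + vnorm (heatEvol (dataFreq a s)) :=
  znorm_add_le (measurable_enorm_vec hv)
    (measurable_enorm_vec (measurable_heatEvol (measurable_dataFreq a s)))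

theorem measurable_solErr (hv : Measurable (Function.uncurry v)) (c : ℝ) :
    Measurable (solErr a s v c) :=
  measurable_errMaj (measurable_enorm_sub hv (measurable_heatEvol (measurable_dataFreq a s)))
    (measurable_modulusSum hv) c

/-- The data vanish on the test region, their frequencies being at least `128`, and so does the
linear evolution. There the solution is minus its Duhamel term, that is, minus the resonant
interaction up to the error. -/
theorem mul_testFun_solution_le (hψ : IsDyadicPartition ψ) (h : IsTestFunction ψ j χ)
    (hL0 : 0 ≤ L) (hL : ∀ ξ : E3, ‖ξ‖ ≤ 2 → ∀ x, ‖linSymbol ξ *ᵥ x‖ ≤ L * ‖x‖)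
    (ha : 0 ≤ a) (hs : ∀ k ∈ s, 7 ≤ k) (ht : 0 ≤ t) (hst : ∀ k ∈ s, 1 ≤ 4 ^ k * t)
    (hv : Measurable (Function.uncurry v))
    (heq : ∀ t ξ, v t ξ = linEvol (dataFreq a s) t ξ - duh v t ξ)
    (hS : znorm (modulusSum a s v) < ∞)
    (hfin : ∫⁻ ξ, solErr a s v (216 * L * t) ξ ≠ ∞)
    {e : Fin 3 → Idx} (he : e = Sum.inl ∨ e = Sum.inr) :
    ∀ᵐ ξ, χ ξ * ψ ((2 : ℝ) ^ (-j) • ξ) * testFun e ξ (v t ξ) ≤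
      -(χ ξ * ψ ((2 : ℝ) ^ (-j) • ξ)) * (interactionConst * (a ^ 2 * s.card)) +
        4 * (solErr a s v (216 * L * t) ξ).toReal := by
  have hmS := measurable_modulusSum (a := a) (s := s) hv
  have hmh := measurable_heatEvol (measurable_dataFreq a s)
  filter_upwards [ae_lintegral_conv_lt_top hmS hS, ae_lt_top (measurable_solErr hv _) hfin]
    with ξ hξ hξe
  by_cases hχ : χ ξ = 0
  · simp [hχ]
  have hreg := h.mem_testRegion ξ hχ
  have hconv : ∫⁻ τ, conv (fun η => ‖heatEvol (dataFreq a s) τ η‖ₑ)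
      (fun η => ‖heatEvol (dataFreq a s) τ η‖ₑ) ξ ∂timeMeasure < ∞ :=
    (lintegral_mono fun τ => conv_mono (fun _ => le_add_self) (fun _ => le_add_self) ξ).trans_lt hξ
  have hlow := testFun_integral_nonlinearity_ge (a := a) ha hs he hreg ht hst hconv
  have herr := enorm_duh_sub_integral_nonlinearity_le hL0 hL hv hmh hmS
    (fun _ _ => le_self_add) (fun _ _ => le_add_self) hreg.2.2 hξ ht
  set I := ∫ τ in Set.Ioc 0 t, nonlinearity (heatEvol (dataFreq a s) τ) ξ with hI
  have herr' : ‖duh v t ξ - I‖ ≤ (solErr a s v (216 * L * t) ξ).toReal := by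
    rw [← toReal_enorm]
    exact ENNReal.toReal_mono hξe.ne herr
  have hg0 : dataFreq a s ξ = 0 := by
    by_contra hne
    have h1 := two_pow_le_norm_of_dataFreq_ne_zero le_rfl hs hne
    have h2 := hreg.2.2
    norm_num at h1
    linarith
  have hv0 : v t ξ = -duh v t ξ := by
    rw [heq, linEvol, hg0, Matrix.mulVec_zero, zero_sub]
  have hT : testFun e ξ (v t ξ) = -testFun e ξ I - testFun e ξ (duh v t ξ - I) := by
    rw [hv0, map_neg, map_sub]
    ring
  have hab := (neg_abs_le _).trans' (neg_le_neg (abs_testFun_le hreg.2.2 e (duh v t ξ - I)))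
  have hle : testFun e ξ (v t ξ) ≤ -(interactionConst * (a ^ 2 * s.card)) +
      4 * (solErr a s v (216 * L * t) ξ).toReal := by
    rw [hT]
    unfold interactionConst
    linarith
  have hχ0 : 0 ≤ χ ξ * ψ ((2 : ℝ) ^ (-j) • ξ) := mul_nonneg (h.nonneg ξ) (hψ.nonneg _)
  have hχ1 : χ ξ * ψ ((2 : ℝ) ^ (-j) • ξ) ≤ 1 :=
    mul_le_one₀ (h.le_one ξ) (hψ.nonneg _) (hψ.le_one _)
  calc _ ≤ χ ξ * ψ ((2 : ℝ) ^ (-j) • ξ) * (-(interactionConst * (a ^ 2 * s.card)) +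
        4 * (solErr a s v (216 * L * t) ξ).toReal) := mul_le_mul_of_nonneg_left hle hχ0
    _ = -(χ ξ * ψ ((2 : ℝ) ^ (-j) • ξ)) * (interactionConst * (a ^ 2 * s.card)) +
        χ ξ * ψ ((2 : ℝ) ^ (-j) • ξ) * (4 * (solErr a s v (216 * L * t) ξ).toReal) := by ring
    _ ≤ _ := add_le_add le_rfl (mul_le_of_le_one_left (by positivity) hχ1)

theorem integral_testFun_solution_le (hψ : IsDyadicPartition ψ) (h : IsTestFunction ψ j χ)
    (hL0 : 0 ≤ L) (hL : ∀ ξ : E3, ‖ξ‖ ≤ 2 → ∀ x, ‖linSymbol ξ *ᵥ x‖ ≤ L * ‖x‖)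
    (ha : 0 ≤ a) (hs : ∀ k ∈ s, 7 ≤ k) (ht : 0 ≤ t) (hst : ∀ k ∈ s, 1 ≤ 4 ^ k * t)
    (hv : IsFreqSolution ψ (dataFreq a s) v)
    (hS : znorm (modulusSum a s v) < ∞)
    (hfin : ∫⁻ ξ, solErr a s v (216 * L * t) ξ ≠ ∞)
    {e : Fin 3 → Idx} (he : e = Sum.inl ∨ e = Sum.inr) :
    ∫ ξ, χ ξ * ψ ((2 : ℝ) ^ (-j) • ξ) * testFun e ξ (v t ξ) ≤
      -(∫ ξ, χ ξ * ψ ((2 : ℝ) ^ (-j) • ξ)) * (interactionConst * (a ^ 2 * s.card)) +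
        4 * (∫⁻ ξ, solErr a s v (216 * L * t) ξ).toReal := by
  have hm := measurable_solErr (a := a) (s := s) hv.measurable (216 * L * t)
  have hi := (enorm_integral_testFun_le hψ h (r := 1) one_ne_zero (e := e)
    fun a => hv.hasFourierDensity hψ ht a).1
  have hcψ : Continuous fun ξ : E3 => χ ξ * ψ ((2 : ℝ) ^ (-j) • ξ) :=
    h.continuous.mul (by fun_prop)
  have hiχ : Integrable fun ξ : E3 => χ ξ * ψ ((2 : ℝ) ^ (-j) • ξ) :=
    hcψ.integrable_of_hasCompactSupport h.hasCompactSupport.mul_right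
  have hie : Integrable fun ξ => (solErr a s v (216 * L * t) ξ).toReal :=
    integrable_toReal_of_lintegral_ne_top hm.aemeasurable hfin
  refine (integral_mono_ae hi ((hiχ.neg.mul_const _).add (hie.const_mul 4))
    (mul_testFun_solution_le hψ h hL0 hL ha hs ht hst hv.measurable hv.eq hS hfin he)).trans ?_
  refine le_of_eq ?_
  have e1 := integral_add (hiχ.neg.mul_const (interactionConst * (a ^ 2 * s.card)))
    (hie.const_mul 4)
  refine e1.trans ?_
  rw [integral_const_mul, integral_mul_const, integral_toReal hm.aemeasurable
    (ae_lt_top hm hfin)]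
  congr 2
  exact integral_neg _

/-- Bounds for the solution with small data concentrated at frequencies larger than `2^K`. -/
theorem solution_bounds (hψ : IsDyadicPartition ψ) {K : ℕ} (hK : 7 ≤ K) (hs : ∀ k ∈ s, K ≤ k)
    {δ x : ℝ} (ha : 0 ≤ a) (hδ : 0 ≤ δ) (haδ : a ^ 2 * s.card = δ ^ 2)
    (hx : x = dataConst.toReal * δ) (hsmall : 2592 * x ≤ 1) (hL0 : 0 ≤ L) :
    ∃ v, IsFreqSolution ψ (dataFreq a s) v ∧ vnorm v ≤ 2 * ENNReal.ofReal (3 * x) ∧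
      864 * ENNReal.ofReal (3 * x) ≤ 1 ∧ znorm (modulusSum a s v) < ∞ ∧
      ∫⁻ ξ, solErr a s v (216 * L * (2⁻¹) ^ K) ξ ≤ ENNReal.ofReal
        (1512 * (48 * (2⁻¹) ^ K + 3888 * x) * x ^ 2 + 10584 * L * (2⁻¹) ^ K * x ^ 2) := by
  have hx0 : 0 ≤ x := by rw [hx]; positivity
  have hs7 : ∀ k ∈ s, 7 ≤ k := fun k hk => hK.trans (hs k hk)
  set T : ℝ := (2⁻¹) ^ K with hT
  have hT0 : 0 < T := by positivity
  have hz : znorm (heatMaj fun ξ => ‖dataFreq a s ξ‖ₑ) ≤ ENNReal.ofReal x := by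
    refine (znorm_heatMaj_dataFreq_le hψ hs7 ha hδ haδ).trans (le_of_eq ?_)
    rw [hx, ENNReal.ofReal_mul ENNReal.toReal_nonneg, ENNReal.ofReal_toReal dataConst_ne_top]
  have hm := measurable_dataFreq a s
  have hlin : vnorm (linEvol (dataFreq a s)) ≤ ENNReal.ofReal (3 * x) := by
    rw [ENNReal.ofReal_mul (by norm_num), ENNReal.ofReal_ofNat]
    exact (vnorm_linEvol_le _).trans (mul_le_mul_right hz _)
  have hε : 864 * ENNReal.ofReal (3 * x) ≤ 1 := by
    have h8 : (864 : ℝ≥0∞) = ENNReal.ofReal 864 := by simp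
    rw [h8, ← ENNReal.ofReal_mul (by norm_num), ENNReal.ofReal_le_one]
    linarith
  obtain ⟨v, hvm, hvn, hveq⟩ := exists_mild hm hlin hε
  have hdata : ∑' j : ℤ, (2 ^ (-(j : ℝ)) * blk ψ j fun ξ => ‖dataFreq a s ξ‖ₑ) *
      (2 ^ (-(j : ℝ)) * blk ψ j fun ξ => ‖dataFreq a s ξ‖ₑ) < ∞ := by
    refine lt_of_le_of_lt (ENNReal.tsum_le_tsum fun j =>
      mul_le_mul' (two_rpow_mul_blk_dataFreq_le hψ ha j) (two_rpow_mul_blk_dataFreq_le hψ ha j))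
      ((tsum_dataSeq_sq_le hψ hs7 ha).trans_lt ?_)
    exact ENNReal.mul_lt_top (ENNReal.pow_lt_top (ENNReal.mul_lt_top (by simp)
      ballVol_ne_top.lt_top)) ENNReal.ofReal_lt_top
  have hv6 : vnorm v ≤ ENNReal.ofReal (6 * x) := by
    refine hvn.trans (le_of_eq ?_)
    rw [show 6 * x = 2 * (3 * x) by ring, ENNReal.ofReal_mul (p := 2) (by norm_num),
      ENNReal.ofReal_ofNat]
  have hvfin : vnorm v < ∞ := hv6.trans_lt ENNReal.ofReal_lt_top
  have hh : vnorm (heatEvol (dataFreq a s)) ≤ ENNReal.ofReal x := (vnorm_heatEvol_le _).trans hz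
  have hhm := measurable_heatEvol hm
  have hS : znorm (modulusSum a s v) ≤ ENNReal.ofReal (7 * x) := by
    refine (znorm_modulusSum_le hvm).trans ((add_le_add hv6 hh).trans (le_of_eq ?_))
    rw [← ENNReal.ofReal_add (by positivity) hx0]
    congr 1
    ring
  -- The solution differs from the heat flow by the linear comparison error, of order `2^{-K} x`,
  -- and by its Duhamel term, of order `x²`. Here `3888 = 108 · 6²`.
  have hW : vnorm (fun t ξ => v t ξ - heatEvol (dataFreq a s) t ξ) ≤
      ENNReal.ofReal ((48 * T + 3888 * x) * x) := by
    have e : vnorm (fun t ξ => v t ξ - heatEvol (dataFreq a s) t ξ) =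
        vnorm (fun t ξ => (linEvol (dataFreq a s) t ξ - heatEvol (dataFreq a s) t ξ) -
          duh v t ξ) := by
      congr 1
      ext1 t
      ext1 ξ
      rw [hveq]
      abel
    rw [e]
    have h1 := vnorm_linEvol_sub_heatEvol_le (g := dataFreq a s) (R := 2 ^ K)
      (one_le_pow₀ one_le_two) (fun ξ hξ => two_pow_le_norm_of_dataFreq_ne_zero hK hs hξ)
      (sum_mul_dataVec a s)
    have h2 := vnorm_duh_le hvm hvfin
    calc _ ≤ vnorm (fun t ξ => linEvol (dataFreq a s) t ξ - heatEvol (dataFreq a s) t ξ) +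
          vnorm (duh v) := vnorm_sub_le ((measurable_linEvol hm).sub hhm) (measurable_duh hvm)
      _ ≤ ENNReal.ofReal (48 / 2 ^ K) * ENNReal.ofReal x +
          108 * (ENNReal.ofReal (6 * x) * ENNReal.ofReal (6 * x)) :=
          add_le_add (h1.trans (mul_le_mul_right hz _))
            (h2.trans (mul_le_mul_right (mul_le_mul' hv6 hv6) _))
      _ = _ := by
          have h108 : (108 : ℝ≥0∞) = ENNReal.ofReal 108 := by simp
          rw [h108, ← ENNReal.ofReal_mul (by positivity), ← ENNReal.ofReal_mul (by positivity),
            ← ENNReal.ofReal_mul (by positivity), ← ENNReal.ofReal_add (by positivity)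
            (by positivity), hT, inv_pow]
          congr 1
          ring
  refine ⟨v, ⟨hm, hvm, hdata, hvfin, hveq⟩, hvn, hε, hS.trans_lt ENNReal.ofReal_lt_top, ?_⟩
  refine (lintegral_errMaj_le (measurable_enorm_sub hvm hhm) (measurable_modulusSum hvm) _).trans ?_
  calc _ ≤ 216 * (ENNReal.ofReal ((48 * T + 3888 * x) * x) * ENNReal.ofReal (7 * x)) +
        ENNReal.ofReal (216 * L * T) * (ENNReal.ofReal (7 * x) * ENNReal.ofReal (7 * x)) :=
        add_le_add (mul_le_mul_right (mul_le_mul' hW hS) _)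
          (mul_le_mul_right (mul_le_mul' hS hS) _)
    _ = _ := by
        have h216 : (216 : ℝ≥0∞) = ENNReal.ofReal 216 := by simp
        rw [h216, ← ENNReal.ofReal_mul (by positivity), ← ENNReal.ofReal_mul (by positivity),
          ← ENNReal.ofReal_mul (by positivity), ← ENNReal.ofReal_mul (by positivity),
          ← ENNReal.ofReal_add (by positivity) (by positivity)]
        congr 1
        ring

/-- Norm inflation: the solutions with these data are bounded below at the time `2^{-K}`. -/
theorem exists_inflation (hψ : IsDyadicPartition ψ) {r : ℝ≥0∞} (hr : r ≠ 0) :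
    ∃ (δ c : ℝ) (K₀ : ℕ) (ε : ℝ≥0∞), 0 < δ ∧ 0 < c ∧ 7 ≤ K₀ ∧ 864 * ε ≤ 1 ∧
      ∀ K, K₀ ≤ K → ∀ (s : Finset ℕ) (a : ℝ), (∀ k ∈ s, K ≤ k) → 0 ≤ a →
        a ^ 2 * s.card = δ ^ 2 → ∃ v, IsFreqSolution ψ (dataFreq a s) v ∧ vnorm v ≤ 2 * ε ∧
          ∀ e : Fin 3 → Idx, e = Sum.inl ∨ e = Sum.inr → ENNReal.ofReal c ≤
            besovNormVec ψ (-1) ∞ r fun k => toField v ((2⁻¹) ^ K) (e k) := by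
  obtain ⟨j, χ, h⟩ := exists_isTestFunction hψ
  obtain ⟨L, hL0, hL⟩ := exists_norm_linSymbol_mulVec_le
  set m : ℝ := ∫ ξ, χ ξ * ψ ((2 : ℝ) ^ (-j) • ξ) with hm
  have hm0 : 0 < m := h.integral_pos
  have hκ := interactionConst_pos
  set q : ℝ := interactionConst * m with hq
  have hq0 : 0 < q := mul_pos hκ hm0
  set d : ℝ := dataConst.toReal with hd
  have hd0 : 0 ≤ d := ENNReal.toReal_nonneg
  -- With `x = dδ`, four times the error bound of `solution_bounds` is exactly `(A 2^{-K} + B δ)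
  -- δ²`. The main term is `q δ²`, so `A 2^{-K}` and `B δ` each have to stay below `q/4`.
  set B : ℝ := 4 * (1512 * 3888) * d ^ 3 with hB
  set A : ℝ := 4 * (1512 * 48 + 10584 * L) * d ^ 2 with hA
  have hB0 : 0 ≤ B := by positivity
  have hA0 : 0 ≤ A := by positivity
  -- The first bound makes the cubic error small, the second is the smallness condition of the fixed
  -- point, `2592 = 864 · 3`.
  set δ : ℝ := min (q / 4 / (B + 1)) (1 / (2592 * d + 1)) with hδdef
  have hδ0 : 0 < δ := lt_min (by positivity) (by positivity)
  have hδB : B * δ ≤ q / 4 := by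
    have h1 : δ ≤ q / 4 / (B + 1) := min_le_left _ _
    rw [le_div_iff₀ (by positivity)] at h1
    nlinarith
  have hδs : 2592 * (d * δ) ≤ 1 := by
    have h1 : δ ≤ 1 / (2592 * d + 1) := min_le_right _ _
    rw [le_div_iff₀ (by positivity)] at h1
    nlinarith
  obtain ⟨K₁, hK₁⟩ := exists_pow_lt_of_lt_one (show 0 < q / 4 / (A + 1) by positivity)
    (show (2⁻¹ : ℝ) < 1 by norm_num)
  have hC0 := testConst_ne_zero h
  have hCt := testConst_ne_top h
  have hC : 0 < (testConst h).toReal := ENNReal.toReal_pos hC0 hCt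
  refine ⟨δ, q * δ ^ 2 / 2 / (testConst h).toReal, max 7 K₁, ENNReal.ofReal (3 * (d * δ)), hδ0,
    by positivity, le_max_left _ _, ?_, fun K hK s a hs ha haδ => ?_⟩
  · have h8 : (864 : ℝ≥0∞) = ENNReal.ofReal 864 := by simp
    rw [h8, ← ENNReal.ofReal_mul (by norm_num), ENNReal.ofReal_le_one]
    linarith
  have hK7 : 7 ≤ K := (le_max_left _ _).trans hK
  obtain ⟨v, hv, hvn, -, hS, hE⟩ := solution_bounds hψ hK7 hs ha hδ0.le haδ rfl hδs hL0
  refine ⟨v, hv, hvn, fun e he => ?_⟩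
  set T : ℝ := (2⁻¹) ^ K with hT
  have hT0 : 0 < T := by positivity
  have hAT : A * T ≤ q / 4 := by
    have h1 : T ≤ (2⁻¹) ^ K₁ :=
      pow_le_pow_of_le_one (by norm_num) (by norm_num) ((le_max_right _ _).trans hK)
    have h2 := h1.trans hK₁.le
    rw [le_div_iff₀ (by positivity)] at h2
    nlinarith
  -- The time `2^{-K}` is long compared with `4^{-k}` for every bump, so all the interactions have
  -- saturated, and yet it tends to zero.
  have hst : ∀ k ∈ s, 1 ≤ 4 ^ k * T := by
    intro k hk
    calc (1 : ℝ) ≤ 2 ^ k := one_le_pow₀ one_le_two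
      _ = (2 ^ k * 2 ^ k) * (2⁻¹) ^ k := by
          rw [mul_assoc, ← mul_pow]; norm_num
      _ = 4 ^ k * (2⁻¹) ^ k := by rw [← mul_pow]; norm_num
      _ ≤ 4 ^ k * T := by
          refine mul_le_mul_of_nonneg_left ?_ (by positivity)
          exact pow_le_pow_of_le_one (by norm_num) (by norm_num) (hs k hk)
  have hfin := (hE.trans_lt ENNReal.ofReal_lt_top).ne
  have h1 := integral_testFun_solution_le hψ h hL0 hL ha (fun k hk => hK7.trans (hs k hk)) hT0.le
    hst hv hS hfin he
  have h2 := ENNReal.toReal_le_of_le_ofReal (by positivity) hE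
  have h3 : ∫ ξ, χ ξ * ψ ((2 : ℝ) ^ (-j) • ξ) * testFun e ξ (v T ξ) ≤ -(q * δ ^ 2 / 2) := by
    rw [haδ, ← hm] at h1
    have e4 : 4 * (1512 * (48 * T + 3888 * (d * δ)) * (d * δ) ^ 2 +
        10584 * L * T * (d * δ) ^ 2) = (A * T + B * δ) * δ ^ 2 := by
      rw [hA, hB]; ring
    have e5 : (A * T + B * δ) * δ ^ 2 ≤ q / 2 * δ ^ 2 :=
      mul_le_mul_of_nonneg_right (by linarith) (sq_nonneg _)
    have e6 : m * (interactionConst * δ ^ 2) = q * δ ^ 2 := by rw [hq]; ring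
    linarith
  have h4 := (enorm_integral_testFun_le hψ h hr (e := e)
    fun a => hv.hasFourierDensity hψ hT0.le a).2
  set Q := ∫ ξ, χ ξ * ψ ((2 : ℝ) ^ (-j) • ξ) * testFun e ξ (v T ξ) with hQ
  rw [ENNReal.ofReal_div_of_pos hC, ENNReal.ofReal_toReal hCt]
  refine ENNReal.div_le_of_le_mul' (le_trans ?_ h4)
  rw [← ofReal_norm]
  refine ENNReal.ofReal_le_ofReal ?_
  rw [Real.norm_eq_abs]
  linarith [neg_le_abs Q]

theorem seqNorm_mono {r : ℝ≥0∞} {b c : ℤ → ℝ≥0∞} (h : ∀ j, b j ≤ c j) :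
    seqNorm r b ≤ seqNorm r c := by
  unfold seqNorm
  split_ifs
  · exact iSup_mono h
  · gcongr
    exact h _

/-- The data are small in the Besov norm. -/
theorem besovNormVec_data_le (hψ : IsDyadicPartition ψ) {r : ℝ≥0∞} (hr : 2 < r)
    (hs : ∀ k ∈ s, 7 ≤ k) (hc : 1 ≤ s.card) (ha : 0 ≤ a)
    (hv : IsFreqSolution ψ (dataFreq a s) v) :
    besovNormVec ψ (-1) ∞ r (toField v 0) ≤
      6 * (18 * ballVol * ENNReal.ofReal (a * (s.card : ℝ) ^ (1 / r).toReal)) := by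
  have hb : ∀ i, besovNorm ψ (-1) ∞ r (toField v 0 i) ≤
      18 * ballVol * ENNReal.ofReal (a * (s.card : ℝ) ^ (1 / r).toReal) := by
    intro i
    have hd := hv.hasFourierDensity hψ le_rfl i
    refine (seqNorm_mono (c := dataSeq ψ a s) fun j => ?_).trans ?_
    · rw [mul_neg_one]
      refine le_trans (mul_le_mul_right ((distLpNorm_top_dyadicBlock_le hψ hd j).trans
        (blk_mono fun ξ => ?_)) _) (two_rpow_mul_blk_dataFreq_le hψ ha j)
      rw [hv.apply_zero]
      exact enorm_apply_le _ _
    · refine (seqNorm_le_of_le (n := s.card) (m := 18 * ballVol * ENNReal.ofReal a)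
        (by exact_mod_cast hc) hr (dataSeq_le hψ hs) ?_).trans (le_of_eq ?_)
      · rw [ENNReal.ofReal_natCast]
        exact tsum_dataSeq_le hψ
      · rw [mul_assoc, ← ENNReal.ofReal_mul ha]
  refine (Finset.sum_le_sum fun i _ => hb i).trans (le_of_eq ?_)
  simp

end Inflation

end

/-! ### Choice of the data and conclusion -/

/-- Applied with `q = 1/r`, this is the size of the data in `Ḃ^{-1}_{∞,r}`. The hypothesis `r > 2`
enters the smallness of the data exactly through `q < 1/2`. -/
theorem tendsto_div_sqrt_mul_rpow (δ : ℝ) {q : ℝ} (hq : q < 1 / 2) :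
    Tendsto (fun N : ℕ => δ / √((N : ℝ) + 1) * ((N : ℝ) + 1) ^ q) atTop (𝓝 0) := by
  have h1 : Tendsto (fun N : ℕ => (N : ℝ) + 1) atTop atTop :=
    tendsto_atTop_add_const_right _ _ tendsto_natCast_atTop_atTop
  have h2 := ((tendsto_rpow_neg_atTop (y := 1 / 2 - q) (by linarith)).comp h1).const_mul δ
  rw [mul_zero] at h2
  refine h2.congr fun N => ?_
  have hN : (0 : ℝ) < (N : ℝ) + 1 := by positivity
  simp only [Function.comp]
  rw [Real.sqrt_eq_rpow, show -(1 / 2 - q) = q - 1 / 2 by ring, Real.rpow_sub hN]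
  ring

theorem toReal_one_div_lt_half {r : ℝ≥0∞} (hr : 2 < r) : (1 / r).toReal < 1 / 2 := by
  have h : 1 / r < 2⁻¹ := by
    rw [one_div]
    exact ENNReal.inv_lt_inv.2 hr
  have := (ENNReal.toReal_lt_toReal h.ne_top (by simp)).2 h
  simpa using this

end Micropolar

end

theorem theorem1p6 (ψ : 𝓢(E3, ℝ)) (hψ : IsDyadicPartition ψ) (r : ℝ≥0∞) (hr : 2 < r) :
    ∃ (c₀ : ℝ) (f : ℕ → VField) (t : ℕ → ℝ) (U : ℕ → ℝ → VField),
      0 < c₀ ∧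
      (∀ N a, MemFB ψ (-1) 1 2 (f N a)) ∧
      (∀ N a, IsRealDist (f N a)) ∧
      (∀ N, IsDivFree (fun k => f N (Sum.inl k))) ∧
      Tendsto (fun N => besovNormVec ψ (-1) ∞ r (f N)) atTop (𝓝 0) ∧
      (∀ N, 0 < t N) ∧
      Tendsto t atTop (𝓝 0) ∧
      (∀ N, ∀ α : ℝ, 0 < α → α < 1 →
        IsSolution ψ α (f N) (U N) ∧
          ∀ V : ℝ → VField, IsSolution ψ α (f N) V → ∀ s, 0 ≤ s → V s = U N s) ∧
      ∀ N, ENNReal.ofReal c₀ ≤ besovNormVec ψ (-1) ∞ r (fun k => U N (t N) (Sum.inl k)) ∧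
        ENNReal.ofReal c₀ ≤ besovNormVec ψ (-1) ∞ r (fun k => U N (t N) (Sum.inr k)) := by
  obtain ⟨δ, c, K₀, ε, hδ, hc, hK₀, hε, H⟩ := exists_inflation hψ (zero_lt_two.trans hr).ne'
  -- The `N`-th data use `N + 1` consecutive scales starting at `K = N + K₀`. The number of scales
  -- makes the Besov norm tend to zero, and their position makes the time `2^{-K}` tend to zero.
  have hk : ∀ N : ℕ, ∀ k ∈ Finset.Ico (N + K₀) (N + K₀ + (N + 1)), N + K₀ ≤ k := fun N k hk =>
    (Finset.mem_Ico.1 hk).1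
  have hcard : ∀ N : ℕ, (Finset.Ico (N + K₀) (N + K₀ + (N + 1))).card = N + 1 := fun N => by
    simp
  have ha : ∀ N : ℕ, 0 ≤ δ / √((N : ℝ) + 1) := fun N => by positivity
  have hsq : ∀ N : ℕ, (δ / √((N : ℝ) + 1)) ^ 2 *
      (Finset.Ico (N + K₀) (N + K₀ + (N + 1))).card = δ ^ 2 := fun N => by
    rw [hcard, div_pow, Real.sq_sqrt (by positivity)]
    push_cast
    field_simp
  choose v hv hsmall hlow using fun N : ℕ => H (N + K₀) (Nat.le_add_left _ _) _ _ (hk N) (ha N)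
    (hsq N)
  have hsol := fun N α (h0 : 0 < α) (h1 : α < 1) =>
    (hv N).isSolution hψ (hsmall N) hε (fun ξ => dataFreq_neg _ _ ξ) (fun ξ => sum_mul_dataVec _ _ ξ) h0 h1
  refine ⟨c, fun N => toField (v N) 0, fun N => 2⁻¹ ^ (N + K₀), fun N => toField (v N), hc,
    fun N a => (hv N).memFB hψ le_rfl a, ?_, ?_, ?_, fun N => by positivity, ?_,
    fun N α h0 h1 => ⟨hsol N α h0 h1, fun V hV s hs => (hv N).eq_of_isSolution hψ h0 h1 hV hs⟩,
    fun N => ⟨hlow N _ (Or.inl rfl), hlow N _ (Or.inr rfl)⟩⟩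
  · exact fun N a => (hv N).isRealDist hψ (hsmall N) hε (fun ξ => dataFreq_neg _ _ ξ) le_rfl a
  · exact fun N => (hv N).isDivFree hψ (fun ξ => sum_mul_dataVec _ _ ξ) le_rfl
  · have hlim := ENNReal.tendsto_ofReal
      (tendsto_div_sqrt_mul_rpow δ (toReal_one_div_lt_half hr))
    have hlim' := ENNReal.Tendsto.const_mul (a := 6)
      (ENNReal.Tendsto.const_mul (a := 18 * ballVol) hlim
        (Or.inr (ENNReal.mul_ne_top (by simp) ballVol_ne_top))) (Or.inr (by simp))
    rw [ENNReal.ofReal_zero, mul_zero, mul_zero] at hlim'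
    refine tendsto_of_tendsto_of_tendsto_of_le_of_le tendsto_const_nhds hlim'
      (fun N => zero_le) fun N => ?_
    refine (besovNormVec_data_le hψ hr (fun k hks => ?_) ?_ (ha N) (hv N)).trans_eq ?_
    · have := hk N k hks
      omega
    · rw [hcard]
      omega
    · rw [hcard]
      push_cast
      rfl
  · exact (tendsto_pow_atTop_nhds_zero_of_lt_one (by norm_num) (by norm_num)).comp
      (tendsto_add_atTop_nat K₀)
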